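/- **Theorem.** Let $\mathbb{F}$ be a field of characteristic different from $2$, let $M=(m_{ij})$ be a symmetric matrix of order $n$ over $\mathbb{F}$, and let $G$ be its underlying graph, i.e. the graph with vertex set $\{1,\dots,n\}$ in which distinct vertices $i,j$ are adjacent if and only if $m_{ij}\neq 0$. Let $\mathcal{T}$ be a tree decomposition of $G$ of width $k$ with $|\mathcal{T}|$ nodes: a tree each of whose nodes carries a bag of vertices of $G$, such that every vertex lies in some bag, both ends of every edge of $G$ lie in a common bag, and for every vertex the nodes whose bags contain it induce a connected subgraph of the tree; the width is the maximum size of a bag minus one. The input consists of the list of the nonzero entries of $M$, the bags, and the edges of the tree, each list in arbitrary order. The algorithm `CongruentDiagonal` roots the tree, turns $\mathcal{T}$ into a nice tree decomposition (leaf, introduce, forget and join nodes, empty root bag) of the same width, orders the vertices so that a vertex forgotten earlier gets a larger label, and processes the nice tree bottom-up. Each node passes to its parent a box: a symmetric matrix $\begin{pmatrix}0&N^{(1)}\\ N^{(1)T}&N^{(2)}\end{pmatrix}$ whose rows are labelled by vertices, where the columns of $N^{(1)}$ and $N^{(2)}$ are labelled by the bag of the node and $N^{(1)}$ is in row echelon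 form without zero rows. A leaf creates a zero box; introducing a vertex adds a zero row and column; a join adds the matrices $N^{(2)}$ of the two children and merges their matrices $N^{(1)}$ into one echelon form; forgetting $v$ adds to the row and column of $v$ the entries $m_{uv}$ for $u$ in the bag of the child, and then, by simultaneous row and column operations, either diagonalizes the row of $v$, or diagonalizes it together with one row of $N^{(1)}$, or inserts it into $N^{(1)}$. Whenever a row $v$ becomes diagonal with diagonal entry $d_v$, the pair $(v,d_v)$ is appended to a global array, which is the output. Then the output contains exactly one pair $(v,d_v)$ for each vertex $v$, and the diagonal matrix $D=\operatorname{diag}(d_1,\dots,d_n)$ is congruent to $M$: there is a nonsingular matrix $P$ with $D=PMP^{T}$. The algorithm runs in time $O(k|\mathcal{T}|+k^2n)$, where for $k=0$ the factor $k$ is to be read as $1$; time is the number of elementary steps (operations and tests in the field and on integers, and accesses to cells of lists and arrays), and the implied constant is absolute. No assumption is made about the absence of accidental cancellations. Consequently, within the same time bound, one computes the determinant of $M$ (as $\prod_v d_v$), the rank of $M$ (as the number of nonzero $d_v$) and, when $\mathbb{F}$ is a subfield of $\mathbb{R}$, the inertia of $M$, i.e. the numbers of its positive, negative and zero eigenvalues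 counted with multiplicity (as the numbers of positive, negative and zero $d_v$). -/

import Mathlib

/-! ## Step counting

All procedures below are written in a small sequential language.  A value of type `Timed α` is the
result of a run together with the number of steps spent on it.  Both `ret` and the sequencing
operation charge one step; between two charges a procedure only performs a bounded number of
elementary operations: arithmetic operations and tests in the field, comparison and increment of
numbers, access to the first cell of a list, reading or writing one cell of an array, building one
node of a list or tree.  Everything whose cost depends on the size of its arguments (length,
reversal, copying, insertion, ...) is itself written as a recursive procedure in this language,
every recursive call being charged, and the creation of an array is charged with its length.
Arrays are used in a single-threaded way. -/

/-- The result of a computation together with the number of steps it took. -/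
structure Timed (α : Type*) where
  val : α
  time : ℕ

namespace Timed

/-- Return a result, in one step. -/
def ret {α : Type*} (a : α) : Timed α := ⟨a, 1⟩

/-- Run `x`, then run `f` on its result; passing on the result costs one step. -/
def bind {α : Type*} {β : Type*} (x : Timed α) (f : α → Timed β) : Timed β :=
  ⟨(f x.val).val, x.time + (f x.val).time + 1⟩

end Timed

infixr:55 " >>- " => Timed.bind

namespace CongDiag

open Timed

/-- Create an array of length `n`, at cost `n + 1`. -/
def newArray {α : Type*} (n : ℕ) (a : α) : Timed (Vector α n) := ⟨Vector.replicate n a, n + 1⟩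

/-- Put `x` in front of the list stored in cell `i`. -/
def pushAt {α : Type*} {n : ℕ} (A : Vector (List α) n) (i : Fin n) (x : α) :
    Timed (Vector (List α) n) :=
  ret (A.set i.1 (x :: A.get i) i.2)

/-! ### Elementary list procedures -/

def lengthT {α : Type*} : List α → Timed ℕ
  | [] => ret 0
  | _ :: l => lengthT l >>- fun r => ret (r + 1)

def dropT {α : Type*} : ℕ → List α → Timed (List α)
  | 0, l => ret l
  | _ + 1, [] => ret []
  | r + 1, _ :: l => dropT r l >>- fun l' => ret l'

/-- `revT l acc` is the reversal of `l`, followed by `acc`. -/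
def revT {α : Type*} : List α → List α → Timed (List α)
  | [], acc => ret acc
  | a :: l, acc => revT l (a :: acc) >>- fun r => ret r

/-- Insert `x` at position `p`. -/
def insertT {α : Type*} : ℕ → α → List α → Timed (List α)
  | 0, x, l => ret (x :: l)
  | _ + 1, x, [] => ret [x]
  | p + 1, x, a :: l => insertT p x l >>- fun r => ret (a :: r)

/-- Split off the last element (`d` serves as last element of the empty list). -/
def unsnoc {α : Type*} (d : α) : List α → Timed (List α × α)
  | [] => ret ([], d)
  | [a] => ret ([], a)
  | a :: b :: l => unsnoc d (b :: l) >>- fun r => ret (a :: r.1, r.2)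

/-- A list of copies of `x`, as long as the given list. -/
def constT {α β : Type*} (x : β) : List α → Timed (List β)
  | [] => ret []
  | _ :: l => constT x l >>- fun r => ret (x :: r)

/-! ### Rooting the tree -/

/-- Rooted ordered forests, in the first-child / next-sibling representation. -/
inductive Forest (α : Type*) where
  | nil : Forest α
  | node (a : α) (children siblings : Forest α) : Forest α

/-- Adjacency lists from a list of edges. -/
def adjacency {m : ℕ} : List (Fin m × Fin m) → Timed (Vector (List (Fin m)) m)
  | [] => newArray m []
  | e :: es => adjacency es >>- fun A => pushAt A e.1 e.2 >>- fun A => pushAt A e.2 e.1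

/-- Depth-first search: the forest of the subtrees hanging below the node `x`, which was entered
from `p`.  The first argument bounds the depth of the search. -/
def grow {m : ℕ} (A : Vector (List (Fin m)) m) : ℕ → Fin m → Fin m → Timed (Forest (Fin m))
  | 0, _, _ => ret Forest.nil
  | d + 1, p, x =>
    (A.get x).foldr
      (fun y rest =>
        if y = p then rest >>- fun s => ret s
        else grow A d x y >>- fun c => rest >>- fun s => ret (Forest.node y c s))
      (ret Forest.nil)

/-- Root the tree with the given edges at its first node. -/
def rootTree {m : ℕ} (edges : List (Fin m × Fin m)) : Timed (Forest (Fin m)) :=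
  if h : 0 < m then
    adjacency edges >>- fun A =>
    grow A m ⟨0, h⟩ ⟨0, h⟩ >>- fun c =>
    ret (Forest.node ⟨0, h⟩ c Forest.nil)
  else ret Forest.nil

/-! ### Labelling the vertices and sorting the bags

The vertices get the labels `1, …, n` in the order in which a preorder traversal of the rooted tree
meets them.  Thus a vertex that will be forgotten earlier gets a larger label: when a vertex is
forgotten, it has the largest label in its bag.  From then on "increasing order" always refers to
these labels. -/

/-- The labels given so far (`0` stands for unlabelled), the labelled vertices in decreasing order
of their labels, and their number. -/
structure Labelling (n : ℕ) where
  lab : Vector ℕ n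
  order : List (Fin n)
  count : ℕ

def labelBag {n : ℕ} : List (Fin n) → Labelling n → Timed (Labelling n)
  | [], L => ret L
  | v :: vs, L =>
    if L.lab.get v = 0 then
      labelBag vs ⟨L.lab.set v.1 (L.count + 1) v.2, v :: L.order, L.count + 1⟩ >>- fun L' => ret L'
    else labelBag vs L >>- fun L' => ret L'

def labelForest {n m : ℕ} (bags : Vector (List (Fin n)) m) :
    Forest (Fin m) → Labelling n → Timed (Labelling n)
  | Forest.nil, L => ret L
  | Forest.node i c s, L =>
    labelBag (bags.get i) L >>- fun L => labelForest bags c L >>- fun L => labelForest bags s L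

/-- Put `x` in front of each of the cells in the list. -/
def spread {α : Type*} {b : ℕ} (x : α) : List (Fin b) → Vector (List α) b →
    Timed (Vector (List α) b)
  | [], R => ret R
  | i :: l, R => pushAt R i x >>- fun R => spread x l R

/-- Bucket sort: for every `j` in the list, in this order, put `j` in front of all cells `i` that
are listed in cell `j` of `A`. -/
def transpose {a b : ℕ} (A : Vector (List (Fin b)) a) : List (Fin a) → Vector (List (Fin a)) b →
    Timed (Vector (List (Fin a)) b)
  | [], R => ret R
  | j :: js, R => spread j (A.get j) R >>- fun R => transpose A js R

/-- Sort all bags in increasing order; `order` lists the vertices in decreasing order. -/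
def sortBags {n m : ℕ} (bags : Vector (List (Fin n)) m) (order : List (Fin n)) :
    Timed (Vector (List (Fin n)) m) :=
  newArray n [] >>- fun R =>
  transpose bags (List.finRange m) R >>- fun occurrences =>
  newArray m [] >>- fun S =>
  transpose occurrences order S

/-- Distribute the nonzero entries over the columns. -/
def bucket {F : Type*} {n : ℕ} : List (Fin n × Fin n × F) → Timed (Vector (List (Fin n × F)) n)
  | [] => newArray n []
  | e :: es => bucket es >>- fun A => pushAt A e.2.1 (e.1, e.2.2)

def spreadRow {F : Type*} {n : ℕ} (v : Fin n) : List (Fin n × F) → Vector (List (Fin n × F)) n →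
    Timed (Vector (List (Fin n × F)) n)
  | [], R => ret R
  | e :: l, R => pushAt R e.1 (v, e.2) >>- fun R => spreadRow v l R

def transposeRows {F : Type*} {n : ℕ} (A : Vector (List (Fin n × F)) n) :
    List (Fin n) → Vector (List (Fin n × F)) n → Timed (Vector (List (Fin n × F)) n)
  | [], R => ret R
  | v :: vs, R => spreadRow v (A.get v) R >>- fun R => transposeRows A vs R

/-- The sparse rows of the matrix, each sorted by increasing column label. -/
def sortRows {F : Type*} {n : ℕ} (entries : List (Fin n × Fin n × F)) (order : List (Fin n)) :
    Timed (Vector (List (Fin n × F)) n) :=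
  bucket entries >>- fun A => newArray n [] >>- fun R => transposeRows A order R

/-! ### Nice tree decompositions -/

/-- Rooted binary trees with leaf, introduce, forget and join nodes.  The bags are determined by
the bags of the leaves. -/
inductive NiceTree (V : Type*) where
  | leaf (B : List V) : NiceTree V
  | introduce (v : V) (t : NiceTree V) : NiceTree V
  | forget (v : V) (t : NiceTree V) : NiceTree V
  | join (t₁ t₂ : NiceTree V) : NiceTree V

section
variable {V : Type*} [DecidableEq V]

/-- For a sorted bag `b` and the sorted bag `P` of its parent: the sorted lists of the elements of
`P` outside `b`, and of the elements of `b` outside `P` (these have larger labels than all elements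
of `P`). -/
def splitBag : List V → List V → Timed (List V × List V)
  | [], b => ret ([], b)
  | p :: P, [] => ret (p :: P, [])
  | p :: P, x :: b =>
    if p = x then splitBag P b >>- fun r => ret r
    else splitBag P (x :: b) >>- fun r => ret (p :: r.1, r.2)

/-- Add to the sorted bag `b` the first `r` elements of the sorted bag `P` that are not in `b`. -/
def enlarge : ℕ → List V → List V → Timed (List V)
  | _, [], b => ret b
  | _, _ :: _, [] => ret []
  | r, p :: P, x :: b =>
    if p = x then enlarge r P b >>- fun B => ret (p :: B)
    else match r with
      | 0 => enlarge 0 P (x :: b) >>- fun B => ret B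
      | r + 1 => enlarge r P (x :: b) >>- fun B => ret (p :: B)

/-- Put a path above the root of `t` that alternately forgets an element of the first list and
introduces an element of the second, and finally forgets what is left of the first list. -/
def climb : NiceTree V → List V → List V → Timed (NiceTree V)
  | t, [], _ => ret t
  | t, f :: fs, [] => climb (NiceTree.forget f t) fs [] >>- fun t' => ret t'
  | t, f :: fs, v :: vs =>
    climb (NiceTree.introduce v (NiceTree.forget f t)) fs vs >>- fun t' => ret t'

/-- A binary tree of join nodes above the given trees, which all have root bag `B`. -/
def joinAll (B : List V) : List (NiceTree V) → Timed (NiceTree V)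
  | [] => ret (NiceTree.leaf B)
  | [t] => ret t
  | t :: t' :: ts => joinAll B (t' :: ts) >>- fun j => ret (NiceTree.join t j)

/-- Turn the subtrees of a node with bag `P` into nice trees with root bag `P`, added to `acc`.
A node whose bag is contained in the bag of its parent is merged with the parent; a bag that is
smaller than the bag of the parent is enlarged by elements of the latter; a node with several
children becomes a binary tree of join nodes; and an edge becomes a path of forget and introduce
nodes. -/
def nice {m : ℕ} (bags : Vector (List V) m) :
    Forest (Fin m) → List V → List (NiceTree V) → Timed (List (NiceTree V))
  | Forest.nil, _, acc => ret acc
  | Forest.node i c s, P, acc =>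
    splitBag P (bags.get i) >>- fun r =>
    match r.2 with
    | [] => nice bags c P acc >>- fun acc => nice bags s P acc
    | f :: fs =>
      lengthT P >>- fun p =>
      lengthT (bags.get i) >>- fun q =>
      enlarge (p - q) P (bags.get i) >>- fun B =>
      dropT (p - q) r.1 >>- fun vs =>
      revT (f :: fs) [] >>- fun gs =>
      nice bags c B [] >>- fun ts =>
      joinAll B ts >>- fun t =>
      climb t gs vs >>- fun t' =>
      nice bags s P (t' :: acc)

/-- A nice tree decomposition, with empty root bag, from a rooted one with sorted bags. -/
def niceTree {m : ℕ} (bags : Vector (List V) m) (T : Forest (Fin m)) : Timed (NiceTree V) :=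
  nice bags T [] [] >>- fun ts => joinAll [] ts

end

/-! ### Boxes -/

/-- A position in an echelon form: empty, or the row `(v, a, r)` that has its pivot in the given
column, where `v` is the vertex that labels the row, `a ≠ 0` the pivot and `r` the list of the
entries to the right of the pivot. -/
abbrev Slot (V F : Type*) := Option (V × F × List F)

/-- A box `(N⁽¹⁾, N⁽²⁾)`: the sorted list of the type-ii vertices, the matrix `N⁽¹⁾` in row echelon
form (for each column, the row with pivot in this column, if there is one), and the rows of the
symmetric matrix `N⁽²⁾`. -/
structure Box (V F : Type*) where
  cols : List V
  ech : List (Slot V F)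
  sym : List (List F)

section
variable {V F : Type*} [Field F] [DecidableEq F]

/-- `r - c • s` -/
def subMul (c : F) : List F → List F → Timed (List F)
  | a :: r, b :: s => subMul c r s >>- fun t => ret ((a - c * b) :: t)
  | _, _ => ret []

def addRow : List F → List F → Timed (List F)
  | a :: r, b :: s => addRow r s >>- fun t => ret ((a + b) :: t)
  | _, _ => ret []

def addMat : List (List F) → List (List F) → Timed (List (List F))
  | r :: A, s :: B => addRow r s >>- fun t => addMat A B >>- fun C => ret (t :: C)
  | _, _ => ret []

/-- Use the diagonal entry `d`, with the entries `y` in its row, to eliminate these entries: the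
second list runs over the rows of the remaining matrix, the first over the entries of `y` that are
to be eliminated from them. -/
def pivotWith (d : F) (y : List F) : List F → List (List F) → Timed (List (List F))
  | a :: as, r :: A => subMul (a / d) r y >>- fun t => pivotWith d y as A >>- fun B => ret (t :: B)
  | _, _ => ret []

def allZero : List F → Timed Bool
  | [] => ret true
  | a :: r => if a = 0 then allZero r >>- fun z => ret z else ret false

def zeroMat : List V → List V → Timed (List (List F))
  | [], _ => ret []
  | _ :: l, B => constT 0 B >>- fun z => zeroMat l B >>- fun A => ret (z :: A)

def leafBox (B : List V) : Timed (Box V F) :=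
  constT none B >>- fun E => zeroMat B B >>- fun A => ret ⟨B, E, A⟩

/-- The position of a vertex of label `x` in a sorted list. -/
def position {n : ℕ} (lab : Vector ℕ n) (x : ℕ) : List (Fin n) → Timed ℕ
  | [] => ret 0
  | c :: cs => if lab.get c < x then position lab x cs >>- fun p => ret (p + 1) else ret 0

/-- Insert a zero column at position `p` into an echelon form. -/
def insertCol : ℕ → List (Slot V F) → Timed (List (Slot V F))
  | 0, E => ret (none :: E)
  | _ + 1, [] => ret [none]
  | p + 1, none :: E => insertCol p E >>- fun E' => ret (none :: E')
  | p + 1, some (v, a, r) :: E =>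
    insertT p 0 r >>- fun r' => insertCol p E >>- fun E' => ret (some (v, a, r') :: E')

def insertAll (p : ℕ) : List (List F) → Timed (List (List F))
  | [] => ret []
  | r :: A => insertT p 0 r >>- fun r' => insertAll p A >>- fun A' => ret (r' :: A')

def introduceBox {n : ℕ} (lab : Vector ℕ n) (v : Fin n) (N : Box (Fin n) F) :
    Timed (Box (Fin n) F) :=
  position lab (lab.get v) N.cols >>- fun p =>
  insertT p v N.cols >>- fun cols =>
  insertCol p N.ech >>- fun E =>
  insertAll p N.sym >>- fun A =>
  constT 0 cols >>- fun z =>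
  insertT p z A >>- fun A' =>
  ret ⟨cols, E, A'⟩

/-- Insert the row with label `v` into an echelon form: while its first nonzero entry lies in the
column of the pivot of another row, use that row to eliminate it.  If the row becomes zero, append
`(v, 0)` to the array `D`. -/
def insertRow (v : V) : List F → List (Slot V F) → List (V × F) →
    Timed (List (Slot V F) × List (V × F))
  | [], E, D => ret (E, (v, 0) :: D)
  | _ :: _, [], D => ret ([], (v, 0) :: D)
  | a :: r, s :: E, D =>
    if a = 0 then insertRow v r E D >>- fun x => ret (s :: x.1, x.2)
    else match s with
      | none => ret (some (v, a, r) :: E, D)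
      | some (w, b, q) =>
        subMul (a / b) r q >>- fun r' =>
        insertRow v r' E D >>- fun x => ret (some (w, b, q) :: x.1, x.2)

/-- Insert all rows of the second echelon form into the first. -/
def mergeEch : List (Slot V F) → List (Slot V F) → List (V × F) →
    Timed (List (Slot V F) × List (V × F))
  | E, [], D => ret (E, D)
  | [], _ :: _, D => ret ([], D)
  | s :: E, none :: E', D => mergeEch E E' D >>- fun x => ret (s :: x.1, x.2)
  | none :: E, some w :: E', D => mergeEch E E' D >>- fun x => ret (some w :: x.1, x.2)
  | some (v, b, q) :: E, some (w, a, r) :: E', D =>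
    subMul (a / b) r q >>- fun r' =>
    insertRow w r' E D >>- fun x =>
    mergeEch x.1 E' x.2 >>- fun y => ret (some (v, b, q) :: y.1, y.2)

def joinBox (N N' : Box V F) (D : List (V × F)) : Timed (Box V F × List (V × F)) :=
  mergeEch N.ech N'.ech D >>- fun x =>
  addMat N.sym N'.sym >>- fun A =>
  ret (⟨N.cols, x.1, A⟩, x.2)

/-- Remove the last column `x` from an echelon form.  If `x` is nonzero, let `u` be the last row in
which it is nonzero, with entry `a`: use this entry to eliminate the other nonzero entries of `x`,
remove the row `u`, and return it as `(u, a, y)`, where `y` are its other entries. -/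
def elimCol : List (Slot V F) → Timed (List (Slot V F) × Option (V × F × List F))
  | [] => ret ([], none)
  | [none] => ret ([], none)
  | [some (u, a, _)] => ret ([], some (u, a, []))
  | s :: s' :: E =>
    elimCol (s' :: E) >>- fun x =>
    match s, x.2 with
    | none, none => ret (none :: x.1, none)
    | none, some (u, a, y) => ret (none :: x.1, some (u, a, 0 :: y))
    | some (w, b, q), none =>
      unsnoc 0 q >>- fun t =>
      if t.2 = 0 then ret (some (w, b, t.1) :: x.1, none)
      else ret (none :: x.1, some (w, t.2, b :: t.1))
    | some (w, b, q), some (u, a, y) =>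
      unsnoc 0 q >>- fun t =>
      if t.2 = 0 then ret (some (w, b, t.1) :: x.1, some (u, a, 0 :: y))
      else subMul (t.2 / a) t.1 y >>- fun q' =>
        ret (some (w, b, q') :: x.1, some (u, a, 0 :: y))

/-- The entries, in the given columns, of a sparse row, whose entries outside these columns come
last. -/
def gather [DecidableEq V] : List V → List (V × F) → Timed (List F)
  | [], _ => ret []
  | _ :: cs, [] => gather cs [] >>- fun g => ret (0 :: g)
  | c :: cs, (u, a) :: r =>
    if u = c then gather cs r >>- fun g => ret (a :: g)
    else gather cs ((u, a) :: r) >>- fun g => ret (0 :: g)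

def stripLast : List (List F) → Timed (List (List F))
  | [] => ret []
  | r :: A => unsnoc 0 r >>- fun t => stripLast A >>- fun A' => ret (t.1 :: A')

/-- Forget the vertex `v`, which is the last column of the box; `row` is its sparse row in the
input matrix. -/
def forgetBox [DecidableEq V] (row : List (V × F)) (v : V) (N : Box V F) (D : List (V × F)) :
    Timed (Box V F × List (V × F)) :=
  gather N.cols row >>- fun g =>
  unsnoc [] N.sym >>- fun S =>
  addRow S.2 g >>- fun z =>
  unsnoc 0 z >>- fun yd =>
  stripLast S.1 >>- fun A =>
  unsnoc v N.cols >>- fun cs =>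
  elimCol N.ech >>- fun x =>
  match x.2 with
  | none =>
    allZero yd.1 >>- fun b =>
    if b then ret (⟨cs.1, x.1, A⟩, (v, yd.2) :: D)
    else if yd.2 ≠ 0 then
      pivotWith yd.2 yd.1 yd.1 A >>- fun A' =>
      ret (⟨cs.1, x.1, A'⟩, (v, yd.2) :: D)
    else
      insertRow v yd.1 x.1 D >>- fun e =>
      ret (⟨cs.1, e.1, A⟩, e.2)
  | some (u, a, yu) =>
    subMul (yd.2 / (2 * a)) yd.1 yu >>- fun y₁ =>
    subMul (-(1 / 2)) yu y₁ >>- fun yu' =>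
    subMul 1 y₁ yu' >>- fun y₂ =>
    pivotWith a yu' yu' A >>- fun A₁ =>
    pivotWith (-a) y₂ y₂ A₁ >>- fun A₂ =>
    ret (⟨cs.1, x.1, A₂⟩, (v, -a) :: (u, a) :: D)

/-- Process a nice tree bottom-up; `D` is the global array of diagonal elements. -/
def process {n : ℕ} (lab : Vector ℕ n) (rows : Vector (List (Fin n × F)) n) :
    NiceTree (Fin n) → List (Fin n × F) → Timed (Box (Fin n) F × List (Fin n × F))
  | NiceTree.leaf B, D => leafBox B >>- fun N => ret (N, D)
  | NiceTree.introduce v t, D =>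
    process lab rows t D >>- fun x => introduceBox lab v x.1 >>- fun N => ret (N, x.2)
  | NiceTree.forget v t, D =>
    process lab rows t D >>- fun x => forgetBox (rows.get v) v x.1 x.2
  | NiceTree.join t₁ t₂, D =>
    process lab rows t₁ D >>- fun x =>
    process lab rows t₂ x.2 >>- fun y =>
    joinBox x.1 y.1 y.2

end

/-! ### The algorithm -/

/-- The input: the list of the nonzero entries `(i, j, m_ij)` of a matrix of order `n`, and a tree
decomposition with `m` nodes, given by the list of the vertices in each bag and the list of the
edges of the tree. -/
structure Input (F : Type*) (n m : ℕ) where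
  entries : List (Fin n × Fin n × F)
  bags : Vector (List (Fin n)) m
  edges : List (Fin m × Fin m)

/-- The algorithm `CongruentDiagonal`.  The output is the array of the pairs `(v, d_v)`. -/
def congruentDiagonal {F : Type*} [Field F] [DecidableEq F] {n m : ℕ} (I : Input F n m) :
    Timed (List (Fin n × F)) :=
  rootTree I.edges >>- fun T =>
  newArray n 0 >>- fun lab₀ =>
  labelForest I.bags T ⟨lab₀, [], 0⟩ >>- fun L =>
  sortBags I.bags L.order >>- fun bags =>
  sortRows I.entries L.order >>- fun rows =>
  niceTree bags T >>- fun t =>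
  process L.lab rows t [] >>- fun x =>
  ret x.2

/-- The product of the diagonal elements. -/
def prodDiag {V F : Type*} [Field F] : List (V × F) → Timed F
  | [] => ret 1
  | x :: D => prodDiag D >>- fun p => ret (x.2 * p)

/-- The number of nonzero diagonal elements. -/
def countDiag {V F : Type*} [Field F] [DecidableEq F] : List (V × F) → Timed ℕ
  | [] => ret 0
  | x :: D => countDiag D >>- fun r => ret (if x.2 = 0 then r else r + 1)

/-- The numbers of positive, negative and zero diagonal elements. -/
def signDiag {V F : Type*} [Field F] [LinearOrder F] : List (V × F) → Timed (ℕ × ℕ × ℕ)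
  | [] => ret (0, 0, 0)
  | x :: D => signDiag D >>- fun r =>
    ret (if 0 < x.2 then (r.1 + 1, r.2.1, r.2.2)
      else if x.2 < 0 then (r.1, r.2.1 + 1, r.2.2) else (r.1, r.2.1, r.2.2 + 1))

/-- Computation of the determinant. -/
def detAlg {F : Type*} [Field F] [DecidableEq F] {n m : ℕ} (I : Input F n m) : Timed F :=
  congruentDiagonal I >>- fun D => prodDiag D

/-- Computation of the rank. -/
def rankAlg {F : Type*} [Field F] [DecidableEq F] {n m : ℕ} (I : Input F n m) : Timed ℕ :=
  congruentDiagonal I >>- fun D => countDiag D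

/-- Computation of the inertia. -/
def inertiaAlg {F : Type*} [Field F] [LinearOrder F] {n m : ℕ} (I : Input F n m) :
    Timed (ℕ × ℕ × ℕ) :=
  congruentDiagonal I >>- fun D => signDiag D

/-! ## The mathematical notions -/

/-- The underlying graph of a matrix: distinct `i`, `j` are adjacent if the entry `i j` (or `j i`,
which is the same for a symmetric matrix) is nonzero. -/
def underlyingGraph {F : Type*} [Field F] {n : ℕ} (M : Matrix (Fin n) (Fin n) F) :
    SimpleGraph (Fin n) :=
  SimpleGraph.fromRel fun i j => M i j ≠ 0

/-- Tree decompositions with `m` nodes. -/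
structure TreeDecomposition {V : Type*} (G : SimpleGraph V) (m : ℕ) where
  tree : SimpleGraph (Fin m)
  isTree : tree.IsTree
  bag : Fin m → Finset V
  cover : ∀ v, ∃ i, v ∈ bag i
  edge : ∀ v w, G.Adj v w → ∃ i, v ∈ bag i ∧ w ∈ bag i
  connected : ∀ v, (tree.induce {i | v ∈ bag i}).Preconnected

/-- The width: one less than the maximum size of a bag. -/
def TreeDecomposition.width {V : Type*} {G : SimpleGraph V} {m : ℕ} (T : TreeDecomposition G m) :
    ℕ :=
  (Finset.univ.sup fun i => (T.bag i).card) - 1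

/-- `I` lists, in any order, the nonzero entries of `M`, the bags of `T` and the edges of the tree
(each edge once, in one of its two orientations). -/
structure Input.Encodes {F : Type*} [Field F] {n m : ℕ} (I : Input F n m)
    (M : Matrix (Fin n) (Fin n) F) (T : TreeDecomposition (underlyingGraph M) m) : Prop where
  entries_nodup : I.entries.Nodup
  mem_entries : ∀ i j a, (i, j, a) ∈ I.entries ↔ a = M i j ∧ a ≠ 0
  bags_nodup : ∀ i, (I.bags.get i).Nodup
  mem_bags : ∀ i v, v ∈ I.bags.get i ↔ v ∈ T.bag i
  edges_nodup : (I.edges.map fun e => s(e.1, e.2)).Nodup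
  mem_edges : ∀ i j, s(i, j) ∈ I.edges.map (fun e => s(e.1, e.2)) ↔ T.tree.Adj i j

/-- The inertia of a real symmetric matrix: the numbers of its positive, negative and zero
eigenvalues, with multiplicity. -/
noncomputable def inertia {n : ℕ} (M : Matrix (Fin n) (Fin n) ℝ) : ℕ × ℕ × ℕ :=
  (M.charpoly.roots.countP (0 < ·), M.charpoly.roots.countP (· < 0), M.charpoly.roots.count 0)

/-- The bound `k m + k² n`, where `k` is the width, `m` the number of nodes and `n` the order of the
matrix; a width `0` is read as `1`. -/
def bound (k m n : ℕ) : ℕ := max k 1 * m + max k 1 ^ 2 * n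

end CongDiag

set_option linter.unusedSectionVars false

namespace CongDiag

open Timed

/-! ## Elementary procedures -/

/-! Matrices are replaced by quadratic forms. In characteristic different from 2, congruence of
symmetric matrices is linear substitution in their forms (`eq_of_quadratic_eq`,
`exists_congruence`). The form of `M` is cut into one piece per vertex `v`, containing the diagonal
term of `v` and the mixed terms of `v` with vertices of smaller label (`vertexForm`,
`sum_vertexForm`). Forgetting `v` brings exactly this piece into play.

The invariant `process_spec` says that, at every node, the sum of the pieces of the vertices
forgotten so far below it turns into the form of the box plus a diagonal form, by a substitution of
determinant 1 that changes only forgotten variables (`Cg`). This locality makes the steps compose: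
whatever does not involve the changed variables is carried along untouched (`Cg.frame`). Bag
variables are not forgotten, and by `NiceOK.closed` the pieces of one child of a join do not involve
the variables forgotten below the other. At the root the bag is empty, hence so is the box, and only
the diagonal form is left.

Each step at a node is a product of transvections (`Cg.shear`). Row operations in an echelon form
are transvections in the row variables. Forgetting `v` leaves a few cases: the row is already
diagonal, its diagonal entry is a pivot (Schur complement), it is a row for the echelon form, or `v`
is coupled to an echelon row `u`, and then `x u` and `x v` form a hyperbolic pair (`Cg.hyperbolic`).
Cancellations merely move a row from one case to another.

For the running time, inserting a single row can cost `K ^ 2`, and a join inserts many rows. Each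
elimination, however, moves a pivot to the right, so it is paid for by the potential `pot`, the
number of entries from the pivots on. Forget and introduce nodes raise the potential by at most the
bag size, and joins create none; thus a node costs `K ^ 2` on average (`process_time`). The nice
tree has at most four nodes per vertex plus one, because every path put into it forgets a new vertex
(`TreesOK`, `niceTree_spec`). The nodes of the given tree therefore only enter through the
preprocessing, at cost `K` each, and reading the matrix is cheap because it has at most `2 * K * n`
nonzero entries (`entries_length_le`).

The combinatorial input comes from acyclicity. A connected set of nodes that meets two sides of a
tree node contains that node (`branch_crossing`, `branch_meeting`), which gives the running
intersection property of the rooted tree. Preorder labels then ensure that, when a vertex is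
forgotten, its neighbours of smaller label are in the bag (`DecompOK.mem_bag`).

The substitution has determinant 1, so the determinant of `M` is that of the diagonal matrix; rank
is a congruence invariant, and so is inertia, by Sylvester's law. -/

@[simp] theorem bind_val {α : Type*} {β : Type*} (x : Timed α) (f : α → Timed β) :
    (x >>- f).val = (f x.val).val := rfl

@[simp] theorem bind_time {α : Type*} {β : Type*} (x : Timed α) (f : α → Timed β) :
    (x >>- f).time = x.time + (f x.val).time + 1 := rfl

@[simp] theorem ret_val {α : Type*} (a : α) : (ret a).val = a := rfl

@[simp] theorem ret_time {α : Type*} (a : α) : (ret a).time = 1 := rfl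

@[simp] theorem lengthT_val {α : Type*} (l : List α) : (lengthT l).val = l.length := by
  induction l <;> simp_all [lengthT]

theorem lengthT_time {α : Type*} (l : List α) : (lengthT l).time = 2 * l.length + 1 := by
  induction l <;> simp_all [lengthT]; omega

@[simp] theorem dropT_val {α : Type*} (r : ℕ) (l : List α) : (dropT r l).val = l.drop r := by
  induction l generalizing r <;> cases r <;> simp_all [dropT]

theorem dropT_time {α : Type*} (r : ℕ) (l : List α) : (dropT r l).time ≤ 2 * l.length + 1 := by
  induction l generalizing r with
  | nil => cases r <;> simp [dropT]
  | cons a l ih =>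
    cases r with
    | zero => simp [dropT]
    | succ r => have := ih r; simp [dropT]; omega

@[simp] theorem revT_val {α : Type*} (l acc : List α) : (revT l acc).val = l.reverse ++ acc := by
  induction l generalizing acc <;> simp_all [revT]

theorem revT_time {α : Type*} (l acc : List α) : (revT l acc).time = 2 * l.length + 1 := by
  induction l generalizing acc <;> simp_all [revT]; omega

theorem insertT_append {α : Type*} (x : α) (l₁ l₂ : List α) :
    (insertT l₁.length x (l₁ ++ l₂)).val = l₁ ++ x :: l₂ := by
  induction l₁ with
  | nil => cases l₂ <;> simp [insertT]
  | cons a l ih => simp [insertT, ih]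

theorem insertT_time {α : Type*} (p : ℕ) (x : α) (l : List α) :
    (insertT p x l).time ≤ 2 * l.length + 1 := by
  induction l generalizing p with
  | nil => cases p <;> simp [insertT]
  | cons a l ih =>
    cases p with
    | zero => simp [insertT]
    | succ p => have := ih p; simp [insertT]; omega

theorem length_insertT {α : Type*} (p : ℕ) (x : α) (l : List α) :
    (insertT p x l).val.length = l.length + 1 := by
  induction l generalizing p <;> cases p <;> simp_all [insertT]

@[simp] theorem unsnoc_append {α : Type*} (d : α) (l : List α) (a : α) :
    (unsnoc d (l ++ [a])).val = (l, a) := by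
  induction l with
  | nil => simp [unsnoc]
  | cons b l ih => cases l <;> simp_all [unsnoc]

theorem unsnoc_time {α : Type*} (d : α) (l : List α) : (unsnoc d l).time ≤ 2 * l.length + 1 := by
  induction l with
  | nil => simp [unsnoc]
  | cons b l ih => cases l <;> simp_all [unsnoc]; omega

theorem constT_val {α β : Type*} (x : β) (l : List α) :
    (constT x l).val = List.replicate l.length x := by
  induction l <;> simp_all [constT, List.replicate_succ]

theorem constT_time {α β : Type*} (x : β) (l : List α) :
    (constT x l).time = 2 * l.length + 1 := by
  induction l <;> simp_all [constT]; omega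

section
variable {V F : Type*} [Field F]

@[simp] theorem length_subMul (c : F) (r s : List F) :
    (subMul c r s).val.length = min r.length s.length := by
  induction r generalizing s <;> cases s <;> simp_all [subMul]

theorem subMul_time (c : F) (r s : List F) : (subMul c r s).time ≤ 2 * r.length + 1 := by
  induction r generalizing s with
  | nil => simp [subMul]
  | cons a r ih =>
    cases s with
    | nil => simp [subMul]
    | cons b s => have := ih s; simp [subMul]; omega

@[simp] theorem length_addRow (r s : List F) :
    (addRow r s).val.length = min r.length s.length := by
  induction r generalizing s <;> cases s <;> simp_all [addRow]

theorem addRow_time (r s : List F) : (addRow r s).time ≤ 2 * r.length + 1 := by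
  induction r generalizing s with
  | nil => simp [addRow]
  | cons a r ih =>
    cases s with
    | nil => simp [addRow]
    | cons b s => have := ih s; simp [addRow]; omega

theorem addRow_append_singleton (r s : List F) (a b : F) (h : r.length = s.length) :
    (addRow (r ++ [a]) (s ++ [b])).val = (addRow r s).val ++ [a + b] := by
  induction r generalizing s with
  | nil => cases s <;> simp_all [addRow]
  | cons c r ih => cases s <;> simp_all [addRow]

/-! ## Linear, bilinear and quadratic forms -/

/-- The linear form with the given coefficients. -/
def dot : List V → List F → ((V → F) →ₗ[F] F)
  | c :: cs, a :: r => a • LinearMap.proj c + dot cs r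
  | _, _ => 0

@[simp] theorem dot_nil_left (r : List F) : dot ([] : List V) r = 0 := by simp [dot]

@[simp] theorem dot_nil_right (cs : List V) : dot cs ([] : List F) = 0 := by cases cs <;> simp [dot]

@[simp] theorem dot_cons (c : V) (cs : List V) (a : F) (r : List F) (x : V → F) :
    dot (c :: cs) (a :: r) x = a * x c + dot cs r x := by simp [dot]

theorem dot_congr (cs : List V) (r : List F) {x y : V → F} (h : ∀ c ∈ cs, x c = y c) :
    dot cs r x = dot cs r y := by
  induction cs generalizing r <;> cases r <;> simp_all

theorem dot_append (cs ds : List V) (r s : List F) (h : r.length = cs.length) (x : V → F) :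
    dot (cs ++ ds) (r ++ s) x = dot cs r x + dot ds s x := by
  induction cs generalizing r <;> cases r <;> simp_all [add_assoc]

theorem dot_subMul (cs : List V) (c : F) (r s : List F) (h : r.length = s.length) (x : V → F) :
    dot cs (subMul c r s).val x = dot cs r x - c * dot cs s x := by
  induction r generalizing cs s with
  | nil => cases s <;> simp_all [subMul]
  | cons a r ih =>
    cases s with
    | nil => simp at h
    | cons b s =>
      cases cs with
      | nil => simp
      | cons d cs => simp [subMul, ih cs s (by simpa using h)]; ring

theorem dot_addRow (cs : List V) (r s : List F) (h : r.length = s.length) (x : V → F) :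
    dot cs (addRow r s).val x = dot cs r x + dot cs s x := by
  induction r generalizing cs s with
  | nil => cases s <;> simp_all [addRow]
  | cons a r ih =>
    cases s with
    | nil => simp at h
    | cons b s =>
      cases cs with
      | nil => simp
      | cons d cs => simp [addRow, ih cs s (by simpa using h)]; ring

theorem dot_insertT_zero (cs ds : List V) (v : V) (r : List F)
    (h : r.length = cs.length + ds.length) (x : V → F) :
    dot (cs ++ v :: ds) (insertT cs.length 0 r).val x = dot (cs ++ ds) r x := by
  induction cs generalizing r with
  | nil => cases r <;> simp [insertT]
  | cons c cs ih =>
    cases r with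
    | nil => simp at h; omega
    | cons a r => simp [insertT, ih r (by simp at h; omega)]

theorem dot_replicate_zero (cs : List V) (n : ℕ) (x : V → F) :
    dot cs (List.replicate n 0) x = 0 := by
  induction cs generalizing n with
  | nil => simp
  | cons c cs ih => cases n <;> simp [List.replicate_succ, ih]

theorem dot_eq_zero_of_all (cs : List V) (r : List F) (h : ∀ a ∈ r, a = 0) (x : V → F) :
    dot cs r x = 0 := by
  induction cs generalizing r <;> cases r <;> simp_all

/-- The bilinear form whose matrix is given by a list of rows. -/
def bil : List V → List V → List (List F) → (V → F) → (V → F) → F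
  | c :: cs, ds, r :: A, x, y => x c * dot ds r y + bil cs ds A x y
  | _, _, _, _, _ => 0

@[simp] theorem bil_nil_left (ds : List V) (A : List (List F)) (x y : V → F) :
    bil [] ds A x y = 0 := by simp [bil]

@[simp] theorem bil_nil_right (cs ds : List V) (x y : V → F) :
    bil cs ds [] x y = 0 := by cases cs <;> simp [bil]

@[simp] theorem bil_cons (c : V) (cs ds : List V) (r : List F) (A : List (List F)) (x y : V → F) :
    bil (c :: cs) ds (r :: A) x y = x c * dot ds r y + bil cs ds A x y := by simp [bil]

theorem bil_congr (cs ds : List V) (A : List (List F)) {x y x' y' : V → F}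
    (h : ∀ c ∈ cs, x c = x' c) (h' : ∀ c ∈ ds, y c = y' c) :
    bil cs ds A x y = bil cs ds A x' y' := by
  induction cs generalizing A with
  | nil => simp
  | cons c cs ih =>
    cases A with
    | nil => simp
    | cons r A =>
      simp [ih A fun d hd => h d (List.mem_cons_of_mem _ hd), h c, dot_congr ds r h']

theorem bil_append (cs cs' ds : List V) (A B : List (List F)) (h : A.length = cs.length)
    (x y : V → F) : bil (cs ++ cs') ds (A ++ B) x y = bil cs ds A x y + bil cs' ds B x y := by
  induction cs generalizing A <;> cases A <;> simp_all [add_assoc]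

/-- All rows of the matrix have length `n`. -/
def RowsLen (n : ℕ) (A : List (List F)) : Prop := ∀ r ∈ A, r.length = n

@[simp] theorem rowsLen_nil (n : ℕ) : RowsLen n ([] : List (List F)) := by simp [RowsLen]

@[simp] theorem rowsLen_cons (n : ℕ) (r : List F) (A : List (List F)) :
    RowsLen n (r :: A) ↔ r.length = n ∧ RowsLen n A := by simp [RowsLen]

/-- `bil` stops at the end of its shortest list, so the identity of forms holds for arbitrary label
lists; only the two matrices must have matching shapes. -/
theorem addMat_spec (cs ds : List V) (n : ℕ) (A B : List (List F)) (h : A.length = B.length)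
    (hA : RowsLen n A) (hB : RowsLen n B) :
    (addMat A B).val.length = A.length ∧ RowsLen n (addMat A B).val ∧
    (∀ x y, bil cs ds (addMat A B).val x y = bil cs ds A x y + bil cs ds B x y) ∧
    (addMat A B).time ≤ (2 * n + 4) * A.length + 1 := by
  induction A generalizing B cs with
  | nil => cases B <;> simp_all [addMat]
  | cons r A ih =>
    cases B with
    | nil => simp at h
    | cons s B =>
      simp only [rowsLen_cons] at hA hB
      have key := fun cs => ih cs B (by simpa using h) hA.2 hB.2
      refine ⟨?_, ?_, ?_, ?_⟩
      · simp [addMat, (key cs).1]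
      · simp [addMat, (key cs).2.1, hA.1, hB.1]
      · intro x y
        cases cs with
        | nil => simp
        | cons c cs =>
          simp only [addMat, bind_val, ret_val, bil_cons, (key cs).2.2.1]
          rw [dot_addRow _ _ _ (by rw [hA.1, hB.1])]
          ring
      · have h1 := (key cs).2.2.2
        have h2 := addRow_time r s
        rw [hA.1] at h2
        simp only [addMat, bind_time, ret_time, List.length_cons]
        rw [Nat.mul_add]
        omega

/-- Elimination subtracts a rank-one matrix. For `as = y` this yields the Schur complement of the
pivot `d`; the two lists are kept apart because the recursion consumes `as` along with the rows. -/
theorem pivotWith_spec (cs ds : List V) (n : ℕ) (d : F) (y as : List F) (A : List (List F))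
    (h : as.length = A.length) (hy : y.length = n) (hA : RowsLen n A) :
    (pivotWith d y as A).val.length = A.length ∧ RowsLen n (pivotWith d y as A).val ∧
    (∀ x z, bil cs ds (pivotWith d y as A).val x z =
      bil cs ds A x z - dot cs as x * dot ds y z / d) ∧
    (pivotWith d y as A).time ≤ (2 * n + 4) * A.length + 1 := by
  induction A generalizing as cs with
  | nil => cases as <;> simp_all [pivotWith]
  | cons r A ih =>
    cases as with
    | nil => simp at h
    | cons a as =>
      simp only [rowsLen_cons] at hA
      have key := fun cs => ih cs as (by simpa using h) hA.2
      refine ⟨?_, ?_, ?_, ?_⟩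
      · simp [pivotWith, (key cs).1]
      · simp [pivotWith, (key cs).2.1, hA.1, hy]
      · intro x z
        cases cs with
        | nil => simp
        | cons c cs =>
          simp only [pivotWith, bind_val, ret_val, bil_cons, (key cs).2.2.1, dot_cons]
          rw [dot_subMul _ _ _ _ (by rw [hA.1, hy])]
          ring
      · have h1 := (key cs).2.2.2
        have h2 := subMul_time (a / d) r y
        rw [hA.1] at h2
        simp only [pivotWith, bind_time, ret_time, List.length_cons]
        rw [Nat.mul_add]
        omega

theorem allZero_val [DecidableEq F] (r : List F) : (allZero r).val = true ↔ ∀ a ∈ r, a = 0 := by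
  induction r with
  | nil => simp [allZero]
  | cons a r ih => by_cases h : a = 0 <;> simp [allZero, h, ih]

theorem allZero_time [DecidableEq F] (r : List F) : (allZero r).time ≤ 2 * r.length + 1 := by
  induction r with
  | nil => simp [allZero]
  | cons a r ih => by_cases h : a = 0 <;> simp [allZero, h]; omega

theorem zeroMat_spec (l B cs ds : List V) :
    (zeroMat l B : Timed (List (List F))).val.length = l.length ∧
    RowsLen B.length (zeroMat l B : Timed (List (List F))).val ∧
    (∀ x y, bil cs ds (zeroMat l B : Timed (List (List F))).val x y = 0) ∧
    (zeroMat l B : Timed (List (List F))).time = (2 * B.length + 4) * l.length + 1 := by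
  induction l generalizing cs with
  | nil => simp [zeroMat]
  | cons a l ih =>
    refine ⟨?_, ?_, ?_, ?_⟩
    · simp [zeroMat, (ih cs).1]
    · simp [zeroMat, (ih cs).2.1, constT_val]
    · intro x y
      cases cs with
      | nil => simp
      | cons c cs => simp [zeroMat, (ih cs).2.2.1, constT_val, dot_replicate_zero]
    · simp only [zeroMat, bind_time, ret_time, constT_time, (ih cs).2.2.2, List.length_cons]
      ring

theorem insertAll_spec (cs ds ds' : List V) (v : V) (A : List (List F))
    (hA : RowsLen (ds.length + ds'.length) A) :
    (insertAll ds.length A).val.length = A.length ∧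
    RowsLen (ds.length + ds'.length + 1) (insertAll ds.length A).val ∧
    (∀ x y, bil cs (ds ++ v :: ds') (insertAll ds.length A).val x y =
      bil cs (ds ++ ds') A x y) ∧
    (insertAll ds.length A).time ≤ (2 * (ds.length + ds'.length) + 4) * A.length + 1 := by
  induction A generalizing cs with
  | nil => simp [insertAll]
  | cons r A ih =>
    simp only [rowsLen_cons] at hA
    have key := fun cs => ih cs hA.2
    refine ⟨?_, ?_, ?_, ?_⟩
    · simp [insertAll, (key cs).1]
    · simp [insertAll, (key cs).2.1, length_insertT, hA.1]
    · intro x y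
      cases cs with
      | nil => simp
      | cons c cs =>
        simp [insertAll, (key cs).2.2.1, dot_insertT_zero _ _ _ _ hA.1]
    · have h1 := (key cs).2.2.2
      have h2 := insertT_time ds.length 0 r
      rw [hA.1] at h2
      simp only [insertAll, bind_time, ret_time, List.length_cons]
      rw [Nat.mul_add _ A.length]
      omega

/-- The procedure discards the last column, but the form still sees it, so the column survives as an
existential `l`. It is chosen before the labels, so that one column serves all of them; symmetry
will identify it with the last row. -/
theorem stripLast_spec (n : ℕ) (v : V) (A : List (List F)) (hA : RowsLen (n + 1) A) :
    (stripLast A).val.length = A.length ∧ RowsLen n (stripLast A).val ∧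
    (∃ l : List F, l.length = A.length ∧ ∀ cs ds : List V, ds.length = n → ∀ x y,
      bil cs (ds ++ [v]) A x y = bil cs ds (stripLast A).val x y + dot cs l x * y v) ∧
    (stripLast A).time ≤ (2 * n + 6) * A.length + 1 := by
  induction A with
  | nil => simp [stripLast]
  | cons r A ih =>
    simp only [rowsLen_cons] at hA
    obtain ⟨h1, h2, ⟨l, hl, h3⟩, h4⟩ := ih hA.2
    obtain ⟨s, a, rfl⟩ : ∃ s a, r = s ++ [a] := by
      rcases List.eq_nil_or_concat' r with h | h
      · simp [h] at hA
      · exact h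
    have hs : s.length = n := by simpa using hA.1
    refine ⟨?_, ?_, ⟨a :: l, by simp [hl], ?_⟩, ?_⟩
    · simp [stripLast, h1]
    · simp [stripLast, h2, hs]
    · intro cs ds hds x y
      cases cs with
      | nil => simp
      | cons c cs =>
        simp only [stripLast, bind_val, ret_val, unsnoc_append, bil_cons, dot_cons]
        rw [h3 cs ds hds, dot_append _ _ _ _ (by rw [hs, hds])]
        simp
        ring
    · have h5 := unsnoc_time (0 : F) (s ++ [a])
      rw [hA.1] at h5
      simp only [stripLast, bind_time, ret_time, List.length_cons]
      rw [Nat.mul_add]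
      omega

/-! ## Congruence of quadratic forms -/

/-- `q` does not depend on the coordinates in `W`. -/
def Indep (W : List V) (q : (V → F) → F) : Prop :=
  ∀ x y, (∀ j ∉ W, x j = y j) → q x = q y

/-- The form `q'` arises from `q` by a unimodular substitution that only changes the variables
in `W`. -/
def Cg (W : List V) (q q' : (V → F) → F) : Prop :=
  ∃ L : (V → F) →ₗ[F] (V → F), LinearMap.det L = 1 ∧ (∀ x, ∀ j ∉ W, L x j = x j) ∧
    ∀ x, q' x = q (L x)

theorem Cg.of_eq {W : List V} {q q' : (V → F) → F} (h : ∀ x, q' x = q x) : Cg W q q' :=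
  ⟨LinearMap.id, by simp, by simp, by simpa using h⟩

theorem Cg.trans {W : List V} {q q' q'' : (V → F) → F} (h : Cg W q q') (h' : Cg W q' q'') :
    Cg W q q'' := by
  obtain ⟨L, h1, h2, h3⟩ := h
  obtain ⟨L', h1', h2', h3'⟩ := h'
  refine ⟨L ∘ₗ L', by simp [LinearMap.det_comp, h1, h1'], fun x j hj => ?_, fun x => ?_⟩
  · simp [h2 _ j hj, h2' _ j hj]
  · simp [h3', h3]

theorem Cg.mono {W W' : List V} (h : W ⊆ W') {q q' : (V → F) → F} (hq : Cg W q q') :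
    Cg W' q q' := by
  obtain ⟨L, h1, h2, h3⟩ := hq
  exact ⟨L, h1, fun x j hj => h2 x j fun hW => hj (h hW), h3⟩

/-- The substitution moves only coordinates in `W`, which `g` does not see, so a summand `g`
survives it unchanged. -/
theorem Cg.add_right {W : List V} {q q' g : (V → F) → F} (h : Cg W q q') (hg : Indep W g) :
    Cg W (fun x => q x + g x) (fun x => q' x + g x) := by
  obtain ⟨L, h1, h2, h3⟩ := h
  exact ⟨L, h1, h2, fun x => by simp only [h3]; rw [hg x (L x) fun j hj => (h2 x j hj).symm]⟩

theorem Cg.congr_left {W : List V} {q p q' : (V → F) → F} (h : Cg W q q') (e : ∀ x, p x = q x) :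
    Cg W p q' := by rwa [show p = q from funext e]

theorem Cg.congr_right {W : List V} {q p q' : (V → F) → F} (h : Cg W q q') (e : ∀ x, p x = q' x) :
    Cg W q p := by rwa [show p = q' from funext e]

/-- The transvection `x ↦ x + l x • e_w` has determinant `1 + l e_w`, so the condition on `l` makes
it unimodular. On matrices this is one simultaneous row and column operation; every elimination
below is an instance. -/
theorem Cg.shear [Fintype V] [DecidableEq V] {W : List V} {w : V} (hw : w ∈ W)
    (l : (V → F) →ₗ[F] F) (hl : l (Pi.single w 1) = 0) {q q' : (V → F) → F}
    (h : ∀ x, q' x = q (x + l x • Pi.single w 1)) : Cg W q q' := by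
  refine ⟨LinearMap.transvection l (Pi.single w 1), ?_, fun x j hj => ?_, fun x => ?_⟩
  · rw [LinearMap.transvection.det, hl, add_zero]
  · have : j ≠ w := fun e => hj (e ▸ hw)
    simp [LinearMap.transvection.apply, this]
  · rw [h, LinearMap.transvection.apply]

theorem Indep.add {W : List V} {p q : (V → F) → F} (hp : Indep W p) (hq : Indep W q) :
    Indep W fun x => p x + q x := fun x y h => by
  show p x + q x = p y + q y
  rw [hp x y h, hq x y h]

theorem Indep.mul {W : List V} {p q : (V → F) → F} (hp : Indep W p) (hq : Indep W q) :
    Indep W fun x => p x * q x := fun x y h => by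
  show p x * q x = p y * q y
  rw [hp x y h, hq x y h]

theorem Indep.const (W : List V) (c : F) : Indep W fun _ => c := fun _ _ _ => rfl

theorem Indep.coord {W : List V} {v : V} (h : v ∉ W) : Indep W fun x : V → F => x v :=
  fun _ _ hxy => hxy v h

theorem Indep.dot {W cs : List V} (h : ∀ c ∈ cs, c ∉ W) (r : List F) :
    Indep W fun x : V → F => dot cs r x :=
  fun _ _ hxy => dot_congr cs r fun c hc => hxy c (h c hc)

theorem Indep.bil {W cs ds : List V} (h : ∀ c ∈ cs, c ∉ W) (h' : ∀ c ∈ ds, c ∉ W)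
    (A : List (List F)) : Indep W fun x : V → F => bil cs ds A x x :=
  fun _ _ hxy => bil_congr cs ds A (fun c hc => hxy c (h c hc)) (fun c hc => hxy c (h' c hc))

/-- The diagonal form given by the output array. -/
def diagForm (D : List (V × F)) (x : V → F) : F := (D.map fun p => p.2 * x p.1 ^ 2).sum

@[simp] theorem diagForm_nil (x : V → F) : diagForm ([] : List (V × F)) x = 0 := by simp [diagForm]

@[simp] theorem diagForm_cons (p : V × F) (D : List (V × F)) (x : V → F) :
    diagForm (p :: D) x = p.2 * x p.1 ^ 2 + diagForm D x := by simp [diagForm]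

@[simp] theorem diagForm_append (D D' : List (V × F)) (x : V → F) :
    diagForm (D ++ D') x = diagForm D x + diagForm D' x := by simp [diagForm]

theorem Indep.diagForm {W : List V} {D : List (V × F)} (h : ∀ v ∈ D.map Prod.fst, v ∉ W) :
    Indep W (diagForm D) := fun x y hxy => by
  induction D with
  | nil => simp
  | cons p D ih =>
    simp only [List.map_cons, List.forall_mem_cons] at h
    simp [ih h.2, hxy _ h.1]

/-- The form of the matrix with zero upper left block whose upper right block is in echelon form. -/
def echForm : List V → List (Slot V F) → (V → F) → F
  | _ :: cs, none :: E, x => echForm cs E x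
  | c :: cs, some (w, a, r) :: E, x => 2 * x w * (a * x c + dot cs r x) + echForm cs E x
  | _, _, _ => 0

@[simp] theorem echForm_nil_left (E : List (Slot V F)) (x : V → F) : echForm [] E x = 0 := by
  simp [echForm]

@[simp] theorem echForm_nil_right (cs : List V) (x : V → F) :
    echForm cs ([] : List (Slot V F)) x = 0 := by cases cs <;> simp [echForm]

@[simp] theorem echForm_none (c : V) (cs : List V) (E : List (Slot V F)) (x : V → F) :
    echForm (c :: cs) (none :: E) x = echForm cs E x := by simp [echForm]

@[simp] theorem echForm_some (c : V) (cs : List V) (w : V) (a : F) (r : List F)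
    (E : List (Slot V F)) (x : V → F) : echForm (c :: cs) (some (w, a, r) :: E) x =
      2 * x w * (a * x c + dot cs r x) + echForm cs E x := by simp [echForm]

/-- The labels of the rows of an echelon form. -/
def rowLabels : List (Slot V F) → List V
  | [] => []
  | none :: E => rowLabels E
  | some (w, _, _) :: E => w :: rowLabels E

@[simp] theorem rowLabels_nil : rowLabels ([] : List (Slot V F)) = [] := rfl
@[simp] theorem rowLabels_none (E : List (Slot V F)) : rowLabels (none :: E) = rowLabels E := rfl
@[simp] theorem rowLabels_some (w : V) (a : F) (r : List F) (E : List (Slot V F)) :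
    rowLabels (some (w, a, r) :: E) = w :: rowLabels E := rfl

/-- Pivots are nonzero, and rows extend to the last column. -/
def EchOK : List (Slot V F) → Prop
  | [] => True
  | none :: E => EchOK E
  | some (_, a, r) :: E => a ≠ 0 ∧ r.length = E.length ∧ EchOK E

@[simp] theorem echOK_nil : EchOK ([] : List (Slot V F)) := trivial
@[simp] theorem echOK_none (E : List (Slot V F)) : EchOK (none :: E) ↔ EchOK E := Iff.rfl
@[simp] theorem echOK_some (w : V) (a : F) (r : List F) (E : List (Slot V F)) :
    EchOK (some (w, a, r) :: E) ↔ a ≠ 0 ∧ r.length = E.length ∧ EchOK E := Iff.rfl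

theorem Indep.echForm {W cs : List V} {E : List (Slot V F)} (h : ∀ c ∈ cs, c ∉ W)
    (h' : ∀ v ∈ rowLabels E, v ∉ W) : Indep W (echForm cs E) := fun x y hxy => by
  induction E generalizing cs with
  | nil => simp
  | cons s E ih =>
    cases cs with
    | nil => simp
    | cons c cs =>
      simp only [List.forall_mem_cons] at h
      rcases s with _ | ⟨w, a, r⟩
      · simpa using ih h.2 h'
      · simp only [rowLabels_some, List.forall_mem_cons] at h'
        simp [ih h.2 h'.2, hxy c h.1, hxy w h'.1, dot_congr cs r fun c hc => hxy c (h.2 c hc)]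

end


/-! ### Row and column operations on echelon forms -/

section
variable {V F : Type*} [Field F] [DecidableEq F] [Fintype V] [DecidableEq V]

theorem Indep.shear_eq {W : List V} {q : (V → F) → F} (hq : Indep W q) {w : V} (hw : w ∈ W)
    (x : V → F) (s : F) : q (x + s • Pi.single w 1) = q x :=
  hq _ _ fun j hj => by
    have : j ≠ w := fun e => hj (e ▸ hw)
    simp [this]

theorem dot_shear {cs : List V} {w : V} (h : w ∉ cs) (r : List F) (x : V → F) (s : F) :
    dot cs r (x + s • Pi.single w 1) = dot cs r x :=
  (Indep.dot (W := [w]) (fun c hc e => h (List.mem_singleton.1 e ▸ hc)) r).shear_eq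
    (by simp) x s

theorem dot_single {cs : List V} {w : V} (h : w ∉ cs) (r : List F) :
    dot cs r (Pi.single w (1 : F)) = 0 := by
  rw [show (Pi.single w (1 : F)) = 0 + (1 : F) • Pi.single w (1 : F) by simp, dot_shear h]; simp

theorem echForm_shear {cs : List V} {w : V} (h : w ∉ cs) {E : List (Slot V F)}
    (h' : w ∉ rowLabels E) (x : V → F) (s : F) :
    echForm cs E (x + s • Pi.single w 1) = echForm cs E x :=
  (Indep.echForm (W := [w]) (fun c hc e => h (List.mem_singleton.1 e ▸ hc))
    (fun c hc e => h' (List.mem_singleton.1 e ▸ hc))).shear_eq (by simp) x s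

theorem bil_shear {cs : List V} {w : V} (h : w ∉ cs) (A : List (List F)) (x : V → F) (s : F) :
    bil cs cs A (x + s • Pi.single w 1) (x + s • Pi.single w 1) = bil cs cs A x x :=
  (Indep.bil (W := [w]) (fun c hc e => h (List.mem_singleton.1 e ▸ hc))
    (fun c hc e => h (List.mem_singleton.1 e ▸ hc)) A).shear_eq (by simp) x s

/-- The number of entries from the pivots on, in all rows of an echelon form. -/
def pot : List (Slot V F) → ℕ
  | [] => 0
  | none :: E => pot E
  | some (_, _, r) :: E => r.length + 1 + pot E

@[simp] theorem pot_nil : pot ([] : List (Slot V F)) = 0 := rfl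
@[simp] theorem pot_none (E : List (Slot V F)) : pot (none :: E) = pot E := rfl
@[simp] theorem pot_some (w : V) (a : F) (r : List F) (E : List (Slot V F)) :
    pot (some (w, a, r) :: E) = r.length + 1 + pot E := rfl

/-- Amortization: the incoming row brings a credit of `b` per entry. Every pass to the next column
shortens the row by one entry and spends at most `b`, which must cover a subtraction of rows; a row
that finds a free pivot column deposits its remaining credit in the potential. -/
theorem insertRow_time (v : V) (row : List F) (E : List (Slot V F)) (D : List (V × F)) (b : ℕ)
    (hb : 2 * row.length + 6 ≤ b) :
    (insertRow v row E D).time + b * pot (insertRow v row E D).val.1 ≤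
      b * (pot E + row.length) + 1 := by
  induction E generalizing row D with
  | nil => cases row <;> simp [insertRow]
  | cons s E ih =>
    cases row with
    | nil => simp [insertRow]; omega
    | cons a r =>
      simp only [List.length_cons] at hb
      by_cases ha : a = 0
      · have h := ih r D (by omega)
        rcases s with _ | ⟨w, c, q⟩ <;> simp [insertRow, ha, Nat.mul_add] at h ⊢ <;> omega
      · rcases s with _ | ⟨w, c, q⟩
        · simp [insertRow, ha, Nat.mul_add]; omega
        · have h0 := length_subMul (a / c) r q
          have h1 := subMul_time (a / c) r q
          have h := ih (subMul (a / c) r q).val D (by omega)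
          have h2 : b * (subMul (a / c) r q).val.length ≤ b * r.length :=
            Nat.mul_le_mul_left _ (by omega)
          simp only [insertRow, ha, if_false, bind_val, bind_time, ret_val, ret_time, pot_some,
            Nat.mul_add, List.length_cons] at h ⊢
          omega

/-- The form in which local steps are used: a congruence of the active summand `q` is embedded into
a larger form and a larger set of variables. -/
theorem Cg.frame {W W' : List V} {q q' g p p' : (V → F) → F} (h : Cg W q q') (hW : W ⊆ W')
    (hg : Indep W g) (e : ∀ x, p x = q x + g x) (e' : ∀ x, p' x = q' x + g x) : Cg W' p p' :=
  (((h.add_right hg).mono hW).congr_left e).congr_right e'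

theorem Indep.rowTerm {W cs : List V} {w c : V} (hw : w ∉ W) (hc : c ∉ W) (hcs : ∀ d ∈ cs, d ∉ W)
    (b : F) (q : List F) : Indep W fun x : V → F => 2 * x w * (b * x c + CongDiag.dot cs q x) :=
  ((Indep.const _ 2).mul (.coord hw)).mul (((Indep.const _ b).mul (.coord hc)).add (.dot hcs q))

/-- Substituting `x w - (a / b) * x v` for `x w` in `2 * x w * (b * x c + ..)` creates a term that
cancels the leading entry `a` of the row `v`: a row operation on row `v` is a shear in the direction
of `w`. If the row is used up, `x v` has vanished from the form, whence the diagonal entry 0. The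
permutation records that every label ends either in the echelon form or in the output. -/
theorem insertRow_spec (v : V) (row : List F) (cs : List V) (E : List (Slot V F))
    (D : List (V × F)) (hrow : row.length = E.length) (hcs : cs.length = E.length)
    (hE : EchOK E) (hdis : ∀ c ∈ cs, c ∉ v :: rowLabels E) (hnd : (v :: rowLabels E).Nodup) :
    ∃ D', (insertRow v row E D).val.2 = D' ++ D ∧ EchOK (insertRow v row E D).val.1 ∧
      (insertRow v row E D).val.1.length = E.length ∧
      (rowLabels (insertRow v row E D).val.1 ++ D'.map Prod.fst).Perm (v :: rowLabels E) ∧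
      Cg (v :: rowLabels E) (fun x => echForm cs E x + 2 * x v * dot cs row x)
        (fun x => echForm cs (insertRow v row E D).val.1 x + diagForm D' x) := by
  induction E generalizing row cs D with
  | nil =>
    obtain rfl : row = [] := by simpa using hrow
    exact ⟨[(v, 0)], by simp [insertRow], by simp [insertRow], by simp [insertRow],
      by simp [insertRow], .of_eq (by simp [insertRow])⟩
  | cons s E ih =>
    obtain ⟨a, r, rfl⟩ := List.exists_cons_of_length_eq_add_one hrow
    obtain ⟨c, cs, rfl⟩ := List.exists_cons_of_length_eq_add_one hcs
    simp only [List.length_cons, Nat.add_right_cancel_iff] at hrow hcs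
    simp only [List.forall_mem_cons] at hdis
    rcases s with _ | ⟨w, b, q⟩
    · by_cases ha : a = 0
      · subst ha
        obtain ⟨D', h1, h2, h3, h4, h5⟩ := ih r cs D hrow hcs hE hdis.2 hnd
        refine ⟨D', by simp [insertRow, h1], by simp [insertRow, h2], by simp [insertRow, h3],
          by simpa [insertRow] using h4, ?_⟩
        simpa [insertRow] using h5
      · refine ⟨[], by simp [insertRow, ha], ?_, by simp [insertRow, ha], by simp [insertRow, ha],
          .of_eq fun x => ?_⟩
        · simpa [insertRow, ha] using ⟨hrow, hE⟩
        · simp [insertRow, ha]; ring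
    · simp only [rowLabels_some, List.nodup_cons, List.mem_cons, not_or] at hdis hnd
      -- The recursive call, with the row `w` carried along as a frame, for any row `r'` whose entry
      -- in column `c` is zero. It serves both when this entry vanishes from the start and after its
      -- elimination.
      have step (r' : List F) (hr' : r'.length = E.length) :
          ∃ D', (insertRow v r' E D).val.2 = D' ++ D ∧
          EchOK (some (w, b, q) :: (insertRow v r' E D).val.1) ∧
          (some (w, b, q) :: (insertRow v r' E D).val.1).length = E.length + 1 ∧
          (rowLabels (some (w, b, q) :: (insertRow v r' E D).val.1) ++ D'.map Prod.fst).Perm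
            (v :: w :: rowLabels E) ∧
          Cg (v :: w :: rowLabels E)
            (fun x => echForm (c :: cs) (some (w, b, q) :: E) x + 2 * x v * dot cs r' x)
            (fun x => echForm (c :: cs) (some (w, b, q) :: (insertRow v r' E D).val.1) x +
              diagForm D' x) := by
        obtain ⟨D', h1, h2, h3, h4, h5⟩ := ih r' cs D hr' hcs hE.2.2
          (fun d hd => by simpa using ⟨(hdis.2 d hd).1, (hdis.2 d hd).2.2⟩)
          (by simpa using ⟨hnd.1.2, hnd.2.2⟩)
        refine ⟨D', h1, ?_, by simp [h3], ?_, ?_⟩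
        · simp [h2, h3, hE.1, hE.2.1]
        · exact (h4.cons w).trans (List.Perm.swap _ _ _)
        · refine h5.frame (fun u hu => by simp at hu ⊢; tauto)
            (Indep.rowTerm (w := w) (c := c) (cs := cs) ?_ ?_ ?_ b q) ?_ ?_
          · simpa using ⟨Ne.symm hnd.1.1, hnd.2.1⟩
          · simpa using ⟨hdis.1.1, hdis.1.2.2⟩
          · exact fun d hd => by simpa using ⟨(hdis.2 d hd).1, (hdis.2 d hd).2.2⟩
          · intro x; simp; ring
          · intro x; simp; ring
      by_cases ha : a = 0
      · subst ha
        simpa [insertRow] using step r hrow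
      · have hlen : r.length = q.length := by rw [hrow, hE.2.1]
        obtain ⟨D', h1, h2, h3, h4, h5⟩ := step (subMul (a / b) r q).val (by simp [← hlen, hrow])
        simp only [insertRow, ha, if_false, bind_val, ret_val]
        refine ⟨D', h1, h2, h3, h4, Cg.trans ?_ h5⟩
        have hw : w ∉ cs := fun hw => (hdis.2 w hw).2.1 rfl
        refine Cg.shear (w := w) (by simp) (-(a / b) • LinearMap.proj v) (by simp [hnd.1.1])
          fun x => ?_
        have h6 : c ≠ w := hdis.1.2.1
        simp only [echForm_some, dot_cons, dot_shear hw, echForm_shear hw hnd.2.1,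
          dot_subMul _ _ _ _ hlen]
        simp [hnd.1.1, h6]
        have := hE.1
        field_simp
        ring

/-- Rows whose pivots lie in different columns simply interleave. If two rows share a pivot column,
the first reduces the second, which is then inserted into the tail of the first form; this leaves
the pivot columns already passed alone, so the merge can go on with the tails. -/
theorem mergeEch_spec (cs : List V) (E E' : List (Slot V F)) (D : List (V × F))
    (hcs : cs.length = E.length) (hlen : E'.length = E.length) (hE : EchOK E) (hE' : EchOK E')
    (hdis : ∀ c ∈ cs, c ∉ rowLabels E ++ rowLabels E') (hnd : (rowLabels E ++ rowLabels E').Nodup) :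
    ∃ D', (mergeEch E E' D).val.2 = D' ++ D ∧ EchOK (mergeEch E E' D).val.1 ∧
      (mergeEch E E' D).val.1.length = E.length ∧
      (rowLabels (mergeEch E E' D).val.1 ++ D'.map Prod.fst).Perm (rowLabels E ++ rowLabels E') ∧
      Cg (rowLabels E ++ rowLabels E') (fun x => echForm cs E x + echForm cs E' x)
        (fun x => echForm cs (mergeEch E E' D).val.1 x + diagForm D' x) := by
  induction E' generalizing cs E D with
  | nil =>
    obtain rfl : E = [] := by simpa [eq_comm] using hlen
    exact ⟨[], by simp [mergeEch], by simp [mergeEch], by simp [mergeEch],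
      by simp [mergeEch], .of_eq (by simp [mergeEch])⟩
  | cons s' E' ih =>
    obtain ⟨s, E, rfl⟩ := List.exists_cons_of_length_eq_add_one hlen.symm
    obtain ⟨c, cs, rfl⟩ := List.exists_cons_of_length_eq_add_one hcs
    simp only [List.length_cons, Nat.add_right_cancel_iff] at hlen hcs
    simp only [List.forall_mem_cons] at hdis
    rcases s' with _ | ⟨w, a, r⟩
    · rcases s with _ | ⟨v, b, q⟩
      · obtain ⟨D', h1, h2, h3, h4, h5⟩ := ih cs E D hcs hlen hE hE' hdis.2 hnd
        refine ⟨D', by simp [mergeEch, h1], by simp [mergeEch, h2], by simp [mergeEch, h3],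
          by simpa [mergeEch] using h4, ?_⟩
        simpa [mergeEch] using h5
      · simp only [rowLabels_some, rowLabels_none, List.cons_append, List.nodup_cons] at hdis hnd
        have hdis' : ∀ d ∈ cs, d ∉ rowLabels E ++ rowLabels E' := fun d hd hd' =>
          hdis.2 d hd (List.mem_cons_of_mem _ hd')
        obtain ⟨D', h1, h2, h3, h4, h5⟩ := ih cs E D hcs hlen hE.2.2 hE' hdis' hnd.2
        refine ⟨D', by simp [mergeEch, h1], ?_, by simp [mergeEch, h3], ?_, ?_⟩
        · simp [mergeEch, h2, h3, hE.1, hE.2.1]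
        · simpa [mergeEch] using h4.cons v
        · refine h5.frame (by simp)
            (Indep.rowTerm (w := v) (c := c) (cs := cs) hnd.1 ?_ hdis' b q) ?_ ?_
          · exact fun h => hdis.1 (List.mem_cons_of_mem _ h)
          · intro x; simp; ring
          · intro x; simp [mergeEch]; ring
    · rcases s with _ | ⟨v, b, q⟩
      · simp only [rowLabels_some, rowLabels_none] at hdis hnd
        have hp : (rowLabels E ++ w :: rowLabels E').Perm (w :: (rowLabels E ++ rowLabels E')) :=
          List.perm_middle
        simp only [hp.mem_iff] at hdis
        rw [hp.nodup_iff, List.nodup_cons] at hnd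
        have hdis' : ∀ d ∈ cs, d ∉ rowLabels E ++ rowLabels E' := fun d hd hd' =>
          hdis.2 d hd (List.mem_cons_of_mem _ hd')
        obtain ⟨D', h1, h2, h3, h4, h5⟩ := ih cs E D hcs hlen hE hE'.2.2 hdis' hnd.2
        refine ⟨D', by simp [mergeEch, h1], ?_, by simp [mergeEch, h3], ?_, ?_⟩
        · simp [mergeEch, h2, h3, hE'.1, hE'.2.1, hlen]
        · simpa [mergeEch] using (h4.cons w).trans hp.symm
        · refine h5.frame (fun u hu => hp.mem_iff.2 (List.mem_cons_of_mem _ hu))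
            (Indep.rowTerm (w := w) (c := c) (cs := cs) hnd.1 ?_ hdis' a r) ?_ ?_
          · exact fun h => hdis.1 (List.mem_cons_of_mem _ h)
          · intro x; simp; ring
          · intro x; simp [mergeEch]; ring
      · simp only [rowLabels_some] at hdis hnd
        have hp : (v :: rowLabels E ++ w :: rowLabels E').Perm
            (v :: w :: (rowLabels E ++ rowLabels E')) := List.perm_middle.cons v
        simp only [hp.mem_iff] at hdis
        rw [hp.nodup_iff] at hnd
        simp only [List.nodup_cons, List.nodup_append, List.mem_cons, List.mem_append,
          not_or] at hdis hnd
        have hlen' : r.length = q.length := by rw [hE.2.1, hE'.2.1, hlen]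
        obtain ⟨D₁, h1, h2, h3, h4, h5⟩ := insertRow_spec w (subMul (a / b) r q).val cs E D
          (by simp [← hlen', hE'.2.1, hlen]) hcs hE.2.2
          (fun d hd => by
            have := hdis.2 d hd
            simp only [List.mem_cons, not_or]; tauto)
          (by simp only [List.nodup_cons]; tauto)
        set x := insertRow w (subMul (a / b) r q).val E D with hx
        have hsub : ∀ u ∈ rowLabels x.val.1, u = w ∨ u ∈ rowLabels E := fun u hu => by
          simpa using h4.subset (List.mem_append_left _ hu)
        have hsub' : ∀ u ∈ D₁.map Prod.fst, u = w ∨ u ∈ rowLabels E := fun u hu => by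
          simpa using h4.subset (List.mem_append_right _ hu)
        have hnd₁ := h4.nodup_iff.2 (by simp only [List.nodup_cons]; tauto)
        rw [List.nodup_append] at hnd₁
        obtain ⟨D₂, g1, g2, g3, g4, g5⟩ := ih cs x.val.1 x.val.2 (by omega) (by omega) h2
          hE'.2.2
          (fun d hd hd' => by
            have := hdis.2 d hd
            rcases List.mem_append.1 hd' with hd' | hd'
            · rcases hsub d hd' with h | h <;> tauto
            · tauto)
          (by
            rw [List.nodup_append]
            refine ⟨hnd₁.1, hnd.2.2.2.1, fun u hu u' hu' => ?_⟩
            rcases hsub u hu with h | h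
            · rintro rfl; subst h; tauto
            · exact hnd.2.2.2.2 u h u' hu')
        have hval : (mergeEch (some (v, b, q) :: E) (some (w, a, r) :: E') D).val =
            (some (v, b, q) :: (mergeEch x.val.1 E' x.val.2).val.1,
              (mergeEch x.val.1 E' x.val.2).val.2) := by simp [mergeEch, hx]
        rw [hval]
        have hv : v ∉ cs := fun hv => (hdis.2 v hv).1 rfl
        have hc : c ≠ v := hdis.1.1
        refine ⟨D₂ ++ D₁, by rw [g1, h1, List.append_assoc], ?_, by simp [g3, h3], ?_, ?_⟩
        · simp [g2, hE.1, hE.2.1, g3, h3]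
        · simp only [rowLabels_some, List.cons_append, List.map_append]
          refine List.Perm.cons v ?_
          rw [← List.append_assoc]
          refine (g4.append_right _).trans ?_
          rw [List.append_assoc]
          refine (List.perm_append_comm.append_left _).trans ?_
          rw [← List.append_assoc]
          refine (h4.append_right _).trans ?_
          simpa using List.perm_middle.symm
        -- Three stages: a shear along `v` clears the pivot of row `w`, then the reduced row is
        -- inserted with row `v` and the second tail as frame, and finally the tails are merged with
        -- row `v` and the zero rows found so far as frame.
        · refine Cg.trans (q' := fun x => (echForm cs E x + 2 * x w * dot cs (subMul (a / b) r q).val x)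
            + (2 * x v * (b * x c + dot cs q x) + echForm cs E' x)) ?_ (Cg.trans
              (q' := fun y => (echForm cs x.val.1 y + diagForm D₁ y)
            + (2 * y v * (b * y c + dot cs q y) + echForm cs E' y)) ?_ ?_)
          · refine Cg.shear (w := v) (by simp) (-(a / b) • LinearMap.proj w)
              (by simp [Ne.symm hnd.1.1]) fun y => ?_
            simp only [echForm_some, dot_shear hv, echForm_shear hv hnd.1.2.1,
              echForm_shear hv hnd.1.2.2, dot_subMul _ _ _ _ hlen']
            simp [hc, Ne.symm hnd.1.1]
            have := hE.1
            field_simp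
            ring
          · refine h5.frame (g := fun x => 2 * x v * (b * x c + dot cs q x) + echForm cs E' x)
              (fun u hu => by simp at hu ⊢; tauto)
              ((Indep.rowTerm ?_ ?_ ?_ b q).add (.echForm ?_ ?_)) (fun _ => rfl) (fun _ => rfl)
            · simp; tauto
            · simp; tauto
            · intro d hd; have := hdis.2 d hd; simp; tauto
            · intro d hd; have := hdis.2 d hd; simp; tauto
            · intro d hd
              have := fun h => hnd.2.2.2.2 d h d hd rfl
              simp only [List.mem_cons, not_or]
              refine ⟨?_, this⟩
              rintro rfl; tauto
          · refine g5.frame (g := fun x => 2 * x v * (b * x c + dot cs q x) + diagForm D₁ x)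
              (fun u hu => ?_)
              ((Indep.rowTerm ?_ ?_ ?_ b q).add (.diagForm ?_)) (fun _ => by ring)
              (fun _ => by simp; ring)
            · rcases List.mem_append.1 hu with hu | hu
              · have := hsub u hu; simp; tauto
              · simp; tauto
            · rw [List.mem_append]; rintro (h | h)
              · have := hsub v h; tauto
              · tauto
            · rw [List.mem_append]; rintro (h | h)
              · have := hsub c h; tauto
              · tauto
            · intro d hd; rw [List.mem_append]; have := hdis.2 d hd; rintro (h | h)
              · have := hsub d h; tauto
              · tauto
            · intro d hd; rw [List.mem_append]; rintro (h | h)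
              · exact hnd₁.2.2 d h d hd rfl
              · rcases hsub' d hd with h' | h'
                · subst h'; tauto
                · exact hnd.2.2.2.2 d h' d h rfl

/-- The shape statement alone, free of hypotheses on the labels, so that the time bounds need none
either. -/
theorem insertRow_ok (v : V) (row : List F) (E : List (Slot V F)) (D : List (V × F))
    (hrow : row.length = E.length) (hE : EchOK E) :
    (insertRow v row E D).val.1.length = E.length ∧ EchOK (insertRow v row E D).val.1 := by
  induction E generalizing row D with
  | nil => cases row <;> simp_all [insertRow]
  | cons s E ih =>
    obtain ⟨a, r, rfl⟩ := List.exists_cons_of_length_eq_add_one hrow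
    simp only [List.length_cons, Nat.add_right_cancel_iff] at hrow
    rcases s with _ | ⟨w, b, q⟩
    · have := ih r D hrow hE
      by_cases ha : a = 0 <;> simp_all [insertRow]
    · have h1 := ih r D hrow hE.2.2
      have h2 := ih (subMul (a / b) r q).val D (by simp [hE.2.1, hrow]) hE.2.2
      have h3 := hE.1
      have h4 := hE.2.1
      by_cases ha : a = 0 <;> simp [insertRow, ha, h1, h2, h3, h4]

/-- When two pivots collide, the pivot entry of the second row pays for its own elimination, and the
remaining entries are the credit with which the row enters `insertRow`. The traversal itself costs
the additive `2 * E.length + 1`. -/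
theorem mergeEch_time (E E' : List (Slot V F)) (D : List (V × F)) (b : ℕ)
    (hlen : E'.length = E.length) (hE : EchOK E) (hE' : EchOK E') (hb : 2 * E.length + 8 ≤ b) :
    (mergeEch E E' D).time + b * pot (mergeEch E E' D).val.1 ≤
      b * (pot E + pot E') + 2 * E.length + 1 := by
  induction E' generalizing E D with
  | nil => simp [mergeEch]; omega
  | cons s' E' ih =>
    obtain ⟨s, E, rfl⟩ := List.exists_cons_of_length_eq_add_one hlen.symm
    simp only [List.length_cons, Nat.add_right_cancel_iff] at hlen hb
    rcases s' with _ | ⟨w, a, r⟩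
    · rcases s with _ | ⟨v, c, q⟩
      · have h := ih E D hlen hE hE' (by omega)
        simp [mergeEch, Nat.mul_add] at h ⊢; omega
      · have h := ih E D hlen hE.2.2 hE' (by omega)
        simp [mergeEch, Nat.mul_add] at h ⊢; omega
    · rcases s with _ | ⟨v, c, q⟩
      · have h := ih E D hlen hE hE'.2.2 (by omega)
        simp [mergeEch, Nat.mul_add] at h ⊢; omega
      · have h1 := subMul_time (a / c) r q
        have h0 := length_subMul (a / c) r q
        have hr := hE'.2.1
        have hq := hE.2.1
        have h2 := insertRow_time w (subMul (a / c) r q).val E D b (by omega)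
        obtain ⟨h3, h4⟩ : (insertRow w (subMul (a / c) r q).val E D).val.1.length = E.length ∧
          EchOK (insertRow w (subMul (a / c) r q).val E D).val.1 := insertRow_ok _ _ _ _ (by omega) hE.2.2
        have h := ih _ (insertRow w (subMul (a / c) r q).val E D).val.2 (by omega) h4 hE'.2.2
          (by omega)
        have h5 : b * (subMul (a / c) r q).val.length ≤ b * r.length :=
            Nat.mul_le_mul_left _ (by omega)
        simp only [mergeEch, bind_val, bind_time, ret_val, ret_time, pot_some,
            Nat.mul_add, List.length_cons] at h h2 ⊢
        omega

/-- The row `u` is the lowest one with a nonzero entry in the column `z`, so among the rows with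
such an entry its pivot is rightmost. Subtracting multiples of it from the rows above therefore
spoils no pivot, and the echelon form persists. The list `y` is padded with zeros on the left, up to
full width. -/
theorem elimCol_spec (z : V) (cs : List V) (E : List (Slot V F))
    (hcs : E.length = cs.length + 1) (hE : EchOK E) (hz : z ∉ rowLabels E)
    (hdis : ∀ c ∈ cs, c ∉ rowLabels E) (hnd : (rowLabels E).Nodup) :
    EchOK (elimCol E).val.1 ∧ (elimCol E).val.1.length = cs.length ∧
    ((elimCol E).val.2 = none ∧ rowLabels (elimCol E).val.1 = rowLabels E ∧
      (∀ x, echForm (cs ++ [z]) E x = echForm cs (elimCol E).val.1 x) ∨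
    ∃ u a y, (elimCol E).val.2 = some (u, a, y) ∧ a ≠ 0 ∧ y.length = cs.length ∧
      (u :: rowLabels (elimCol E).val.1).Perm (rowLabels E) ∧
      Cg (rowLabels E) (echForm (cs ++ [z]) E)
        (fun x => echForm cs (elimCol E).val.1 x + 2 * x u * (a * x z + dot cs y x))) := by
  induction E generalizing cs with
  | nil => simp at hcs
  | cons s E ih =>
    rcases E with _ | ⟨s', E⟩
    · obtain rfl : cs = [] := by simpa using hcs
      rcases s with _ | ⟨u, a, r⟩
      · simp [elimCol]
      · refine ⟨by simp [elimCol], by simp [elimCol], Or.inr ⟨u, a, [], by simp [elimCol], hE.1,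
          rfl, by simp [elimCol], .of_eq fun x => ?_⟩⟩
        simp [elimCol]
    · obtain ⟨c, cs, rfl⟩ := List.exists_cons_of_length_eq_add_one
        (show cs.length = E.length + 1 by simpa using hcs.symm)
      simp only [List.length_cons, Nat.add_right_cancel_iff] at hcs
      simp only [List.forall_mem_cons] at hdis
      rcases s with _ | ⟨w, b, q⟩
      · obtain ⟨h1, h2, h3⟩ := ih cs (by simpa using hcs) hE hz hdis.2 hnd
        rcases h3 with ⟨h3, h4, h5⟩ | ⟨u, a, y, h3, h4, h5, h6, h7⟩
        · simp [elimCol, h3, h1, h2, h4, h5]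
        · refine ⟨by simp [elimCol, h3, h1], by simp [elimCol, h3, h2],
            Or.inr ⟨u, a, 0 :: y, by simp [elimCol, h3], h4, by simp [h5],
              by simpa [elimCol, h3] using h6, ?_⟩⟩
          exact (h7.congr_left (by simp)).congr_right (by simp [elimCol, h3])
      · obtain ⟨t, e, rfl⟩ : ∃ t e, q = t ++ [e] := by
          rcases List.eq_nil_or_concat' q with h | h
          · have := hE.2.1
            simp [h] at this
          · exact h
        have ht : t.length = cs.length := by
          have := hE.2.1
          simp at this; omega
        simp only [rowLabels_some, List.mem_cons, not_or, List.nodup_cons] at hz hdis hnd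
        obtain ⟨h1, h2, h3⟩ := ih cs (by simpa using hcs) hE.2.2 hz.2
          (fun d hd => (hdis.2 d hd).2) hnd.2
        have hb := hE.1
        have hwI : Indep (rowLabels (s' :: E)) fun x : V → F =>
            2 * x w * (b * x c + dot (cs ++ [z]) (t ++ [e]) x) := by
          refine .rowTerm hnd.1 hdis.1.2 (fun d hd => ?_) _ _
          rcases List.mem_append.1 hd with hd | hd
          · exact (hdis.2 d hd).2
          · rw [List.mem_singleton.1 hd]; exact hz.2
        rcases h3 with ⟨h3, h4, h5⟩ | ⟨u, a, y, h3, h4, h5, h6, h7⟩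
        · by_cases he : e = 0
          · subst he
            refine ⟨?_, ?_, Or.inl ⟨?_, ?_, fun x => ?_⟩⟩ <;>
              simp [elimCol, h3, h1, h2, h4, h5, ht, hb, dot_append]
          · refine ⟨?_, ?_, Or.inr ⟨w, e, b :: t, ?_, he, ?_, ?_, .of_eq fun x => ?_⟩⟩ <;>
              simp [elimCol, h3, h1, h2, h4, h5, ht, he, dot_append]
            ring
        · have hu : u ∈ rowLabels (s' :: E) := h6.subset (by simp)
          have hwu : w ≠ u := by rintro rfl; exact hnd.1 hu
          by_cases he : e = 0
          · subst he
            refine ⟨?_, ?_, Or.inr ⟨u, a, 0 :: y, ?_, h4, ?_, ?_, ?_⟩⟩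
            · simp [elimCol, h3, h1, h2, ht, hb]
            · simp [elimCol, h3, h2]
            · simp [elimCol, h3]
            · simp [h5]
            · simpa [elimCol, h3] using (List.Perm.swap _ _ _).trans (h6.cons w)
            · refine h7.frame (by simp) hwI (fun x => ?_) (fun x => ?_)
              · simp; ring
              · simp [elimCol, h3, dot_append, ht]; ring
          · refine ⟨?_, ?_, Or.inr ⟨u, a, 0 :: y, ?_, h4, ?_, ?_, ?_⟩⟩
            · simp [elimCol, h3, h1, h2, ht, hb, he, h5]
            · simp [elimCol, h3, h2, he]
            · simp [elimCol, h3, he]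
            · simp [h5]
            · simpa [elimCol, h3, he] using (List.Perm.swap _ _ _).trans (h6.cons w)
            -- First the recursive result with row `w` as frame; then the shear of `x u` by `-(e /
            -- a) * x w`, which removes the entry `e` of row `w` in the last column.
            · refine (h7.frame (W' := rowLabels (some (w, b, t ++ [e]) :: s' :: E)) (by simp) hwI
                (p := echForm (c :: cs ++ [z]) (some (w, b, t ++ [e]) :: s' :: E))
                (fun x => ?_) (fun x => rfl)).trans ?_
              · simp; ring
              · have hu' : u ∈ rowLabels (some (w, b, t ++ [e]) :: s' :: E) :=
                  List.mem_cons_of_mem _ hu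
                have huz : z ≠ u := by rintro rfl; exact hz.2 hu
                have huc : c ≠ u := by rintro rfl; exact hdis.1.2 hu
                have hucs : u ∉ cs := fun h => (hdis.2 u h).2 hu
                have hu1 : u ∉ rowLabels (elimCol (s' :: E)).val.1 :=
                  (List.nodup_cons.1 (h6.nodup_iff.2 hnd.2)).1
                refine Cg.shear hu' (-(e / a) • LinearMap.proj w) (by simp [hwu]) fun x => ?_
                simp only [elimCol, h3, he, if_false, bind_val, ret_val, unsnoc_append,
                  echForm_some, dot_cons, dot_append _ _ _ _ ht,
                  dot_shear hucs, echForm_shear hucs hu1,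
                  dot_subMul _ _ _ _ (ht.trans h5.symm)]
                simp [huz, huc, hwu]
                field_simp
                ring

/-- Dropping the last column and possibly a row, while pivots stay in place, can only lower the
potential. -/
theorem elimCol_time (E : List (Slot V F)) (hE : EchOK E) :
    (elimCol E).time ≤ (4 * E.length + 8) * E.length + 1 ∧
      pot (elimCol E).val.1 ≤ pot E := by
  induction E with
  | nil => simp [elimCol]
  | cons s E ih =>
    rcases E with _ | ⟨s', E⟩
    · rcases s with _ | ⟨u, a, r⟩ <;> simp [elimCol]
    · have hm : (4 * (s' :: E).length + 8) * (s' :: E).length + (4 * (s' :: E).length + 8) ≤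
          (4 * (s :: s' :: E).length + 8) * (s :: s' :: E).length := by
        simp only [List.length_cons]; nlinarith
      rcases s with _ | ⟨w, b, q⟩
      · obtain ⟨h1, h2⟩ := ih hE
        refine ⟨hm.trans' ?_ |>.trans (Nat.le_succ _), ?_⟩
        · rcases h3 : (elimCol (s' :: E)).val.2 with _ | ⟨u, a, y⟩ <;>
            simp [elimCol, h3] at h1 ⊢ <;> omega
        · rcases h3 : (elimCol (s' :: E)).val.2 with _ | ⟨u, a, y⟩ <;>
            simpa [elimCol, h3] using h2
      · obtain ⟨h1, h2⟩ := ih hE.2.2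
        have hq := hE.2.1
        obtain ⟨t, e, rfl⟩ : ∃ t e, q = t ++ [e] := by
          rcases List.eq_nil_or_concat' q with h | h
          · simp [h] at hq
          · exact h
        have h4 := unsnoc_time 0 (t ++ [e])
        rw [hq] at h4
        have h6 : t.length = E.length := by simpa using hq
        refine ⟨hm.trans' ?_ |>.trans (Nat.le_succ _), ?_⟩
        · rcases h3 : (elimCol (s' :: E)).val.2 with _ | ⟨u, a, y⟩ <;> by_cases he : e = 0 <;>
            simp [elimCol, h3, he] at h1 h4 ⊢ <;> try omega
          have h5 := subMul_time (e / a) t y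
          omega
        · rcases h3 : (elimCol (s' :: E)).val.2 with _ | ⟨u, a, y⟩ <;> by_cases he : e = 0 <;>
            simp [elimCol, h3, he] at h2 ⊢ <;> omega

end

/-! ### Boxes: leaf, introduce and join nodes -/

section
variable {V F : Type*} [Field F] [DecidableEq F]

/-- The box `N` has the columns `B`, and is well-formed. -/
structure BoxOK (B : List V) (N : Box V F) : Prop where
  cols : N.cols = B
  ech_len : N.ech.length = B.length
  ech : EchOK N.ech
  sym_len : N.sym.length = B.length
  rows : RowsLen B.length N.sym
  symm : ∀ x y, bil B B N.sym x y = bil B B N.sym y x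

/-- The quadratic form of a box. -/
def boxForm (N : Box V F) (x : V → F) : F :=
  echForm N.cols N.ech x + bil N.cols N.cols N.sym x x

theorem echForm_replicate_none (cs : List V) (n : ℕ) (x : V → F) :
    echForm cs (List.replicate n (none : Slot V F)) x = 0 := by
  induction n generalizing cs with
  | zero => simp
  | succ n ih => cases cs <;> simp [List.replicate_succ, ih]

theorem rowLabels_replicate_none (n : ℕ) :
    rowLabels (List.replicate n (none : Slot V F)) = [] := by
  induction n <;> simp_all [List.replicate_succ]

theorem echOK_replicate_none (n : ℕ) : EchOK (List.replicate n (none : Slot V F)) := by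
  induction n <;> simp_all [List.replicate_succ]

theorem pot_replicate_none (n : ℕ) : pot (List.replicate n (none : Slot V F)) = 0 := by
  induction n <;> simp_all [List.replicate_succ]

theorem leafBox_spec (B : List V) :
    BoxOK B (leafBox B : Timed (Box V F)).val ∧
    rowLabels (leafBox B : Timed (Box V F)).val.ech = [] ∧
    (∀ x, boxForm (leafBox B : Timed (Box V F)).val x = 0) := by
  have h := fun cs ds => zeroMat_spec (F := F) B B cs ds
  refine ⟨⟨?_, ?_, ?_, ?_, ?_, ?_⟩, ?_, fun x => ?_⟩
  · simp [leafBox]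
  · simp [leafBox, constT_val]
  · simp [leafBox, constT_val, echOK_replicate_none]
  · simp [leafBox, (h [] []).1]
  · simp [leafBox, (h [] []).2.1]
  · intro x y
    simp [leafBox, (h B B).2.2.1]
  · simp [leafBox, constT_val, rowLabels_replicate_none]
  · simp [boxForm, leafBox, (h B B).2.2.1, constT_val, echForm_replicate_none]

theorem leafBox_time (B : List V) (K : ℕ) (hK : B.length ≤ K) (hK1 : 1 ≤ K) :
    (leafBox B : Timed (Box V F)).time ≤ 15 * (K * K) ∧
    pot (leafBox B : Timed (Box V F)).val.ech = 0 := by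
  have h := (zeroMat_spec (F := F) B B [] []).2.2.2
  constructor
  · simp only [leafBox, bind_time, ret_time, constT_time, h]
    nlinarith
  · simp [leafBox, constT_val, pot_replicate_none]

theorem position_val {n : ℕ} (lab : Vector ℕ n) (x : ℕ) (B₁ B₂ : List (Fin n))
    (h₁ : ∀ c ∈ B₁, lab.get c < x) (h₂ : ∀ c ∈ B₂, x < lab.get c) :
    (position lab x (B₁ ++ B₂)).val = B₁.length := by
  induction B₁ with
  | nil =>
    cases B₂ with
    | nil => simp [position]
    | cons c B => have := h₂ c (by simp); simp [position, this.not_gt]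
  | cons c B ih =>
    simp only [List.forall_mem_cons] at h₁
    simp [position, h₁.1, ih h₁.2]

theorem position_time {n : ℕ} (lab : Vector ℕ n) (x : ℕ) (B : List (Fin n)) :
    (position lab x B).time ≤ 2 * B.length + 1 := by
  induction B with
  | nil => simp [position]
  | cons c B ih => by_cases h : lab.get c < x <;> simp [position, h]; omega

/-- Only rows with pivot left of the new column get an additional entry, so the potential rises by
at most one per row. `EchOK` survives because the new column holds no pivot. -/
theorem insertCol_spec (v : V) (B₁ B₂ : List V) (E : List (Slot V F))
    (hlen : E.length = B₁.length + B₂.length) (hE : EchOK E) :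
    (insertCol B₁.length E).val.length = E.length + 1 ∧
    EchOK (insertCol B₁.length E).val ∧
    rowLabels (insertCol B₁.length E).val = rowLabels E ∧
    (∀ x, echForm (B₁ ++ v :: B₂) (insertCol B₁.length E).val x = echForm (B₁ ++ B₂) E x) ∧
    pot (insertCol B₁.length E).val ≤ pot E + E.length ∧
    (insertCol B₁.length E).time ≤ (2 * E.length + 6) * E.length + 1 := by
  induction B₁ generalizing E with
  | nil => simp [insertCol, hE]
  | cons c B ih =>
    cases E with
    | nil => simp at hlen; omega
    | cons s E =>
      have hl : E.length = B.length + B₂.length := by simp at hlen; omega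
      have hm : (2 * E.length + 6) * E.length + (2 * E.length + 6) ≤
          (2 * (s :: E).length + 6) * (s :: E).length := by
        simp only [List.length_cons]; nlinarith
      rcases s with _ | ⟨w, a, r⟩
      · obtain ⟨h1, h2, h3, h4, h5, h6⟩ := ih E hl hE
        refine ⟨?_, ?_, ?_, ?_, ?_, hm.trans' ?_ |>.trans (Nat.le_succ _)⟩ <;>
          simp [insertCol, h1, h2, h3, h4] <;> omega
      · obtain ⟨h1, h2, h3, h4, h5, h6⟩ := ih E hl hE.2.2
        have ha := hE.1
        have hr := hE.2.1
        have h7 := length_insertT B.length 0 r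
        have h8 := insertT_time B.length 0 r
        refine ⟨?_, ?_, ?_, ?_, ?_, hm.trans' ?_ |>.trans (Nat.le_succ _)⟩
        · simp [insertCol, h1]
        · simp [insertCol, ha, h7, hr, h1, h2]
        · simp [insertCol, h3]
        · intro x
          simp [insertCol, h4, dot_insertT_zero _ _ _ _ (hr.trans hl)]
        · simp [insertCol, h7]; omega
        · simp [insertCol]; omega

theorem introduceBox_spec {n : ℕ} (lab : Vector ℕ n) (v : Fin n) (B₁ B₂ : List (Fin n))
    (N : Box (Fin n) F) (hN : BoxOK (B₁ ++ B₂) N)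
    (h₁ : ∀ c ∈ B₁, lab.get c < lab.get v) (h₂ : ∀ c ∈ B₂, lab.get v < lab.get c) :
    BoxOK (B₁ ++ v :: B₂) (introduceBox lab v N).val ∧
    rowLabels (introduceBox lab v N).val.ech = rowLabels N.ech ∧
    (∀ x, boxForm (introduceBox lab v N).val x = boxForm N x) ∧
    pot (introduceBox lab v N).val.ech ≤ pot N.ech + (B₁ ++ B₂).length ∧
    ∀ K, (B₁ ++ B₂).length ≤ K → 1 ≤ K → (introduceBox lab v N).time ≤ 40 * (K * K) := by
  obtain ⟨cols, E, A⟩ := N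
  obtain ⟨rfl, e1, e2, s1, s2, s3⟩ := hN
  simp only at e1 e2 s1 s2 s3
  have hp := position_val lab (lab.get v) B₁ B₂ h₁ h₂
  obtain ⟨i1, i2, i3, i4, i5, i6⟩ := insertCol_spec v B₁ B₂ E (by simpa using e1) e2
  have ia := fun cs => insertAll_spec cs B₁ B₂ v A (by simpa using s2)
  -- The rows are cut at the insertion position, so that the new zero row and zero column stand at
  -- the same place and the form can be compared block by block.
  obtain ⟨A₁, A₂, hA, hA₁⟩ : ∃ A₁ A₂, (insertAll B₁.length A).val = A₁ ++ A₂ ∧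
      A₁.length = B₁.length := by
    refine ⟨_, _, (List.take_append_drop B₁.length _).symm, ?_⟩
    rw [List.length_take, (ia []).1, s1]; simp
  have hA₂ : A₂.length = B₂.length := by
    have := congrArg List.length hA
    rw [(ia []).1, s1] at this
    simp [hA₁] at this
    exact this.symm
  set z := (constT (0 : F) (B₁ ++ v :: B₂)).val with hz
  have hins : (insertT B₁.length z (insertAll B₁.length A).val).val = A₁ ++ z :: A₂ := by
    rw [hA, ← hA₁, insertT_append]
  have hval : (introduceBox lab v ⟨B₁ ++ B₂, E, A⟩).val =
      ⟨B₁ ++ v :: B₂, (insertCol B₁.length E).val, A₁ ++ z :: A₂⟩ := by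
    simp only [introduceBox, bind_val, ret_val, hp, insertT_append, ← hz, hins]
  have hbil : ∀ x y, bil (B₁ ++ v :: B₂) (B₁ ++ v :: B₂) (A₁ ++ z :: A₂) x y =
      bil (B₁ ++ B₂) (B₁ ++ B₂) A x y := fun x y => by
    rw [← (ia _).2.2.1 x y, hA, bil_append _ _ _ _ _ hA₁, bil_append _ _ _ _ _ hA₁]
    simp [hz, constT_val, dot_replicate_zero]
  rw [hval]
  refine ⟨⟨rfl, ?_, i2, ?_, ?_, ?_⟩, i3, ?_, ?_, ?_⟩
  · rw [i1, e1]; simp; omega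
  · simp [hA₁, hA₂]
  · have := (ia []).2.1
    rw [hA] at this
    intro r hr
    simp only [List.mem_append, List.mem_cons] at hr
    have hz' : z.length = (B₁ ++ v :: B₂).length := by rw [hz, constT_val]; simp
    rcases hr with hr | rfl | hr
    · rw [this r (by simp [hr])]; simp; omega
    · exact hz'
    · rw [this r (by simp [hr])]; simp; omega
  · intro x y; rw [hbil, hbil, s3]
  · intro x; simp [boxForm, hbil, i4]
  · rw [e1] at i5; exact i5
  · intro K hK hK1
    have t1 := position_time lab (lab.get v) (B₁ ++ B₂)
    have t2 := insertT_time B₁.length v (B₁ ++ B₂)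
    have t4 := (ia []).2.2.2
    have t6 := insertT_time B₁.length z (insertAll B₁.length A).val
    rw [(ia []).1] at t6
    simp only [introduceBox, bind_time, ret_time, hp, insertT_append, constT_time, ← hz]
    rw [e1] at i6
    rw [s1] at t4 t6
    rw [← List.length_append] at t4
    have hl : (B₁ ++ v :: B₂).length = (B₁ ++ B₂).length + 1 := by simp; omega
    rw [hl]
    generalize (B₁ ++ B₂).length = s at *
    nlinarith

variable [Fintype V] [DecidableEq V]

/-- The merge changes row variables only, and these are distinct from the columns; hence the two
symmetric parts form a frame and may simply be added. -/
theorem joinBox_spec (B : List V) (N N' : Box V F) (D : List (V × F)) (hN : BoxOK B N)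
    (hN' : BoxOK B N') (hdis : ∀ c ∈ B, c ∉ rowLabels N.ech ++ rowLabels N'.ech)
    (hnd : (rowLabels N.ech ++ rowLabels N'.ech).Nodup) :
    ∃ D', (joinBox N N' D).val.2 = D' ++ D ∧ BoxOK B (joinBox N N' D).val.1 ∧
      (rowLabels (joinBox N N' D).val.1.ech ++ D'.map Prod.fst).Perm
        (rowLabels N.ech ++ rowLabels N'.ech) ∧
      Cg (rowLabels N.ech ++ rowLabels N'.ech) (fun x => boxForm N x + boxForm N' x)
        (fun x => boxForm (joinBox N N' D).val.1 x + diagForm D' x) := by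
  obtain ⟨cols, E, A⟩ := N
  obtain ⟨cols', E', A'⟩ := N'
  obtain ⟨rfl, e1, e2, s1, s2, s3⟩ := hN
  obtain ⟨h, e1', e2', s1', s2', s3'⟩ := hN'
  simp only at h e1 e2 s1 s2 s3 e1' e2' s1' s2' s3' hdis hnd
  subst h
  obtain ⟨D', h1, h2, h3, h4, h5⟩ := mergeEch_spec cols' E E' D e1.symm (by omega) e2 e2' hdis hnd
  obtain ⟨a1, a2, a3, -⟩ := addMat_spec cols' cols' _ A A' (by omega) s2 s2'
  refine ⟨D', by simp [joinBox, h1], ⟨?_, ?_, ?_, ?_, ?_, ?_⟩, by simpa [joinBox] using h4, ?_⟩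
  · simp [joinBox]
  · simp [joinBox, h3, e1]
  · simp [joinBox, h2]
  · simp [joinBox, a1, s1]
  · simp [joinBox, a2]
  · intro x y; simp [joinBox, a3, s3 x y, s3' x y]
  · refine h5.frame (g := fun x => bil cols' cols' A x x + bil cols' cols' A' x x) (fun _ h => h)
      (.add (.bil hdis hdis _) (.bil hdis hdis _)) ?_ ?_
    · intro x; simp [boxForm]; ring
    · intro x; simp [boxForm, joinBox, a3]; ring

/-- The eliminations are paid by the potentials of the two children; only the addition of the
symmetric parts and the traversal are charged to the node itself. -/
theorem joinBox_time (B : List V) (N N' : Box V F) (D : List (V × F)) (hN : BoxOK B N)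
    (hN' : BoxOK B N') (K b : ℕ) (hK : B.length ≤ K) (hK1 : 1 ≤ K) (hb : 2 * K + 8 ≤ b) :
    (joinBox N N' D).time + b * pot (joinBox N N' D).val.1.ech ≤
      b * (pot N.ech + pot N'.ech) + 40 * (K * K) := by
  obtain ⟨-, -, -, a4⟩ := addMat_spec B B _ N.sym N'.sym
    (hN.sym_len.trans hN'.sym_len.symm) hN.rows hN'.rows
  have h := mergeEch_time N.ech N'.ech D b (hN'.ech_len.trans hN.ech_len.symm) hN.ech hN'.ech
    (by rw [hN.ech_len]; omega)
  rw [hN.sym_len] at a4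
  rw [hN.ech_len] at h
  simp only [joinBox, bind_time, bind_val, ret_val, ret_time]
  nlinarith

theorem length_gather (cs : List V) (r : List (V × F)) :
    (gather cs r).val.length = cs.length := by
  induction cs generalizing r with
  | nil => simp [gather]
  | cons c cs ih =>
    cases r with
    | nil => simp [gather, ih]
    | cons p r =>
      obtain ⟨u, a⟩ := p
      by_cases h : u = c <;> simp [gather, h, ih]

theorem gather_time (cs : List V) (r : List (V × F)) :
    (gather cs r).time = 2 * cs.length + 1 := by
  induction cs generalizing r with
  | nil => simp [gather]
  | cons c cs ih =>
    cases r with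
    | nil => simp [gather, ih]; omega
    | cons p r =>
      obtain ⟨u, a⟩ := p
      by_cases h : u = c <;> simp [gather, h, ih] <;> omega

end

/-! ### Forget nodes -/

section
variable {V F : Type*} [Field F] [DecidableEq F] [Fintype V] [DecidableEq V]

/-- Diagonalization of a hyperbolic pair of variables. -/
theorem Cg.hyperbolic {W : List V} {u v : V} (hu : u ∈ W) (hv : v ∈ W) (huv : u ≠ v)
    (α β : (V → F) →ₗ[F] F) (hαu : α (Pi.single u 1) = 0) (hαv : α (Pi.single v 1) = 0)
    (hβu : β (Pi.single u 1) = 0) (hβv : β (Pi.single v 1) = 0) {p : (V → F) → F}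
    (hp : Indep [u, v] p) {a : F} (ha : a ≠ 0) (h2 : (2 : F) ≠ 0) (d : F) :
    Cg W (fun x => p x + 2 * x u * (a * x v + α x) + 2 * x v * β x + d * x v ^ 2)
      (fun x => p x - (α x + 1 / 2 * (β x - d / (2 * a) * α x)) ^ 2 / a
        + (β x - d / (2 * a) * α x - (α x + 1 / 2 * (β x - d / (2 * a) * α x))) ^ 2 / a
        + a * x u ^ 2 - a * x v ^ 2) := by
  have pu := fun x s => hp.shear_eq (w := u) (by simp) x s
  have pv := fun x s => hp.shear_eq (w := v) (by simp) x s
  -- Five shears. Subtracting `d / (2 * a) * x v` from `x u` kills the term in `x v ^ 2` and turns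
  -- `β` into `γ`. Adding `x u / 2` to `x v` creates `a * x u ^ 2` and turns `α` into `α'`.
  -- Subtracting `x v` from `x u` gives `a * (x u ^ 2 - x v ^ 2)`. The last two complete the squares
  -- in `x u` and `x v`.
  let γ := β - (d / (2 * a)) • α
  let α' := α + (1 / 2 : F) • γ
  have hγ : ∀ x, γ x = β x - d / (2 * a) * α x := fun x => rfl
  have hα' : ∀ x, α' x = α x + 1 / 2 * γ x := fun x => rfl
  refine Cg.trans (q' := fun x => p x + 2 * x u * (a * x v + α x) + 2 * x v * γ x) ?_
    (Cg.trans (q' := fun x => p x + 2 * a * x u * x v + a * x u ^ 2 + 2 * x u * α' x +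
      2 * x v * γ x) ?_ (Cg.trans (q' := fun x => p x + a * x u ^ 2 - a * x v ^ 2 +
      2 * x u * α' x + 2 * x v * (γ x - α' x)) ?_ (Cg.trans (q' := fun x => p x + a * x u ^ 2 -
      a * x v ^ 2 - α' x ^ 2 / a + 2 * x v * (γ x - α' x)) ?_ ?_)))
  · refine Cg.shear hu (-(d / (2 * a)) • LinearMap.proj v) (by simp [huv]) fun x => ?_
    simp only [pu, map_add, map_smul, hαu, hβu, hγ]
    simp [huv.symm]
    field_simp
    ring
  · refine Cg.shear hv ((1 / 2 : F) • LinearMap.proj u) (by simp [huv.symm]) fun x => ?_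
    simp only [pv, map_add, map_smul, hαv, hβv, hγ, hα']
    simp [huv]
    field_simp
    ring
  · refine Cg.shear hu (-LinearMap.proj v) (by simp [huv]) fun x => ?_
    simp only [pu, map_add, map_smul, hαu, hβu, hγ, hα']
    simp [huv.symm]
    ring
  · refine Cg.shear hu (-(1 / a : F) • α') (by simp [hα', hγ, hαu, hβu]) fun x => ?_
    simp only [pu, map_add, map_smul, hαu, hβu, hγ, hα']
    simp [huv.symm, hα', hγ]
    field_simp
    ring
  · refine Cg.shear hv ((1 / a : F) • (γ - α')) (by simp [hα', hγ, hαv, hβv]) fun x => ?_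
    simp only [pv, map_add, map_smul, hαv, hβv, hγ, hα']
    simp [huv, hα', hγ]
    field_simp
    ring

theorem bil_zero_right (cs ds : List V) (A : List (List F)) (x : V → F) :
    bil cs ds A x 0 = 0 := by
  induction cs generalizing A <;> cases A <;> simp_all

theorem bil_zero_left (cs ds : List V) (A : List (List F)) (y : V → F) :
    bil cs ds A 0 y = 0 := by
  induction cs generalizing A <;> cases A <;> simp_all

/-- Splitting off the last row and column of a symmetric matrix. -/
theorem stripLast_symm (cs : List V) (v : V) (A₀ : List (List F)) (s : List F) (d : F)
    (hv : v ∉ cs) (hA₀ : A₀.length = cs.length) (hs : s.length = cs.length)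
    (hrows : RowsLen (cs.length + 1) A₀)
    (hsymm : ∀ x y, bil (cs ++ [v]) (cs ++ [v]) (A₀ ++ [s ++ [d]]) x y =
      bil (cs ++ [v]) (cs ++ [v]) (A₀ ++ [s ++ [d]]) y x) :
    (∀ x y, bil cs cs (stripLast A₀).val x y = bil cs cs (stripLast A₀).val y x) ∧
    (∀ x, bil (cs ++ [v]) (cs ++ [v]) (A₀ ++ [s ++ [d]]) x x =
      bil cs cs (stripLast A₀).val x x + 2 * x v * dot cs s x + d * x v ^ 2) := by
  obtain ⟨-, -, ⟨l, hl, hbil⟩, -⟩ := stripLast_spec cs.length v A₀ hrows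
  have hsplit : ∀ x y, bil (cs ++ [v]) (cs ++ [v]) (A₀ ++ [s ++ [d]]) x y =
      bil cs cs (stripLast A₀).val x y + dot cs l x * y v + x v * (dot cs s y + d * y v) :=
    fun x y => by
      rw [bil_append _ _ _ _ _ hA₀, hbil cs cs rfl]
      simp [dot_append _ _ _ _ hs]
  have hup : ∀ x : V → F, ∀ c ∈ cs, Function.update x v 0 c = x c := fun x c hc =>
    Function.update_of_ne (by rintro rfl; exact hv hc) _ _
  have hsing : ∀ c ∈ cs, Pi.single (M := fun _ => F) v 1 c = (0 : V → F) c := fun c hc =>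
    Pi.single_eq_of_ne (by rintro rfl; exact hv hc) _
  -- Symmetry tested on a vector with `v`-coordinate 0 and the unit vector at `v` isolates the last
  -- column against the last row.
  have hls : ∀ x, dot cs l x = dot cs s x := fun x => by
    have h := hsymm (Function.update x v 0) (Pi.single v 1)
    rw [hsplit, hsplit, bil_congr cs cs _ (hup x) hsing, bil_congr cs cs _ hsing (hup x),
      dot_congr cs l (hup x), dot_congr cs s (hup x), bil_zero_left, bil_zero_right,
      dot_congr cs l hsing] at h
    simpa using h
  refine ⟨fun x y => ?_, fun x => ?_⟩
  -- With both `v`-coordinates 0, only the upper left block remains.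
  · have h := hsymm (Function.update x v 0) (Function.update y v 0)
    rw [hsplit, hsplit, bil_congr cs cs _ (hup x) (hup y), bil_congr cs cs _ (hup y) (hup x)] at h
    simpa using h
  · rw [hsplit, hls]; ring

set_option maxHeartbeats 1000000 in
-- Once the entries of `M` are added, `v` has the row `y` and the diagonal entry `δ`. If `v` is
-- uncoupled from the echelon rows, then `y = 0` makes `v` diagonal, `δ ≠ 0` is a pivot for a Schur
-- complement, and for `δ = 0` the row of `v` looks like an echelon row and is inserted as one. If
-- it is coupled to them, a single row `u` remains coupled after `elimCol`, and the two variables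
-- are diagonalized together.
theorem forgetBox_spec (h2 : (2 : F) ≠ 0) (row : List (V × F)) (v : V) (cs : List V)
    (N : Box V F) (D : List (V × F)) (hN : BoxOK (cs ++ [v]) N) (hnd : (v :: rowLabels N.ech).Nodup)
    (hv : v ∉ cs) (hdis : ∀ c ∈ cs, c ∉ rowLabels N.ech) (g : List F) (e : F)
    (hg : (gather (cs ++ [v]) row).val = g ++ [e]) :
    ∃ D', (forgetBox row v N D).val.2 = D' ++ D ∧ BoxOK cs (forgetBox row v N D).val.1 ∧
      (rowLabels (forgetBox row v N D).val.1.ech ++ D'.map Prod.fst).Perm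
        (v :: rowLabels N.ech) ∧
      Cg (v :: rowLabels N.ech) (fun x => boxForm N x + x v * (2 * dot cs g x + e * x v))
        (fun x => boxForm (forgetBox row v N D).val.1 x + diagForm D' x) := by
  obtain ⟨cols, E, S⟩ := N
  obtain ⟨hcols, e1, e2, s1, s2, s3⟩ := hN
  simp only at hcols e1 e2 s1 s2 s3 hdis hnd ⊢
  subst hcols
  have hglen : g.length = cs.length := by
    have := length_gather (cs ++ [v]) row
    rw [hg] at this; simpa using this
  obtain ⟨A₀, s, d, rfl⟩ : ∃ A₀ s d, S = A₀ ++ [s ++ [d]] := by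
    rcases List.eq_nil_or_concat' S with h | ⟨A₀, r, rfl⟩
    · simp [h] at s1
    · have hr := s2 r (by simp)
      rcases List.eq_nil_or_concat' r with h | ⟨s, d, rfl⟩
      · simp [h] at hr
      · exact ⟨A₀, s, d, rfl⟩
  have hA₀ : A₀.length = cs.length := by simpa using s1
  have hs : s.length = cs.length := by simpa using s2 (s ++ [d]) (by simp)
  have hrows : RowsLen (cs.length + 1) A₀ := fun r hr => by
    simpa using s2 r (by simp [hr])
  obtain ⟨hsymm, hform⟩ := stripLast_symm cs v A₀ s d hv hA₀ hs hrows s3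
  obtain ⟨a1, a2, -, -⟩ := stripLast_spec cs.length v A₀ hrows
  rw [hA₀] at a1
  have hylen : (addRow s g).val.length = cs.length := by simp [hs, hglen]
  have hy : ∀ x, dot cs (addRow s g).val x = dot cs s x + dot cs g x :=
    dot_addRow cs s g (hs.trans hglen.symm)
  have hadd := addRow_append_singleton s g d e (hs.trans hglen.symm)
  obtain ⟨c1, c2, hx⟩ := elimCol_spec v cs E (by simpa using e1) e2 (List.nodup_cons.1 hnd).1 hdis
    (List.nodup_cons.1 hnd).2
  -- The form with the roles separated: echelon part including column `v`, symmetric block on `cs`,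
  -- linear part of `v`, square of `x v`.
  have hq : ∀ x, boxForm ⟨cs ++ [v], E, A₀ ++ [s ++ [d]]⟩ x + x v * (2 * dot cs g x + e * x v) =
      echForm (cs ++ [v]) E x + (bil cs cs (stripLast A₀).val x x +
        2 * x v * dot cs (addRow s g).val x + (d + e) * x v ^ 2) := fun x => by
    simp only [boxForm, hform, hy]; ring
  set y := (addRow s g).val with hydef
  set A := (stripLast A₀).val with hA
  set E' := (elimCol E).val.1 with hE'
  set δ := d + e with hδ
  have hvE : ∀ c ∈ cs, c ∉ v :: rowLabels E := fun c hc => by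
    simpa using ⟨by rintro rfl; exact hv hc, hdis c hc⟩
  rcases hx with ⟨hx, hl, hE⟩ | ⟨u, a, yu, hx, ha, hyu, hl, hE⟩
  · have hvE' : v ∉ rowLabels E' := hl ▸ (List.nodup_cons.1 hnd).1
    by_cases hz : (allZero y).val = true
    · have hval : (forgetBox row v ⟨cs ++ [v], E, A₀ ++ [s ++ [d]]⟩ D).val =
          (⟨cs, E', A⟩, (v, δ) :: D) := by
        simp only [forgetBox, bind_val, unsnoc_append, hg, hadd, hx, hz, if_true,
          ret_val, ← hA, ← hE']
      have hz' := (allZero_val y).1 hz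
      refine ⟨[(v, δ)], by rw [hval]; rfl, ?_, ?_, ?_⟩
      · rw [hval]; exact ⟨rfl, c2, c1, a1, a2, hsymm⟩
      · rw [hval]; simp only [hl]
        exact List.perm_append_comm
      · refine .of_eq fun x => ?_
        rw [hval]
        rw [hq]
        simp [hE, boxForm, dot_eq_zero_of_all cs y hz']; ring
    · by_cases hd : δ = 0
      · obtain ⟨D', h1, h3, h4, h5, h6⟩ := insertRow_spec v y cs E' D (by omega) c2.symm c1
          (by rw [hl]; exact hvE) (by rw [hl]; exact hnd)
        have hval : (forgetBox row v ⟨cs ++ [v], E, A₀ ++ [s ++ [d]]⟩ D).val =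
            (⟨cs, (insertRow v y E' D).val.1, A⟩, (insertRow v y E' D).val.2) := by
          simp only [forgetBox, bind_val, unsnoc_append, hg, hadd, hx, hz, if_false,
            ret_val, ← hA, ← hE', hd, ne_eq, not_true_eq_false, Bool.false_eq_true]
        refine ⟨D', by rw [hval]; exact h1, ?_, ?_, ?_⟩
        · rw [hval]; exact ⟨rfl, h4.trans c2, h3, a1, a2, hsymm⟩
        · rw [hval]; rw [← hl]; exact h5
        · rw [hval, ← hl]
          refine h6.frame (g := fun x => bil cs cs A x x) (fun _ h => h)
            (.bil (by rw [hl]; exact hvE) (by rw [hl]; exact hvE) A) ?_ ?_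
          · intro x; rw [hq, hE, hd]; ring
          · intro x; simp only [boxForm]; ring
      · obtain ⟨p1, p2, p3, -⟩ := pivotWith_spec cs cs cs.length δ y y A (by omega) hylen a2
        rw [a1] at p1
        have hval : (forgetBox row v ⟨cs ++ [v], E, A₀ ++ [s ++ [d]]⟩ D).val =
            (⟨cs, E', (pivotWith δ y y A).val⟩, (v, δ) :: D) := by
          simp only [forgetBox, bind_val, unsnoc_append, hg, hadd, hx, hz, if_false,
            ret_val, ← hA, ← hE', hd, ne_eq, not_false_eq_true, if_true, Bool.false_eq_true]
        refine ⟨[(v, δ)], by rw [hval]; rfl, ?_, ?_, ?_⟩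
        · rw [hval]
          refine ⟨rfl, c2, c1, p1, p2, fun x z => ?_⟩
          rw [p3, p3, hsymm]; ring
        · rw [hval]; simp only [hl]
          exact List.perm_append_comm
        · rw [hval]
          refine Cg.shear (w := v) (by simp) (-(1 / δ) • dot cs y) (by simp [dot_single hv])
            fun x => ?_
          rw [hq]
          simp only [hE, boxForm, p3, echForm_shear hv hvE', bil_shear hv, dot_shear hv]
          simp
          field_simp
          ring
  · set y₁ := (subMul (δ / (2 * a)) y yu).val with hy₁
    set yu' := (subMul (-(1 / 2)) yu y₁).val with hyu'
    set y₂ := (subMul 1 y₁ yu').val with hy₂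
    have l₁ : y₁.length = cs.length := by simp [hy₁, hylen, hyu]
    have lu : yu'.length = cs.length := by simp [hyu', hyu, l₁]
    have l₂ : y₂.length = cs.length := by simp [hy₂, l₁, lu]
    have d₁ : ∀ x, dot cs y₁ x = dot cs y x - δ / (2 * a) * dot cs yu x :=
      dot_subMul _ _ _ _ (by omega)
    have du : ∀ x, dot cs yu' x = dot cs yu x - -(1 / 2) * dot cs y₁ x :=
      dot_subMul _ _ _ _ (by omega)
    have d₂ : ∀ x, dot cs y₂ x = dot cs y₁ x - 1 * dot cs yu' x :=
      dot_subMul _ _ _ _ (by omega)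
    obtain ⟨p1, p2, p3, -⟩ := pivotWith_spec cs cs cs.length a yu' yu' A (by omega) lu a2
    rw [a1] at p1
    set A₁ := (pivotWith a yu' yu' A).val with hA₁
    obtain ⟨r1, r2, r3, -⟩ := pivotWith_spec cs cs cs.length (-a) y₂ y₂ A₁ (by omega) l₂ p2
    rw [p1] at r1
    set A₂ := (pivotWith (-a) y₂ y₂ A₁).val with hA₂
    have hval : (forgetBox row v ⟨cs ++ [v], E, A₀ ++ [s ++ [d]]⟩ D).val =
        (⟨cs, E', A₂⟩, (v, -a) :: (u, a) :: D) := by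
      simp only [forgetBox, bind_val, unsnoc_append, hg, hadd, hx,
        ret_val, ← hA, ← hE', ← hy₁, ← hyu', ← hy₂, ← hA₁, ← hA₂]
    have hu : u ∈ rowLabels E := hl.subset (by simp)
    have huv : u ≠ v := by rintro rfl; exact (List.nodup_cons.1 hnd).1 hu
    have hucs : u ∉ cs := fun h => hdis u h hu
    have hnd' := hl.nodup_iff.2 (List.nodup_cons.1 hnd).2
    have hvE' : v ∉ rowLabels E' := fun h =>
      (List.nodup_cons.1 hnd).1 (hl.subset (List.mem_cons_of_mem _ h))
    refine ⟨[(v, -a), (u, a)], by rw [hval]; rfl, ?_, ?_, ?_⟩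
    · rw [hval]
      refine ⟨rfl, c2, c1, r1, r2, fun x z => ?_⟩
      rw [r3, r3, p3, p3, hsymm]; ring
    · rw [hval]
      refine List.perm_append_comm.trans ?_
      simpa using hl.cons v
    · rw [hval]
      -- The elimination in column `v` moves echelon row variables only, so the terms of the
      -- symmetric part, including those with `x v`, are a frame.
      refine (hE.frame (W' := v :: rowLabels E) (p := fun x => _) (p' := fun x => _)
        (fun _ h => List.mem_cons_of_mem _ h)
        (g := fun x => bil cs cs A x x + 2 * x v * dot cs y x + δ * x v ^ 2) ?_ hq
          (fun _ => rfl)).trans ?_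
      · refine ((Indep.bil hdis hdis A).add (((Indep.const _ 2).mul (.coord ?_)).mul
          (.dot hdis y))).add ((Indep.const _ δ).mul fun x z h => ?_)
        · exact (List.nodup_cons.1 hnd).1
        · simp only [h v (List.nodup_cons.1 hnd).1]
      · have hp : Indep [u, v] fun x => echForm cs E' x + bil cs cs A x x := by
          have h : ∀ c ∈ cs, c ∉ [u, v] := fun c hc hc' => by
            rcases List.mem_pair.1 hc' with rfl | rfl
            · exact hucs hc
            · exact hv hc
          refine .add (.echForm h fun c hc hc' => ?_) (.bil h h A)
          rcases List.mem_pair.1 hc' with rfl | rfl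
          · exact (List.nodup_cons.1 hnd').1 hc
          · exact hvE' hc
        -- What is left over in the hyperbolic lemma is `α = yu`, `β = y`; the procedure computes
        -- `γ`, `α'` and `γ - α'` as `y₁`, `yu'` and `y₂`.
        have := Cg.hyperbolic (W := v :: rowLabels E) (List.mem_cons_of_mem _ hu)
          (List.mem_cons_self ..) huv (dot cs yu) (dot cs y) (dot_single hucs yu)
          (dot_single hv yu) (dot_single hucs y) (dot_single hv y) hp ha h2 δ
        refine (this.congr_left fun x => by ring).congr_right fun x => ?_
        simp only [boxForm, r3, p3, d₂, du, d₁, diagForm_cons, diagForm_nil]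
        field_simp
        ring

set_option maxHeartbeats 1000000 in
-- The potential rises only when the row of `v` enters the echelon form, and then by at most the
-- number of remaining columns. Everything else is a bounded number of passes over a matrix of order
-- at most `K`.
theorem forgetBox_time (row : List (V × F)) (v : V) (cs : List V)
    (N : Box V F) (D : List (V × F)) (hN : BoxOK (cs ++ [v]) N) (hnd : (v :: rowLabels N.ech).Nodup)
    (hdis : ∀ c ∈ cs, c ∉ rowLabels N.ech) (K b : ℕ) (hK : cs.length + 1 ≤ K)
    (hb : 2 * K + 8 ≤ b) :
    (forgetBox row v N D).time + b * pot (forgetBox row v N D).val.1.ech ≤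
      b * (pot N.ech + K) + 100 * (K * K) := by
  obtain ⟨cols, E, S⟩ := N
  obtain ⟨hcols, e1, e2, s1, s2, -⟩ := hN
  simp only at hcols e1 e2 s1 s2 hdis hnd ⊢
  subst hcols
  obtain ⟨g, e, hg⟩ : ∃ g e, (gather (cs ++ [v]) row).val = g ++ [e] := by
    rcases List.eq_nil_or_concat' (gather (cs ++ [v]) row).val with h | h
    · have := length_gather (cs ++ [v]) row
      simp [h] at this
    · exact h
  have hglen : g.length = cs.length := by
    have := length_gather (cs ++ [v]) row
    rw [hg] at this; simpa using this
  obtain ⟨A₀, s, d, rfl⟩ : ∃ A₀ s d, S = A₀ ++ [s ++ [d]] := by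
    rcases List.eq_nil_or_concat' S with h | ⟨A₀, r, rfl⟩
    · simp [h] at s1
    · have hr := s2 r (by simp)
      rcases List.eq_nil_or_concat' r with h | ⟨s, d, rfl⟩
      · simp [h] at hr
      · exact ⟨A₀, s, d, rfl⟩
  have hA₀ : A₀.length = cs.length := by simpa using s1
  have hs : s.length = cs.length := by simpa using s2 (s ++ [d]) (by simp)
  obtain ⟨a1, a2, -, a4⟩ := stripLast_spec cs.length v A₀ fun r hr => by
    simpa using s2 r (by simp [hr])
  rw [hA₀] at a1 a4
  have hylen : (addRow s g).val.length = cs.length := by simp [hs, hglen]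
  have hadd := addRow_append_singleton s g d e (hs.trans hglen.symm)
  have t1 := gather_time (cs ++ [v]) row
  have t2 := unsnoc_time [] (A₀ ++ [s ++ [d]])
  have t3 := addRow_time (s ++ [d]) (g ++ [e])
  have t4 := unsnoc_time 0 ((addRow s g).val ++ [d + e])
  have t5 := unsnoc_time v (cs ++ [v])
  have t6 := elimCol_time E e2
  simp only [List.length_append, List.length_singleton, hA₀, hs, hylen] at t1 t2 t3 t4 t5
  rw [show E.length = cs.length + 1 by simpa using e1] at t6
  obtain ⟨c1, c2, hx⟩ := elimCol_spec v cs E (by simpa using e1) e2 (List.nodup_cons.1 hnd).1 hdis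
    (List.nodup_cons.1 hnd).2
  set y := (addRow s g).val with hydef
  set A := (stripLast A₀).val with hA
  set E' := (elimCol E).val.1 with hE'
  set δ := d + e with hδ
  have q1 : K ≤ K * K := Nat.le_mul_self K
  have q2 : (2 * cs.length + 6) * cs.length ≤ 8 * (K * K) := by nlinarith
  have q3 : (2 * cs.length + 4) * cs.length ≤ 8 * (K * K) := by nlinarith
  have q4 : (4 * (cs.length + 1) + 8) * (cs.length + 1) ≤ 12 * (K * K) := by nlinarith
  have hb' : b * pot E' ≤ b * (pot E + K) := Nat.mul_le_mul_left _ (by omega)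
  have t7 := allZero_time y
  rw [hylen] at t7
  -- All quadratic terms have been bounded by multiples of `K * K`; as an atom it leaves linear
  -- goals, apart from products with `b`, which are atoms too.
  generalize K * K = Q at *
  rcases hx with ⟨hx, -, -⟩ | ⟨u, a, yu, hx, ha, hyu, -, -⟩
  · by_cases hz : (allZero y).val = true
    · simp only [forgetBox, bind_val, bind_time, ret_val, unsnoc_append, hg, hadd, hx, hz, if_true,
        ret_time, ← hE']
      omega
    · by_cases hd : δ = 0
      · have t8 := insertRow_time v y E' D b (by omega)
        have hb' : b * (pot E' + y.length) ≤ b * (pot E + K) :=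
          Nat.mul_le_mul_left _ (by omega)
        simp only [forgetBox, bind_val, bind_time, ret_val, unsnoc_append, hg, hadd, hx, hz,
          if_false, ret_time, hd, ne_eq, not_true_eq_false, ← hE', Bool.false_eq_true]
        rw [hd] at t4
        omega
      · obtain ⟨-, -, -, p4⟩ := pivotWith_spec cs cs cs.length δ y y A (by omega) hylen a2
        rw [a1] at p4
        simp only [forgetBox, bind_val, bind_time, ret_val, unsnoc_append, hg, hadd, hx, hz,
          if_false, ret_time, hd, ne_eq, not_false_eq_true, if_true, ← hA, ← hE',
          Bool.false_eq_true]
        omega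
  · set y₁ := (subMul (δ / (2 * a)) y yu).val with hy₁
    set yu' := (subMul (-(1 / 2)) yu y₁).val with hyu'
    set y₂ := (subMul 1 y₁ yu').val with hy₂
    have l₁ : y₁.length = cs.length := by simp [hy₁, hylen, hyu]
    have lu : yu'.length = cs.length := by simp [hyu', hyu, l₁]
    have l₂ : y₂.length = cs.length := by simp [hy₂, l₁, lu]
    obtain ⟨p1, p2, -, p4⟩ := pivotWith_spec cs cs cs.length a yu' yu' A (by omega) lu a2
    rw [a1] at p1 p4
    set A₁ := (pivotWith a yu' yu' A).val with hA₁
    obtain ⟨-, -, -, r4⟩ := pivotWith_spec cs cs cs.length (-a) y₂ y₂ A₁ (by omega) l₂ p2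
    rw [p1] at r4
    have t7 := subMul_time (δ / (2 * a)) y yu
    have t8 := subMul_time (-(1 / 2)) yu y₁
    have t9 := subMul_time 1 y₁ yu'
    rw [hylen] at t7
    rw [hyu] at t8
    rw [l₁] at t9
    simp only [forgetBox, bind_val, bind_time, ret_val, unsnoc_append, hg, hadd, hx,
      ret_time, ← hA, ← hE', ← hy₁, ← hyu', ← hy₂, ← hA₁]
    omega

end

/-- `t` is a nice tree decomposition for the relation `R`, with bags of size at most `K`, sorted by
their labels, with root bag `B` and list `W` of forgotten vertices. -/
inductive NiceOK {n : ℕ} (lab : Vector ℕ n) (R : Fin n → Fin n → Prop) (K : ℕ) :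
    NiceTree (Fin n) → List (Fin n) → List (Fin n) → Prop
  | leaf (B : List (Fin n)) (hB : B.Pairwise fun u v => lab.get u < lab.get v)
      (hK : B.length ≤ K) : NiceOK lab R K (NiceTree.leaf B) B []
  | introduce (v : Fin n) (t : NiceTree (Fin n)) (B₁ B₂ W : List (Fin n))
      (ht : NiceOK lab R K t (B₁ ++ B₂) W) (h₁ : ∀ c ∈ B₁, lab.get c < lab.get v)
      (h₂ : ∀ c ∈ B₂, lab.get v < lab.get c) (hv : v ∉ W) (hK : (B₁ ++ B₂).length + 1 ≤ K) :
      NiceOK lab R K (NiceTree.introduce v t) (B₁ ++ v :: B₂) W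
  | forget (v : Fin n) (t : NiceTree (Fin n)) (B W : List (Fin n))
      (ht : NiceOK lab R K t (B ++ [v]) W) (hR : ∀ u, R v u → lab.get u < lab.get v → u ∈ B) :
      NiceOK lab R K (NiceTree.forget v t) B (v :: W)
  | join (t₁ t₂ : NiceTree (Fin n)) (B W₁ W₂ : List (Fin n)) (h₁ : NiceOK lab R K t₁ B W₁)
      (h₂ : NiceOK lab R K t₂ B W₂) (hd : ∀ v ∈ W₁, v ∉ W₂) :
      NiceOK lab R K (NiceTree.join t₁ t₂) B (W₁ ++ W₂)

/-- The number of nodes. -/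
def NiceTree.size {V : Type*} : NiceTree V → ℕ
  | .leaf _ => 1
  | .introduce _ t => t.size + 1
  | .forget _ t => t.size + 1
  | .join t₁ t₂ => t₁.size + t₂.size + 1

/-! ### Structural consequences of the nice tree conditions -/

section
variable {n : ℕ} {lab : Vector ℕ n} {R : Fin n → Fin n → Prop} {K : ℕ} {t : NiceTree (Fin n)}
  {B W : List (Fin n)}

theorem NiceOK.sorted (h : NiceOK lab R K t B W) :
    B.Pairwise fun u v => lab.get u < lab.get v := by
  induction h with
  | leaf B hB hK => exact hB
  | introduce v t B₁ B₂ W ht h₁ h₂ hv hK ih =>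
    rw [List.pairwise_append] at ih ⊢
    refine ⟨ih.1, List.pairwise_cons.2 ⟨h₂, ih.2.1⟩, fun a ha b hb => ?_⟩
    rcases List.mem_cons.1 hb with rfl | hb
    · exact h₁ a ha
    · exact ih.2.2 a ha b hb
  | forget v t B W ht hR ih => exact (List.pairwise_append.1 ih).1
  | join t₁ t₂ B W₁ W₂ h₁ h₂ hd ih₁ ih₂ => exact ih₁

theorem nodup_of_sorted (h : B.Pairwise fun u v => lab.get u < lab.get v) : B.Nodup :=
  h.imp fun h e => by subst e; exact lt_irrefl _ h

theorem NiceOK.length_le (h : NiceOK lab R K t B W) : B.length ≤ K := by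
  induction h with
  | leaf B hB hK => exact hK
  | introduce v t B₁ B₂ W ht h₁ h₂ hv hK ih => simp at hK ⊢; omega
  | forget v t B W ht hR ih => simp at ih; omega
  | join t₁ t₂ B W₁ W₂ h₁ h₂ hd ih₁ ih₂ => exact ih₁

theorem NiceOK.disjoint (h : NiceOK lab R K t B W) : ∀ c ∈ B, c ∉ W := by
  induction h with
  | leaf B hB hK => simp
  | introduce v t B₁ B₂ W ht h₁ h₂ hv hK ih =>
    intro c hc
    simp only [List.mem_append, List.mem_cons] at hc
    rcases hc with hc | rfl | hc
    · exact ih c (by simp [hc])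
    · exact hv
    · exact ih c (by simp [hc])
  | forget v t B W ht hR ih =>
    intro c hc
    have := nodup_of_sorted ht.sorted
    rw [List.nodup_append] at this
    simp only [List.mem_cons, not_or]
    exact ⟨this.2.2 c hc v (by simp), ih c (by simp [hc])⟩
  | join t₁ t₂ B W₁ W₂ h₁ h₂ hd ih₁ ih₂ =>
    intro c hc
    simpa using ⟨ih₁ c hc, ih₂ c hc⟩

theorem NiceOK.nodup (h : NiceOK lab R K t B W) : W.Nodup := by
  induction h with
  | leaf B hB hK => simp
  | introduce v t B₁ B₂ W ht h₁ h₂ hv hK ih => exact ih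
  | forget v t B W ht hR ih => exact List.nodup_cons.2 ⟨ht.disjoint v (by simp), ih⟩
  | join t₁ t₂ B W₁ W₂ h₁ h₂ hd ih₁ ih₂ =>
    rw [List.nodup_append]
    exact ⟨ih₁, ih₂, fun a ha b hb e => hd a ha (e ▸ hb)⟩

/-- At a join this is what decouples the children: a piece `vertexForm` of one child involves only
variables of its own forgotten vertices and of the common bag. -/
theorem NiceOK.closed (h : NiceOK lab R K t B W) :
    ∀ v ∈ W, ∀ u, R v u → lab.get u < lab.get v → u ∈ W ∨ u ∈ B := by
  induction h with
  | leaf B hB hK => simp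
  | introduce v t B₁ B₂ W ht h₁ h₂ hv hK ih =>
    intro w hw u hu hl
    rcases ih w hw u hu hl with h | h
    · exact Or.inl h
    · right; simp at h ⊢; tauto
  | forget v t B W ht hR ih =>
    intro w hw u hu hl
    rcases List.mem_cons.1 hw with rfl | hw
    · exact Or.inr (hR u hu hl)
    · have := ih w hw u hu hl
      simp at this ⊢; tauto
  | join t₁ t₂ B W₁ W₂ h₁ h₂ hd ih₁ ih₂ =>
    intro w hw u hu hl
    rcases List.mem_append.1 hw with hw | hw
    · have := ih₁ w hw u hu hl
      simp; tauto
    · have := ih₂ w hw u hu hl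
      simp; tauto

/-- The bag left when `v` is forgotten contains all its smaller neighbours. This bounds the number
of nonzero entries of the matrix. -/
theorem NiceOK.exists_bag (h : NiceOK lab R K t B W) : ∀ v ∈ W, ∃ B' : List (Fin n),
    B'.length + 1 ≤ K ∧ ∀ u, R v u → lab.get u < lab.get v → u ∈ B' := by
  induction h with
  | leaf B hB hK => simp
  | introduce v t B₁ B₂ W ht h₁ h₂ hv hK ih => exact ih
  | forget v t B W ht hR ih =>
    intro w hw
    rcases List.mem_cons.1 hw with rfl | hw
    · exact ⟨B, by simpa using ht.length_le, hR⟩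
    · exact ih w hw
  | join t₁ t₂ B W₁ W₂ h₁ h₂ hd ih₁ ih₂ =>
    intro w hw
    rcases List.mem_append.1 hw with hw | hw
    · exact ih₁ w hw
    · exact ih₂ w hw

end

/-! ### Correctness and cost of the bottom-up processing -/

section
variable {F : Type*} [Field F] [DecidableEq F] {n : ℕ} {lab : Vector ℕ n}

/-- Both lists are sorted, so a single simultaneous pass suffices. Entries outside the bag have
larger labels than the whole bag; they come last in the sparse row and never block the pass. -/
theorem gather_map (f : Fin n → F) (cs l : List (Fin n))
    (hcs : cs.Pairwise fun u v => lab.get u < lab.get v)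
    (hl : l.Pairwise fun u v => lab.get u < lab.get v)
    (h : ∀ u ∈ l, u ∈ cs ∨ ∀ c ∈ cs, lab.get c < lab.get u) (h0 : ∀ u ∈ cs, u ∉ l → f u = 0) :
    (gather cs (l.map fun u => (u, f u))).val = cs.map f := by
  induction cs generalizing l with
  | nil => simp [gather]
  | cons c cs ih =>
    rw [List.pairwise_cons] at hcs
    cases l with
    | nil =>
      have := ih [] hcs.2 (by simp) (by simp) (by simpa using fun u hu => h0 u (by simp [hu]))
      simp only [List.map_nil] at this
      simp [gather, this, h0 c]
    | cons u l =>
      rw [List.pairwise_cons] at hl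
      by_cases hu : u = c
      · subst hu
        have := ih l hcs.2 hl.2 (fun w hw => ?_) (fun w hw hw' => h0 w (by simp [hw]) ?_)
        · simp [gather, this]
        · rcases h w (by simp [hw]) with h | h
          · rcases List.mem_cons.1 h with rfl | h
            · exact absurd (hl.1 _ hw) (lt_irrefl _)
            · exact Or.inl h
          · exact Or.inr fun d hd => h d (by simp [hd])
        · simp only [List.mem_cons, not_or]
          refine ⟨?_, hw'⟩
          rintro rfl
          exact lt_irrefl _ (hcs.1 _ hw)
      · have hc : c ∉ u :: l := by
          intro hc
          rcases List.mem_cons.1 hc with e | hc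
          · exact hu e.symm
          · have h1 := hl.1 c hc
            rcases h u (by simp) with h | h
            · rcases List.mem_cons.1 h with h | h
              · exact hu h
              · exact lt_asymm h1 (hcs.1 u h)
            · exact lt_asymm h1 (h c (by simp))
        have := ih (u :: l) hcs.2 (List.pairwise_cons.2 hl) (fun w hw => ?_)
          (fun w hw hw' => h0 w (by simp [hw]) hw')
        · simp only [List.map_cons] at this
          simp [gather, hu, this, h0 c (by simp) hc]
        · rcases h w hw with h | h
          · rcases List.mem_cons.1 h with rfl | h
            · exact absurd hw hc
            · exact Or.inl h
          · exact Or.inr fun d hd => h d (by simp [hd])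

/-- The part of the quadratic form of `M` that involves `v` and otherwise only smaller labels. -/
def vertexForm (M : Matrix (Fin n) (Fin n) F) (lab : Vector ℕ n) (v : Fin n) (x : Fin n → F) : F :=
  x v * (2 * (∑ u with lab.get u < lab.get v, M v u * x u) + M v v * x v)

theorem dot_map (f : Fin n → F) (B : List (Fin n)) (x : Fin n → F) :
    dot B (B.map f) x = (B.map fun u => f u * x u).sum := by
  induction B <;> simp_all

theorem vertexForm_eq (M : Matrix (Fin n) (Fin n) F) (v : Fin n) (B : List (Fin n))
    (hB : (B ++ [v]).Pairwise fun u v => lab.get u < lab.get v)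
    (hR : ∀ u, M v u ≠ 0 → lab.get u < lab.get v → u ∈ B) (x : Fin n → F) :
    vertexForm M lab v x = x v * (2 * dot B (B.map (M v)) x + M v v * x v) := by
  rw [List.pairwise_append] at hB
  rw [vertexForm, dot_map, ← List.sum_toFinset _ (nodup_of_sorted hB.1)]
  congr 3
  symm
  refine Finset.sum_subset (fun u hu => ?_) fun u hu hu' => ?_
  · simpa using hB.2.2 u (by simpa using hu) v (by simp)
  · by_contra h
    exact hu' (by simpa using hR u (left_ne_zero_of_mul h) (by simpa using hu))

variable {M : Matrix (Fin n) (Fin n) F} {rows : Vector (List (Fin n × F)) n} {K : ℕ}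

/-- The sparse rows of `M`, sorted by their labels. -/
def RowsOK (lab : Vector ℕ n) (M : Matrix (Fin n) (Fin n) F) (rows : Vector (List (Fin n × F)) n) :
    Prop :=
  ∀ v, ∃ l : List (Fin n), rows.get v = l.map (fun u => (u, M v u)) ∧
    l.Pairwise (fun u v => lab.get u < lab.get v) ∧ ∀ u, u ∈ l ↔ M v u ≠ 0

/-- Every off-diagonal entry is used once, when the endpoint of larger label is forgotten, so the
pieces `vertexForm` of the forgotten vertices are what the subtree has seen. The incoming array `D`
is arbitrary because the output array is global. -/
theorem process_spec (h2 : (2 : F) ≠ 0) (hlab : Function.Injective lab.get)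
    (hrows : RowsOK lab M rows) {t : NiceTree (Fin n)} {B W : List (Fin n)}
    (ht : NiceOK lab (fun v u => M v u ≠ 0) K t B W) (D : List (Fin n × F)) :
    ∃ D', (process lab rows t D).val.2 = D' ++ D ∧ BoxOK B (process lab rows t D).val.1 ∧
      (rowLabels (process lab rows t D).val.1.ech ++ D'.map Prod.fst).Perm W ∧
      Cg W (fun x => (W.map fun v => vertexForm M lab v x).sum)
        (fun x => boxForm (process lab rows t D).val.1 x + diagForm D' x) := by
  induction ht generalizing D with
  | leaf B hB hK =>
    obtain ⟨h1, h2, h3⟩ := leafBox_spec (F := F) B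
    exact ⟨[], by simp [process], by simpa [process] using h1, by simp [process, h2],
      .of_eq fun x => by simp [process, h3]⟩
  | introduce v t B₁ B₂ W ht h₁ h₂ hv hK ih =>
    obtain ⟨D', g1, g2, g3, g4⟩ := ih D
    obtain ⟨i1, i2, i3, -⟩ := introduceBox_spec lab v B₁ B₂ _ g2 h₁ h₂
    refine ⟨D', by simp [process, g1], by simpa [process] using i1, by simpa [process, i2] using g3,
      g4.congr_right fun x => ?_⟩
    simp only [process, bind_val, ret_val, i3]
  | forget v t B W ht hR ih =>
    obtain ⟨D', g1, g2, g3, g4⟩ := ih D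
    have hs := ht.sorted
    have hs' := List.pairwise_append.1 hs
    have hdis := ht.disjoint
    have hsub : ∀ w ∈ rowLabels (process lab rows t D).val.1.ech, w ∈ W := fun w hw =>
      g3.subset (by simp [hw])
    have hnd : (v :: rowLabels (process lab rows t D).val.1.ech).Nodup := by
      refine List.nodup_cons.2 ⟨fun h => hdis v (by simp) (hsub v h), ?_⟩
      exact (List.nodup_append.1 (g3.nodup_iff.2 ht.nodup)).1
    obtain ⟨l, l1, l2, l3⟩ := hrows v
    have hg : (gather (B ++ [v]) (rows.get v)).val = B.map (M v) ++ [M v v] := by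
      rw [l1, gather_map (M v) _ _ hs l2, List.map_append]; rfl
      · intro u hu
        rcases lt_trichotomy (lab.get u) (lab.get v) with h | h | h
        · exact Or.inl (by simp [hR u ((l3 u).1 hu) h])
        · exact Or.inl (by simp [hlab h])
        · refine Or.inr fun c hc => ?_
          rcases List.mem_append.1 hc with hc | hc
          · exact (hs'.2.2 c hc v (by simp)).trans h
          · rw [List.mem_singleton.1 hc]; exact h
      · intro u _ hu
        by_contra h
        exact hu ((l3 u).2 h)
    obtain ⟨D₁, f1, f2, f3, f4⟩ := forgetBox_spec h2 (rows.get v) v B _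
      (process lab rows t D).val.2 g2 hnd
      (fun h => lt_irrefl _ (hs'.2.2 v h v (by simp)))
      (fun c hc h => hdis c (by simp [hc]) (hsub c h)) _ _ hg
    have hval : (process lab rows (NiceTree.forget v t) D).val =
        (forgetBox (rows.get v) v (process lab rows t D).val.1 (process lab rows t D).val.2).val :=
      rfl
    rw [hval]
    refine ⟨D₁ ++ D', by rw [f1, g1, List.append_assoc], f2, ?_, ?_⟩
    · rw [List.map_append, ← List.append_assoc]
      exact (f3.append_right _).trans (by simpa using g3.cons v)
    -- The child is processed with the new piece of `v` as frame, which is allowed since it only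
    -- involves bag variables; then `v` is forgotten, with the finished diagonal form as frame.
    · refine (g4.frame (g := vertexForm M lab v) (W' := v :: W) (by simp) ?_
        (fun x => by simp; ring) (fun x => rfl)).trans
        (f4.frame (g := diagForm D') ?_ (.diagForm ?_) ?_ ?_)
      · have : vertexForm M lab v = fun x => x v * (2 * dot B (B.map (M v)) x + M v v * x v) :=
          funext (vertexForm_eq M v B hs hR)
        rw [this]
        have hv := hdis v (by simp)
        exact .mul (.coord hv) (.add (.mul (.const _ 2)
          (.dot (fun c hc => hdis c (by simp [hc])) _)) (.mul (.const _ _) (.coord hv)))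
      · intro w hw
        rcases List.mem_cons.1 hw with rfl | hw
        · simp
        · exact List.mem_cons_of_mem _ (hsub w hw)
      · intro w hw hw'
        rcases List.mem_cons.1 hw' with rfl | hw'
        · exact hdis w (by simp) (g3.subset (List.mem_append_right _ hw))
        · exact (List.nodup_append.1 (g3.nodup_iff.2 ht.nodup)).2.2 w hw' w hw rfl
      · intro x; rw [vertexForm_eq M v B hs hR]; ring
      · intro x; simp; ring
  | join t₁ t₂ B W₁ W₂ h₁ h₂ hd ih₁ ih₂ =>
    obtain ⟨D₁, f1, f2, f3, f4⟩ := ih₁ D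
    obtain ⟨D₂, g1, g2, g3, g4⟩ := ih₂ (process lab rows t₁ D).val.2
    set x := (process lab rows t₁ D).val with hx
    set y := (process lab rows t₂ x.2).val with hy
    have hsubx : ∀ w ∈ rowLabels x.1.ech, w ∈ W₁ := fun w hw => f3.subset (by simp [hw])
    have hsuby : ∀ w ∈ rowLabels y.1.ech, w ∈ W₂ := fun w hw => g3.subset (by simp [hw])
    have hDx : ∀ w ∈ D₁.map Prod.fst, w ∈ W₁ := fun w hw =>
      f3.subset (List.mem_append_right _ hw)
    have hDy : ∀ w ∈ D₂.map Prod.fst, w ∈ W₂ := fun w hw =>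
      g3.subset (List.mem_append_right _ hw)
    have ndx := List.nodup_append.1 (f3.nodup_iff.2 h₁.nodup)
    have ndy := List.nodup_append.1 (g3.nodup_iff.2 h₂.nodup)
    obtain ⟨D₃, j1, j2, j3, j4⟩ := joinBox_spec B x.1 y.1 y.2 f2 g2
      (fun c hc h => by
        rcases List.mem_append.1 h with h | h
        · exact h₁.disjoint c hc (hsubx c h)
        · exact h₂.disjoint c hc (hsuby c h))
      (List.nodup_append.2 ⟨ndx.1, ndy.1, fun a ha b hb e =>
        hd a (hsubx a ha) (e ▸ hsuby b hb)⟩)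
    have hval : (process lab rows (NiceTree.join t₁ t₂) D).val = (joinBox x.1 y.1 y.2).val := rfl
    rw [hval]
    refine ⟨D₃ ++ (D₂ ++ D₁), by rw [j1, g1, f1]; simp, j2, ?_, ?_⟩
    · simp only [List.map_append]
      rw [← List.append_assoc]
      refine (j3.append_right _).trans (List.Perm.trans ?_ (f3.append g3))
      simp only [List.append_assoc]
      refine List.Perm.append_left _ ?_
      have := List.perm_append_comm (l₁ := rowLabels y.1.ech ++ D₂.map Prod.fst)
        (l₂ := D₁.map Prod.fst)
      rwa [List.append_assoc] at this
    -- By closedness the neighbours of smaller label of a vertex in `W₂` lie in `W₂` or in the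
    -- common bag, hence outside `W₁`.
    · have i₂ : Indep W₁ fun z => (W₂.map fun v => vertexForm M lab v z).sum := by
        intro z z' hz
        refine congrArg List.sum (List.map_congr_left fun v hv => ?_)
        have hv' : v ∉ W₁ := fun h => hd v h hv
        have : ∑ u with lab.get u < lab.get v, M v u * z u =
            ∑ u with lab.get u < lab.get v, M v u * z' u := by
          refine Finset.sum_congr rfl fun u hu => ?_
          by_cases h0 : M v u = 0
          · simp [h0]
          · rw [hz u ?_]
            rcases h₂.closed v hv u h0 (by simpa using hu) with h | h
            · exact fun h' => hd u h' h
            · exact h₁.disjoint u h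
        simp only [vertexForm]
        rw [this, hz v hv']
      -- The first child has been processed by now, so here the frame is its box and diagonal form
      -- rather than its original pieces.
      have i₁ : Indep W₂ fun z => boxForm x.1 z + diagForm D₁ z := by
        have hc : ∀ c ∈ x.1.cols, c ∉ W₂ := fun c hc => h₂.disjoint c (f2.cols ▸ hc)
        exact .add (.add (.echForm hc fun v hv h => hd v (hsubx v hv) h) (.bil hc hc _))
          (.diagForm fun v hv h => hd v (hDx v hv) h)
      refine (f4.frame (W' := W₁ ++ W₂) (List.subset_append_left _ _) i₂ (fun z => by simp)
        (fun z => rfl)).trans ((g4.frame (List.subset_append_right _ _) i₁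
          (fun z => by ring) (fun z => rfl)).trans
        (j4.frame (g := fun z => diagForm D₂ z + diagForm D₁ z) ?_ (.add (.diagForm ?_)
          (.diagForm ?_)) (fun z => by ring) (fun z => by simp; ring)))
      · intro w hw
        rcases List.mem_append.1 hw with hw | hw
        · exact List.mem_append_left _ (hsubx w hw)
        · exact List.mem_append_right _ (hsuby w hw)
      · intro v hv hv'
        rcases List.mem_append.1 hv' with hv' | hv'
        · exact hd v (hsubx v hv') (hDy v hv)
        · exact ndy.2.2 v hv' v hv rfl
      · intro v hv hv'
        rcases List.mem_append.1 hv' with hv' | hv'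
        · exact ndx.2.2 v hv' v hv rfl
        · exact hd v (hDx v hv) (hsuby v hv')

/-- The factor `2 * K + 8` is the price of one elimination step, so the left-hand side is an
amortized cost. Forget and introduce nodes add at most `(2 * K + 8) * K ≤ 10 * K ^ 2` to the
potential term, and a join adds nothing to it. -/
theorem process_time (h2 : (2 : F) ≠ 0) (hlab : Function.Injective lab.get)
    (hrows : RowsOK lab M rows) (hK1 : 1 ≤ K) {t : NiceTree (Fin n)} {B W : List (Fin n)}
    (ht : NiceOK lab (fun v u => M v u ≠ 0) K t B W) (D : List (Fin n × F)) :
    (process lab rows t D).time + (2 * K + 8) * pot (process lab rows t D).val.1.ech ≤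
      200 * (K * K) * t.size := by
  have q1 : K ≤ K * K := Nat.le_mul_self K
  have q2 : (2 * K + 8) * K ≤ 10 * (K * K) := by nlinarith
  induction ht generalizing D with
  | leaf B hB hK =>
    obtain ⟨h3, h4⟩ := leafBox_time (F := F) B K hK hK1
    simp only [process, bind_val, bind_time, ret_val, ret_time, h4, NiceTree.size]
    omega
  | introduce v t B₁ B₂ W ht h₁ h₂ hv hK ih =>
    obtain ⟨D', g1, g2, g3, g4⟩ := process_spec h2 hlab hrows ht D
    obtain ⟨i1, i2, i3, i4, i5⟩ := introduceBox_spec lab v B₁ B₂ _ g2 h₁ h₂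
    have i5 := i5 K (by omega) hK1
    have h := ih D
    have i4 := (Nat.mul_le_mul_left (2 * K + 8) i4)
    have hK' : (2 * K + 8) * (B₁ ++ B₂).length ≤ (2 * K + 8) * K :=
      Nat.mul_le_mul_left _ (by omega)
    rw [Nat.mul_add] at i4
    simp only [process, bind_val, bind_time, ret_val, ret_time, NiceTree.size,
      Nat.mul_add (200 * (K * K))] at h ⊢
    omega
  | forget v t B W ht hR ih =>
    obtain ⟨D', g1, g2, g3, g4⟩ := process_spec h2 hlab hrows ht D
    have hsub : ∀ w ∈ rowLabels (process lab rows t D).val.1.ech, w ∈ W := fun w hw =>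
      g3.subset (by simp [hw])
    have hf := forgetBox_time (rows.get v) v B _ (process lab rows t D).val.2 g2
      (List.nodup_cons.2 ⟨fun h => ht.disjoint v (by simp) (hsub v h),
        (List.nodup_append.1 (g3.nodup_iff.2 ht.nodup)).1⟩)
      (fun c hc h => ht.disjoint c (by simp [hc]) (hsub c h)) K (2 * K + 8)
      (by simpa using ht.length_le) le_rfl
    have h := ih D
    rw [Nat.mul_add] at hf
    simp only [process, bind_val, bind_time, NiceTree.size,
      Nat.mul_add (200 * (K * K))] at h ⊢
    omega
  | join t₁ t₂ B W₁ W₂ h₁ h₂ hd ih₁ ih₂ =>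
    obtain ⟨-, -, g2, -⟩ := process_spec h2 hlab hrows h₁ D
    obtain ⟨-, -, g2', -⟩ := process_spec h2 hlab hrows h₂ (process lab rows t₁ D).val.2
    have hj := joinBox_time B _ _ (process lab rows t₂ (process lab rows t₁ D).val.2).val.2 g2 g2'
      K (2 * K + 8) h₁.length_le hK1 le_rfl
    have h := ih₁ D
    have h' := ih₂ (process lab rows t₁ D).val.2
    rw [Nat.mul_add (2 * K + 8)] at hj
    simp only [process, bind_val, bind_time, NiceTree.size,
      Nat.mul_add (200 * (K * K))] at h ⊢
    omega

end

/-! ### Building blocks of the nice tree -/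

section
variable {n : ℕ} {lab : Vector ℕ n} {R : Fin n → Fin n → Prop} {K : ℕ}

theorem sorted_ext {A B : List (Fin n)} (hA : A.Pairwise fun u v => lab.get u < lab.get v)
    (hB : B.Pairwise fun u v => lab.get u < lab.get v) (h : ∀ v, v ∈ A ↔ v ∈ B) : A = B := by
  refine List.Perm.eq_of_pairwise (le := fun u v => lab.get u < lab.get v)
    (fun u v _ _ h h' => absurd h (lt_asymm h')) hA hB ?_
  exact (List.perm_ext_iff_of_nodup (nodup_of_sorted hA) (nodup_of_sorted hB)).2 h

theorem exists_position (v : Fin n) (X : List (Fin n))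
    (hX : X.Pairwise fun u v => lab.get u < lab.get v) (hv : ∀ c ∈ X, lab.get c ≠ lab.get v) :
    ∃ X₁ X₂, X = X₁ ++ X₂ ∧ (∀ c ∈ X₁, lab.get c < lab.get v) ∧
      ∀ c ∈ X₂, lab.get v < lab.get c := by
  induction X with
  | nil => exact ⟨[], [], by simp⟩
  | cons c X ih =>
    rw [List.pairwise_cons] at hX
    simp only [List.forall_mem_cons] at hv
    rcases lt_or_gt_of_ne hv.1 with h | h
    · obtain ⟨X₁, X₂, rfl, h₁, h₂⟩ := ih hX.2 hv.2
      exact ⟨c :: X₁, X₂, rfl, by simpa using ⟨h, h₁⟩, h₂⟩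
    · exact ⟨[], c :: X, rfl, by simp, by simpa using ⟨h, fun d hd => h.trans (hX.1 d hd)⟩⟩

/-- Forgetting before introducing keeps the bags within the size of the initial one. The list `gs`
runs from the largest label downwards, so its reversal is the end of the sorted bag and each
forgotten vertex is the last column. The introduced vertices have smaller labels than all of `gs`
and therefore find their places inside `X`; the resulting list is described by its members only,
since sortedness determines the rest. -/
theorem climb_spec (hlab : Function.Injective lab.get) (gs vs : List (Fin n))
    (t : NiceTree (Fin n)) (X W : List (Fin n)) (ht : NiceOK lab R K t (X ++ gs.reverse) W)
    (hlen : vs.length ≤ gs.length) (hR : ∀ f ∈ gs, ∀ u, R f u → lab.get u < lab.get f →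
      u ∈ X ++ gs.reverse) (hvs : vs.Nodup) (hvX : ∀ v ∈ vs, v ∉ X) (hvW : ∀ v ∈ vs, v ∉ W)
    (hvg : ∀ v ∈ vs, ∀ f ∈ gs, lab.get v < lab.get f) :
    ∃ X', NiceOK lab R K (climb t gs vs).val X' (gs.reverse ++ W) ∧
      (∀ v, v ∈ X' ↔ v ∈ X ∨ v ∈ vs) ∧
      (climb t gs vs).val.size = t.size + gs.length + vs.length ∧
      (climb t gs vs).time = 2 * gs.length + 1 := by
  induction gs generalizing vs t X W with
  | nil =>
    obtain rfl : vs = [] := by simpa using hlen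
    exact ⟨X, by simpa [climb] using ht, by simp, by simp [climb], by simp [climb]⟩
  | cons f gs ih =>
    have hs := ht.sorted
    have hforget : NiceOK lab R K (NiceTree.forget f t) (X ++ gs.reverse) (f :: W) := by
      refine .forget f t _ W (by simpa using ht) fun u hu hl => ?_
      have := hR f (by simp) u hu hl
      simp only [List.reverse_cons, List.mem_append, List.mem_singleton] at this ⊢
      rcases this with h | h | h
      · exact Or.inl h
      · exact Or.inr h
      · subst h; exact absurd hl (lt_irrefl _)
    have hR' : ∀ f' ∈ gs, ∀ u, R f' u → lab.get u < lab.get f' → u ∈ X ++ gs.reverse := by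
      intro f' hf' u hu hl
      have := hR f' (by simp [hf']) u hu hl
      simp only [List.reverse_cons, List.mem_append, List.mem_singleton] at this ⊢
      rcases this with h | h | h
      · exact Or.inl h
      · exact Or.inr h
      · subst h
        rw [List.reverse_cons, ← List.append_assoc, List.pairwise_append] at hs
        -- A vertex of the bag that has just been forgotten has larger label than those forgotten
        -- later, so it is not one of their smaller neighbours.
        exact absurd hl (lt_asymm (hs.2.2 f' (by simp [hf']) u (by simp)))
    cases vs with
    | nil =>
      obtain ⟨X', h1, h2, h3, h4⟩ := ih [] (NiceTree.forget f t) X (f :: W) hforget (by simp) hR'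
        (by simp) (by simp) (by simp) (by simp)
      refine ⟨X', by simpa [climb] using h1, h2, ?_, ?_⟩
      · simp [climb, h3, NiceTree.size]; omega
      · simp [climb, h4]; omega
    | cons v vs =>
      simp only [List.forall_mem_cons, List.nodup_cons] at hvs hvX hvW hvg
      have hs' := hforget.sorted
      obtain ⟨X₁, X₂, rfl, p₁, p₂⟩ := exists_position v X (List.pairwise_append.1 hs').1
        (fun c hc h => hvX.1 (hlab h ▸ hc))
      have hlen' := ht.length_le
      have hintro : NiceOK lab R K (NiceTree.introduce v (NiceTree.forget f t))
          ((X₁ ++ v :: X₂) ++ gs.reverse) (f :: W) := by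
        rw [List.append_assoc, List.cons_append]
        refine .introduce v _ X₁ (X₂ ++ gs.reverse) _ (by simpa using hforget) p₁ (fun c hc => ?_)
          ?_ ?_
        · rcases List.mem_append.1 hc with hc | hc
          · exact p₂ c hc
          · exact hvg.1.2 c (by simpa using hc)
        · simp only [List.mem_cons, not_or]
          refine ⟨?_, hvW.1⟩
          rintro rfl
          exact lt_irrefl _ hvg.1.1
        · simp at hlen' ⊢; omega
      have hR'' : ∀ f' ∈ gs, ∀ u, R f' u → lab.get u < lab.get f' →
          u ∈ (X₁ ++ v :: X₂) ++ gs.reverse := fun f' hf' u hu hl => by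
        have := hR' f' hf' u hu hl
        simp at this ⊢; tauto
      have hvX' : ∀ w ∈ vs, w ∉ X₁ ++ v :: X₂ := fun w hw => by
        have := hvX.2 w hw
        simp only [List.mem_append, List.mem_cons, not_or] at this ⊢
        refine ⟨this.1, ?_, this.2⟩
        rintro rfl
        exact hvs.1 hw
      have hvW' : ∀ w ∈ vs, w ∉ f :: W := fun w hw => by
        simp only [List.mem_cons, not_or]
        refine ⟨?_, hvW.2 w hw⟩
        rintro rfl
        exact lt_irrefl _ (hvg.2 w hw).1
      obtain ⟨X', h1, h2, h3, h4⟩ := ih vs _ (X₁ ++ v :: X₂) (f :: W) hintro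
        (by simpa using hlen) hR'' hvs.2 hvX' hvW' (fun w hw => (hvg.2 w hw).2)
      refine ⟨X', by simpa [climb] using h1, fun w => ?_, ?_, ?_⟩
      · rw [h2]; simp; tauto
      · simp [climb, h3, NiceTree.size]; omega
      · simp [climb, h4]; omega

/-- The vertices that a bag shares with its parent precede its new vertices, and are in the order of
the parent. That is why one pass over `P` separates the two parts. -/
theorem splitBag_spec {P P₀ fs : List (Fin n)} (hsub : P₀.Sublist P) (hP : P.Nodup)
    (hfs : ∀ f ∈ fs, f ∉ P) :
    (splitBag P (P₀ ++ fs)).val = (P.filter (· ∉ P₀), fs) ∧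
      (splitBag P (P₀ ++ fs)).time ≤ 2 * P.length + 1 := by
  induction hsub with
  | slnil => simp [splitBag]
  | @cons P₀ P p hsub ih =>
    rw [List.nodup_cons] at hP
    have hp : p ∉ P₀ := fun h => hP.1 (hsub.subset h)
    obtain ⟨h1, h2⟩ := ih hP.2 fun f hf h => hfs f hf (by simp [h])
    rcases hb : P₀ ++ fs with _ | ⟨x, b⟩
    · obtain ⟨rfl, rfl⟩ := List.append_eq_nil_iff.1 hb
      simp [splitBag]
    · have hx : p ≠ x := by
        rintro rfl
        have : p ∈ P₀ ++ fs := by rw [hb]; simp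
        rcases List.mem_append.1 this with h | h
        · exact hp h
        · exact hfs p h (by simp)
      rw [hb] at h1 h2
      simp [splitBag, hx, h1, hp]
      omega
  | @cons_cons P₀ P p hsub ih =>
    rw [List.nodup_cons] at hP
    obtain ⟨h1, h2⟩ := ih hP.2 fun f hf h => hfs f hf (by simp [h])
    constructor
    · simp only [List.cons_append, splitBag, if_true, bind_val, ret_val, h1]
      congr 1
      simp only [List.mem_cons, true_or, not_true_eq_false, decide_false, Bool.false_eq_true,
        not_false_eq_true, List.filter_cons_of_neg]
      refine List.filter_congr fun x hx => ?_
      have : x ≠ p := by rintro rfl; exact hP.1 hx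
      simp [this]
    · simp [splitBag]; omega

/-- The new vertices `fs` stay at the end, so the pass ends before the bag argument is exhausted.
This is where `fs ≠ []` matters: on an exhausted bag `enlarge` returns the empty list. -/
theorem enlarge_spec {P P₀ fs : List (Fin n)} (r : ℕ) (hsub : P₀.Sublist P) (hP : P.Nodup)
    (hfs : ∀ f ∈ fs, f ∉ P) (hne : fs ≠ []) :
    (∃ X, (enlarge r P (P₀ ++ fs)).val = X ++ fs ∧ X.Sublist P ∧
      (∀ v, v ∈ X ↔ v ∈ P₀ ∨ v ∈ (P.filter (· ∉ P₀)).take r) ∧ X.length ≤ P₀.length + r) ∧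
      (enlarge r P (P₀ ++ fs)).time ≤ 2 * P.length + 1 := by
  induction hsub generalizing r with
  | slnil => cases r <;> simp [enlarge]
  | @cons P₀ P p hsub ih =>
    rw [List.nodup_cons] at hP
    have hp : p ∉ P₀ := fun h => hP.1 (hsub.subset h)
    have ih := fun r => ih r hP.2 fun f hf h => hfs f hf (by simp [h])
    rcases hb : P₀ ++ fs with _ | ⟨x, b⟩
    · exact absurd (List.append_eq_nil_iff.1 hb).2 hne
    · have hx : p ≠ x := by
        rintro rfl
        have : p ∈ P₀ ++ fs := by rw [hb]; simp
        rcases List.mem_append.1 this with h | h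
        · exact hp h
        · exact hfs p h (by simp)
      rw [hb] at ih
      cases r with
      | zero =>
        obtain ⟨⟨X, h1, h2, h3, h4⟩, h5⟩ := ih 0
        refine ⟨⟨X, by simp [enlarge, hx, h1], h2.cons _, by simpa using h3, h4⟩, ?_⟩
        simp [enlarge, hx]; omega
      | succ r =>
        obtain ⟨⟨X, h1, h2, h3, h4⟩, h5⟩ := ih r
        refine ⟨⟨p :: X, by simp [enlarge, hx, h1], h2.cons_cons _, ?_, by simp; omega⟩, ?_⟩
        · intro v
          simp [hp, h3]; tauto
        · simp [enlarge, hx]; omega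
  | @cons_cons P₀ P p hsub ih =>
    rw [List.nodup_cons] at hP
    obtain ⟨⟨X, h1, h2, h3, h4⟩, h5⟩ := ih r hP.2 fun f hf h => hfs f hf (by simp [h])
    refine ⟨⟨p :: X, by cases r <;> simp [enlarge, h1], h2.cons_cons _, fun v => ?_,
      by simp; omega⟩, ?_⟩
    · have : (p :: P).filter (· ∉ p :: P₀) = P.filter (· ∉ P₀) := by
        simp only [List.mem_cons, true_or, not_true_eq_false, decide_false, Bool.false_eq_true,
          not_false_eq_true, List.filter_cons_of_neg]
        refine List.filter_congr fun x hx => ?_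
        have : x ≠ p := by rintro rfl; exact hP.1 hx
        simp [this]
      rw [this, List.mem_cons, h3, List.mem_cons, or_assoc]
    · cases r <;> simp [enlarge] <;> omega

/-- Nice trees with the same root bag and disjoint sets of forgotten vertices, that have few nodes
in comparison with the number of the latter. -/
inductive TreesOK (lab : Vector ℕ n) (R : Fin n → Fin n → Prop) (K : ℕ) (B : List (Fin n)) :
    List (NiceTree (Fin n)) → List (Fin n) → Prop
  | nil : TreesOK lab R K B [] []
  | cons (t : NiceTree (Fin n)) (ts : List (NiceTree (Fin n))) (W₁ W₂ : List (Fin n))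
      (ht : NiceOK lab R K t B W₁) (hts : TreesOK lab R K B ts W₂) (hd : ∀ v ∈ W₁, v ∉ W₂)
      (hsize : t.size + 1 ≤ 4 * W₁.length) : TreesOK lab R K B (t :: ts) (W₁ ++ W₂)

theorem TreesOK.append {B : List (Fin n)} {ts ts' : List (NiceTree (Fin n))} {W W' : List (Fin n)}
    (h : TreesOK lab R K B ts W) (h' : TreesOK lab R K B ts' W') (hd : ∀ v ∈ W, v ∉ W') :
    TreesOK lab R K B (ts ++ ts') (W ++ W') := by
  induction h with
  | nil => exact h'
  | cons t ts W₁ W₂ ht hts hd' hsize ih =>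
    rw [List.append_assoc]
    refine .cons t _ W₁ _ ht (ih fun v hv => hd v (by simp [hv])) (fun v hv hv' => ?_) hsize
    rcases List.mem_append.1 hv' with hv' | hv'
    · exact hd' v hv hv'
    · exact hd v (by simp [hv]) hv'

theorem joinAll_time (B : List (Fin n)) (ts : List (NiceTree (Fin n))) :
    (joinAll B ts).time ≤ 2 * ts.length + 1 := by
  induction ts with
  | nil => simp [joinAll]
  | cons t ts ih => cases ts <;> simp [joinAll] at ih ⊢; omega

/-- Each tree has one node to spare in `TreesOK`, which pays for the join node above it. The
trailing `+ 1` is for the single leaf made from an empty list. -/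
theorem joinAll_spec {B : List (Fin n)} (hB : B.Pairwise fun u v => lab.get u < lab.get v)
    (hK : B.length ≤ K) {ts : List (NiceTree (Fin n))} {W : List (Fin n)}
    (h : TreesOK lab R K B ts W) : NiceOK lab R K (joinAll B ts).val B W ∧
      (joinAll B ts).val.size ≤ 4 * W.length + 1 := by
  suffices NiceOK lab R K (joinAll B ts).val B W ∧
      (ts ≠ [] → (joinAll B ts).val.size + 1 ≤ 4 * W.length) by
    refine ⟨this.1, ?_⟩
    rcases eq_or_ne ts [] with rfl | hne
    · simp [joinAll, NiceTree.size]
    · have := this.2 hne; omega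
  induction h with
  | nil => exact ⟨.leaf B hB hK, by simp⟩
  | cons t ts W₁ W₂ ht hts hd hsize ih =>
    cases ts with
    | nil =>
      cases hts
      simpa [joinAll] using ⟨ht, hsize⟩
    | cons t' ts =>
      refine ⟨?_, fun _ => ?_⟩
      · exact .join _ _ B W₁ W₂ ht ih.1 hd
      · have := ih.2 (by simp)
        simp [joinAll, NiceTree.size] at this ⊢
        omega

end

/-- The list of the nodes of a forest. -/
def Forest.nodes {α : Type*} : Forest α → List α
  | .nil => []
  | .node a c s => a :: (c.nodes ++ s.nodes)

/-! ### Rooted tree decompositions and their labels -/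

section
variable {α V : Type*} (bag : α → Set V)

/-- The vertices that occur in the bags of a forest. -/
def verts (T : Forest α) : Set V := {v | ∃ i ∈ T.nodes, v ∈ bag i}

@[simp] theorem verts_nil : verts bag .nil = ∅ := by simp [verts, Forest.nodes]

@[simp] theorem verts_node (i : α) (c s : Forest α) :
    verts bag (.node i c s) = bag i ∪ verts bag c ∪ verts bag s := by
  ext v
  simp only [verts, Forest.nodes, List.mem_cons, List.mem_append, Set.mem_ofPred_eq, Set.mem_union]
  constructor
  · rintro ⟨j, rfl | h | h, hv⟩
    · exact Or.inl (Or.inl hv)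
    · exact Or.inl (Or.inr ⟨j, h, hv⟩)
    · exact Or.inr ⟨j, h, hv⟩
  · rintro ((hv | ⟨j, h, hv⟩) | ⟨j, h, hv⟩)
    · exact ⟨i, Or.inl rfl, hv⟩
    · exact ⟨j, Or.inr (Or.inl h), hv⟩
    · exact ⟨j, Or.inr (Or.inr h), hv⟩

/-- The connectivity condition for a forest whose roots hang below a node with bag `P`. -/
def RunInt : Forest α → Set V → Prop
  | .nil, _ => True
  | .node i c s, P => verts bag c ∩ P ⊆ bag i ∧ (bag i ∪ verts bag c) ∩ verts bag s ⊆ P ∧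
      RunInt c (bag i) ∧ RunInt s P

/-- Vertices that are met later in the forest have larger labels. -/
def LabOK (lab : V → ℕ) : Forest α → Set V → Prop
  | .nil, _ => True
  | .node i c s, P => (∀ u ∈ P, ∀ v ∈ bag i ∪ verts bag c, v ∉ P → lab u < lab v) ∧
      LabOK lab c (bag i) ∧ LabOK lab s P

/-- Related vertices, one of which is outside `P`, lie in a common bag. -/
def EdgeOK (R : V → V → Prop) (T : Forest α) (P : Set V) : Prop :=
  ∀ v ∈ verts bag T, v ∉ P → ∀ u, R v u → ∃ i ∈ T.nodes, v ∈ bag i ∧ u ∈ bag i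

variable {bag} {lab : V → ℕ} {R : V → V → Prop}

/-- The bag above a forest may be enlarged by vertices that do not occur in the forest. -/
theorem RunInt.mono {T : Forest α} {P Q : Set V} (h : RunInt bag T P) (hPQ : P ⊆ Q)
    (hQ : verts bag T ∩ Q ⊆ P) : RunInt bag T Q := by
  induction T generalizing P Q with
  | nil => trivial
  | node i c s ihc ihs =>
    obtain ⟨h1, h2, h3, h4⟩ := h
    rw [verts_node] at hQ
    refine ⟨fun v hv => h1 ⟨hv.1, hQ ⟨by simp [hv.1], hv.2⟩⟩, h2.trans hPQ, h3,
      ihs h4 hPQ fun v hv => hQ ⟨by simp [hv.1], hv.2⟩⟩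

theorem LabOK.lt {T : Forest α} {P : Set V} (h : LabOK bag lab T P) :
    ∀ u ∈ P, ∀ v ∈ verts bag T, v ∉ P → lab u < lab v := by
  induction T generalizing P with
  | nil => simp
  | node i c s ihc ihs =>
    obtain ⟨h1, h2, h3⟩ := h
    intro u hu v hv hvP
    rw [verts_node] at hv
    rcases hv with hv | hv
    · exact h1 u hu v hv hvP
    · exact ihs h3 u hu v hv hvP

theorem LabOK.mono {T : Forest α} {P Q : Set V} (h : LabOK bag lab T P) (hPQ : P ⊆ Q)
    (hQ : ∀ u ∈ Q, ∀ v ∈ verts bag T, v ∉ P → lab u < lab v) : LabOK bag lab T Q := by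
  induction T generalizing P Q with
  | nil => trivial
  | node i c s ihc ihs =>
    obtain ⟨h1, h2, h3⟩ := h
    rw [verts_node] at hQ
    exact ⟨fun u hu v hv hvQ => hQ u hu v (Or.inl hv) fun h => hvQ (hPQ h), h2,
      ihs h3 hPQ fun u hu v hv => hQ u hu v (Or.inr hv)⟩

variable (bag lab R) in
/-- The conditions on a labelled rooted tree decomposition. -/
structure DecompOK (T : Forest α) (P : Set V) : Prop where
  run : RunInt bag T P
  lab : LabOK bag lab T P
  edge : EdgeOK bag R T P

theorem DecompOK.siblings {i : α} {c s : Forest α} {P : Set V}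
    (h : DecompOK bag lab R (.node i c s) P) : DecompOK bag lab R s P := by
  refine ⟨h.run.2.2.2, h.lab.2.2, fun v hv hvP u hu => ?_⟩
  obtain ⟨j, hj, h1, h2⟩ := h.edge v (by simp [hv]) hvP u hu
  simp only [Forest.nodes, List.mem_cons, List.mem_append] at hj
  rcases hj with rfl | hj | hj
  · exact absurd (h.run.2.1 ⟨Or.inl h1, hv⟩) hvP
  · exact absurd (h.run.2.1 ⟨Or.inr ⟨j, hj, h1⟩, hv⟩) hvP
  · exact ⟨j, hj, h1, h2⟩

/-- The range of `Q` covers both uses: `Q = P`, when a node is merged with its parent, and a bag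
enlarged by elements of `P`. By running intersection, vertices of `P` outside the bag do not occur
further below, so they do no harm. -/
theorem DecompOK.children {i : α} {c s : Forest α} {P Q : Set V}
    (h : DecompOK bag lab R (.node i c s) P) (h₁ : bag i ⊆ Q) (h₂ : Q ⊆ bag i ∪ P) :
    DecompOK bag lab R c Q := by
  have hc : ∀ v ∈ verts bag c, v ∈ P → v ∈ bag i := fun v hv hP => h.run.1 ⟨hv, hP⟩
  refine ⟨h.run.2.2.1.mono h₁ fun v hv => ?_, h.lab.2.1.mono h₁ fun u hu v hv hvi => ?_,
    fun v hv hvQ u hu => ?_⟩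
  · rcases h₂ hv.2 with h' | h'
    · exact h'
    · exact hc v hv.1 h'
  · rcases h₂ hu with h' | h'
    · exact h.lab.2.1.lt u h' v hv hvi
    · exact h.lab.1 u h' v (Or.inr hv) fun hvP => hvi (hc v hv hvP)
  · have hvi : v ∉ bag i := fun h' => hvQ (h₁ h')
    have hvP : v ∉ P := fun h' => hvi (hc v hv h')
    obtain ⟨j, hj, h1, h2⟩ := h.edge v (by simp [hv]) hvP u hu
    simp only [Forest.nodes, List.mem_cons, List.mem_append] at hj
    rcases hj with rfl | hj | hj
    · exact absurd h1 hvi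
    · exact ⟨j, hj, h1, h2⟩
    · exact absurd (h.run.2.1 ⟨Or.inr hv, ⟨j, hj, h1⟩⟩) hvP

/-- A common bag of `v` and `u` lies at `i`, below `i`, or in the sibling forest. The last would put
`v` into `P`; and a vertex that occurs only below `i` has a larger label than `v`, which is in the
bag of `i`. -/
theorem DecompOK.mem_bag {i : α} {c s : Forest α} {P : Set V}
    (h : DecompOK bag lab R (.node i c s) P) {v : V} (hv : v ∈ bag i) (hvP : v ∉ P) {u : V}
    (hu : R v u) (hlt : lab u < lab v) : u ∈ bag i := by
  obtain ⟨j, hj, h1, h2⟩ := h.edge v (by simp [hv]) hvP u hu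
  simp only [Forest.nodes, List.mem_cons, List.mem_append] at hj
  rcases hj with rfl | hj | hj
  · exact h2
  · by_contra hui
    exact lt_asymm hlt (h.lab.2.1.lt v hv u ⟨j, hj, h2⟩ hui)
  · exact absurd (h.run.2.1 ⟨Or.inl hv, ⟨j, hj, h1⟩⟩) hvP

end

/-! ### From a rooted decomposition to a nice tree -/

section
variable {n m : ℕ} {lab : Vector ℕ n} {R : Fin n → Fin n → Prop} {K : ℕ}

set_option maxHeartbeats 1000000 in
-- Induction over the forest, with an arbitrary bag `P` above it. Merged nodes contribute no nodes
-- to the result; any other node forgets a nonempty list `fs`, and its path has at most `2 *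
-- fs.length` nodes. The term `2 * ts.length` in the time bound is a reserve for the later call of
-- `joinAll`.
theorem nice_spec (hlab : Function.Injective lab.get) (hK : 1 ≤ K)
    (bags : Vector (List (Fin n)) m)
    (hbags : ∀ i, (bags.get i).Pairwise fun u v => lab.get u < lab.get v)
    (hbK : ∀ i, (bags.get i).length ≤ K) (T : Forest (Fin m)) (P : List (Fin n))
    (acc : List (NiceTree (Fin n))) (hP : P.Pairwise fun u v => lab.get u < lab.get v)
    (hPK : P.length ≤ K)
    (hT : DecompOK (fun i => {v | v ∈ bags.get i}) lab.get R T {v | v ∈ P}) :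
    ∃ ts W, (nice bags T P acc).val = ts ++ acc ∧ TreesOK lab R K P ts W ∧
      (∀ v, v ∈ W ↔ v ∈ verts (fun i => {v | v ∈ bags.get i}) T ∧ v ∉ P) ∧
      (nice bags T P acc).time + 2 * ts.length ≤ 50 * K * T.nodes.length + 1 := by
  induction T generalizing P acc with
  | nil => exact ⟨[], [], by simp [nice], .nil, by simp, by simp [nice]⟩
  | node i c s ihc ihs =>
    have hPn := nodup_of_sorted hP
    have hrun := hT.run
    have hlt : ∀ u ∈ P, ∀ v ∈ bags.get i, v ∉ P → lab.get u < lab.get v := fun u hu v hv hvP =>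
      hT.lab.1 u hu v (Or.inl hv) hvP
    set b := bags.get i with hb
    set P₀ := P.filter (· ∈ b) with hP₀
    set fs := b.filter (· ∉ P) with hfs
    have hsub : P₀.Sublist P := List.filter_sublist
    have hfsP : ∀ f ∈ fs, f ∉ P := fun f hf => by simpa using (List.mem_filter.1 hf).2
    -- The labels of the new vertices exceed those of `P`, so both sides are sorted lists with the
    -- same members.
    have hsplit : b = P₀ ++ fs := by
      refine sorted_ext (hbags i) (List.pairwise_append.2 ⟨hP.sublist hsub,
        (hbags i).sublist List.filter_sublist, fun u hu v hv => ?_⟩) fun v => ?_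
      · exact hlt u (List.mem_filter.1 hu).1 v (List.mem_filter.1 hv).1 (hfsP v hv)
      · simp only [hP₀, hfs, List.mem_append, List.mem_filter, decide_eq_true_eq]
        tauto
    obtain ⟨s1, s2⟩ := splitBag_spec hsub hPn hfsP
    rw [← hsplit] at s1 s2
    rcases hfs' : fs with _ | ⟨f, fs'⟩
    · have hbP : ∀ v ∈ b, v ∈ P := fun v hv => by
        rw [hsplit, hfs', List.append_nil] at hv
        exact hsub.subset hv
      obtain ⟨ts₁, W₁, a1, a2, a3, a4⟩ := ihc P acc hP hPK
        (hT.children hbP fun v hv => Or.inr hv)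
      obtain ⟨ts₂, W₂, b1, b2, b3, b4⟩ := ihs P (ts₁ ++ acc) hP hPK hT.siblings
      have hval : (nice bags (.node i c s) P acc).val = ts₂ ++ (ts₁ ++ acc) := by
        simp only [nice, bind_val, ← hb, s1, hfs', a1, b1]
      refine ⟨ts₂ ++ ts₁, W₂ ++ W₁, by rw [hval, List.append_assoc], b2.append a2 ?_, ?_, ?_⟩
      · intro v hv hv'
        exact ((b3 v).1 hv).2 (hrun.2.1 ⟨Or.inr ((a3 v).1 hv').1, ((b3 v).1 hv).1⟩)
      · intro v
        have := hbP v
        rw [List.mem_append, a3, b3, verts_node]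
        simp only [Set.mem_union, Set.mem_ofPred_eq, ← hb]
        tauto
      · simp only [nice, bind_time, ← hb, s1, hfs', a1, Forest.nodes, List.length_cons,
          List.length_append]
        simp only [Nat.mul_add (50 * K)]
        omega
    · have hfs_ne : fs ≠ [] := by simp [hfs']
      obtain ⟨⟨X, e1, e2, e3, e4⟩, e5⟩ := enlarge_spec (P.length - b.length) hsub hPn hfsP hfs_ne
      rw [← hsplit] at e1 e5
      -- Truncated subtraction: the bag is filled up only if it is smaller than `P`. So the enlarged
      -- bag has at most `max P.length b.length` elements, and at most `fs.length` elements of `P`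
      -- are left to be introduced.
      set r := P.length - b.length with hr
      set vs := (P.filter (· ∉ P₀)).drop r with hvs
      have hblen : b.length = P₀.length + fs.length := by rw [← List.length_append, ← hsplit]
      have hcomp : (P.filter (· ∉ P₀)).length + P₀.length = P.length := by
        have h := List.length_eq_length_filter_add (l := P) (· ∈ b)
        have h' : P.filter (· ∉ P₀) = P.filter fun x => !decide (x ∈ b) := by
          refine List.filter_congr fun x hx => ?_
          simp [hP₀, hx]
        rw [h', h, ← hP₀]; omega
      have hXb : ∀ v ∈ P₀, v ∈ X := fun v hv => (e3 v).2 (Or.inl hv)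
      have hBsorted : (X ++ fs).Pairwise fun u v => lab.get u < lab.get v := by
        refine List.pairwise_append.2 ⟨hP.sublist e2,
          (hbags i).sublist List.filter_sublist, fun u hu v hv => ?_⟩
        exact hlt u (e2.subset hu) v (List.mem_filter.1 hv).1 (hfsP v hv)
      have hBK : (X ++ fs).length ≤ K := by
        have : b.length ≤ K := hbK i
        rw [List.length_append]; omega
      have hbB : ∀ v ∈ b, v ∈ X ++ fs := fun v hv => by
        rw [hsplit] at hv
        rcases List.mem_append.1 hv with h | h
        · exact List.mem_append_left _ (hXb v h)
        · exact List.mem_append_right _ h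
      have hBbP : ∀ v ∈ X ++ fs, v ∈ b ∨ v ∈ P := fun v hv => by
        rcases List.mem_append.1 hv with h | h
        · exact Or.inr (e2.subset h)
        · exact Or.inl (List.mem_filter.1 h).1
      obtain ⟨ts₁, W₁, a1, a2, a3, a4⟩ := ihc (X ++ fs) [] hBsorted hBK
        (hT.children hbB hBbP)
      rw [List.append_nil] at a1
      obtain ⟨j1, j2⟩ := joinAll_spec hBsorted hBK a2
      have hvslen : vs.length ≤ fs.length := by
        rw [hvs, List.length_drop]; omega
      have s1' : (splitBag P b).val = (P.filter (· ∉ P₀), f :: fs') := by rw [s1, hfs']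
      have hvsP : ∀ v ∈ vs, v ∈ P ∧ v ∉ P₀ := fun v hv => by
        simpa using List.mem_filter.1 (List.mem_of_mem_drop hv)
      have hvsb : ∀ v ∈ vs, v ∉ b := fun v hv h => (hvsP v hv).2 (by simp [hP₀, hvsP v hv, h])
      have hfn : (P.filter (· ∉ P₀)).Nodup := hPn.filter _
      have hvsX : ∀ v ∈ vs, v ∉ X := fun v hv h => by
        rcases (e3 v).1 h with h | h
        · exact (hvsP v hv).2 h
        · exact (List.disjoint_take_drop hfn (le_refl r)) h hv
      have hgs : (revT (f :: fs') []).val.reverse = fs := by simp [hfs']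
      have hgmem : ∀ g ∈ (revT (f :: fs') []).val, g ∈ fs := fun g hg => by
        rw [← hgs]; exact List.mem_reverse.2 hg
      have hglen : (revT (f :: fs') []).val.length = fs.length := by
        rw [← hgs, List.length_reverse]
      obtain ⟨X', c1, c2, c3, c4⟩ := climb_spec hlab (revT (f :: fs') []).val vs
        (joinAll (X ++ fs) ts₁).val X W₁ (by rw [hgs]; exact j1)
        (hglen ▸ hvslen)
        (fun g hg u hu hl => by
          rw [hgs]
          have hg' := List.mem_filter.1 (hgmem g hg)
          exact hbB u (hT.mem_bag hg'.1 (by simpa using hg'.2) hu hl))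
        (hfn.sublist (List.drop_sublist _ _)) hvsX
        -- Running intersection: a vertex of `P` that occurs below would lie in the bag `b`, so an
        -- introduced vertex has not been forgotten before.
        (fun v hv h => hvsb v hv (hrun.1 ⟨((a3 v).1 h).1, (hvsP v hv).1⟩))
        (fun v hv g hg => hlt v (hvsP v hv).1 g (List.mem_filter.1 (hgmem g hg)).1
          (hfsP g (hgmem g hg)))
      have hX' : X' = P := by
        refine sorted_ext c1.sorted hP fun v => ?_
        rw [c2, e3, or_assoc, hvs, ← List.mem_append, List.take_append_drop]
        simp only [hP₀, List.mem_filter, decide_eq_true_eq]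
        tauto
      subst hX'
      rw [hgs] at c1
      obtain ⟨ts₂, W₂, b1, b2, b3, b4⟩ := ihs X' ((climb (joinAll (X ++ fs) ts₁).val
        (revT (f :: fs') []).val vs).val :: acc) hP hPK hT.siblings
      have hval : (nice bags (.node i c s) X' acc).val = ts₂ ++
          ((climb (joinAll (X ++ fs) ts₁).val (revT (f :: fs') []).val vs).val :: acc) := by
        rw [← b1]
        simp only [nice, bind_val, ← hb, s1', lengthT_val, ← hr, e1, dropT_val, ← hvs, a1]
      have hWc : ∀ v, v ∈ fs ++ W₁ ↔
          (v ∈ b ∨ v ∈ verts (fun i => {v | v ∈ bags.get i}) c) ∧ v ∉ X' := fun v => by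
        have h1 : v ∈ verts (fun i => {v | v ∈ bags.get i}) c → v ∈ X' → v ∈ b :=
          fun h h' => hrun.1 ⟨h, h'⟩
        have h2 : v ∈ X → v ∈ X' := fun h => e2.subset h
        have h3 := hbB v
        rw [List.mem_append] at h3
        rw [List.mem_append, a3, List.mem_append]
        simp only [hfs, List.mem_filter, decide_eq_true_eq] at h3 ⊢
        tauto
      -- Node count: at most `4 * W₁.length + 1` from the children, `2 * fs.length` from the path,
      -- and one spare. The two extra nodes are covered because `fs` is nonempty.
      have hone : TreesOK lab R K X'
          [(climb (joinAll (X ++ fs) ts₁).val (revT (f :: fs') []).val vs).val] (fs ++ W₁) := by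
        have hf1 : 1 ≤ fs.length := by simp [hfs']
        have := TreesOK.cons _ [] _ [] c1 .nil (by simp) (by
          rw [c3, hglen, List.length_append]; omega)
        simpa using this
      refine ⟨ts₂ ++ [(climb (joinAll (X ++ fs) ts₁).val (revT (f :: fs') []).val vs).val],
        W₂ ++ (fs ++ W₁), by rw [hval]; simp, b2.append hone ?_, ?_, ?_⟩
      · intro v hv hv'
        exact ((b3 v).1 hv).2 (hrun.2.1 ⟨((hWc v).1 hv').1, ((b3 v).1 hv).1⟩)
      · intro v
        rw [List.mem_append, hWc, b3, verts_node]
        simp only [Set.mem_union, Set.mem_ofPred_eq, ← hb]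
        tauto
      · have t1 := lengthT_time X'
        have t2 := lengthT_time b
        have t3 := dropT_time r (X'.filter (· ∉ P₀))
        have t4 := revT_time (f :: fs') []
        have t5 := joinAll_time (X ++ fs) ts₁
        have hbK' : b.length ≤ K := hbK i
        rw [hglen] at c4
        have hfl : (X'.filter (· ∉ P₀)).length ≤ X'.length := List.length_filter_le _ _
        simp only [nice, bind_time, ← hb, s1', lengthT_val, ← hr, e1,
          dropT_val, ← hvs, a1, Forest.nodes, List.length_cons, List.length_append,
          List.length_nil, c4]
        simp only [Nat.mul_add (50 * K)]
        have hf1 : (f :: fs').length = fs.length := by rw [hfs']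
        rw [hf1] at t4
        omega

theorem niceTree_spec (hlab : Function.Injective lab.get) (hK : 1 ≤ K)
    (bags : Vector (List (Fin n)) m)
    (hbags : ∀ i, (bags.get i).Pairwise fun u v => lab.get u < lab.get v)
    (hbK : ∀ i, (bags.get i).length ≤ K) (T : Forest (Fin m))
    (hT : DecompOK (fun i => {v | v ∈ bags.get i}) lab.get R T ∅) :
    ∃ W, NiceOK lab R K (niceTree bags T).val [] W ∧
      (∀ v, v ∈ W ↔ v ∈ verts (fun i => {v | v ∈ bags.get i}) T) ∧
      (niceTree bags T).val.size ≤ 4 * W.length + 1 ∧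
      (niceTree bags T).time ≤ 50 * K * T.nodes.length + 3 := by
  obtain ⟨ts, W, h1, h2, h3, h4⟩ := nice_spec hlab hK bags hbags hbK T [] [] (by simp) (by simp)
    (by simpa using hT)
  rw [List.append_nil] at h1
  obtain ⟨j1, j2⟩ := joinAll_spec (by simp) (by simp) h2
  have h5 := joinAll_time [] ts
  refine ⟨W, by simpa [niceTree, h1] using j1, by simpa using h3, by simpa [niceTree, h1] using j2,
    ?_⟩
  simp only [niceTree, bind_time, h1]
  omega

end

/-! ## Labels -/

section
variable {n m : ℕ}

theorem get_set {α : Type*} (A : Vector α n) (i j : Fin n) (x : α) :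
    (A.set i.1 x i.2).get j = if i = j then x else A.get j := by
  simp [Vector.get_eq_getElem, Vector.getElem_set, Fin.ext_iff]

theorem get_replicate {α : Type*} (i : Fin n) (x : α) : (Vector.replicate n x).get i = x := by
  simp [Vector.get_eq_getElem]

/-- The invariant of the labelling procedure. -/
structure Labelling.OK (L : Labelling n) : Prop where
  sorted : L.order.Pairwise fun u v => L.lab.get v < L.lab.get u
  mem : ∀ v, v ∈ L.order ↔ L.lab.get v ≠ 0
  le : ∀ v, L.lab.get v ≤ L.count

/-- `L'` extends `L` by larger labels. -/
structure Labelling.Ext (L L' : Labelling n) : Prop where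
  eq : ∀ v, L.lab.get v ≠ 0 → L'.lab.get v = L.lab.get v
  lt : ∀ v, L.lab.get v = 0 → L'.lab.get v ≠ 0 → L.count < L'.lab.get v
  le : L.count ≤ L'.count

theorem Labelling.Ext.trans {L L' L'' : Labelling n} (h : L.Ext L') (h' : L'.Ext L'') :
    L.Ext L'' := by
  refine ⟨fun v hv => ?_, fun v hv hv' => ?_, h.le.trans h'.le⟩
  · rw [h'.eq v (by rw [h.eq v hv]; exact hv), h.eq v hv]
  · by_cases hv'' : L'.lab.get v = 0
    · exact h.le.trans_lt (h'.lt v hv'' hv')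
    · rw [h'.eq v hv'']; exact h.lt v hv hv''

theorem labelBag_spec (vs : List (Fin n)) (L : Labelling n) (hL : L.OK) :
    (labelBag vs L).val.OK ∧ L.Ext (labelBag vs L).val ∧
    (∀ v, (labelBag vs L).val.lab.get v ≠ 0 ↔ L.lab.get v ≠ 0 ∨ v ∈ vs) ∧
    (labelBag vs L).time = 2 * vs.length + 1 := by
  induction vs generalizing L with
  | nil => exact ⟨hL, ⟨fun _ _ => rfl, fun _ h h' => absurd h h', le_rfl⟩, by simp [labelBag],
      by simp [labelBag]⟩
  | cons w vs ih =>
    by_cases hw : L.lab.get w = 0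
    · set L₁ : Labelling n := ⟨L.lab.set w.1 (L.count + 1) w.2, w :: L.order, L.count + 1⟩ with hL₁
      have hget : ∀ v, L₁.lab.get v = if w = v then L.count + 1 else L.lab.get v :=
        fun v => get_set L.lab w v (L.count + 1)
      have hne : ∀ v ∈ L.order, w ≠ v := fun v hv e => (hL.mem v).1 hv (e ▸ hw)
      have h₁ : L₁.OK := by
        refine ⟨List.pairwise_cons.2 ⟨fun v hv => ?_, hL.sorted.imp_of_mem fun hu hv h => ?_⟩,
          fun v => ?_, fun v => ?_⟩
        · rw [hget, hget, if_neg (hne v hv), if_pos rfl]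
          exact Nat.lt_succ_of_le (hL.le v)
        · rw [hget, hget, if_neg (hne _ hu), if_neg (hne _ hv)]
          exact h
        · rw [hget, hL₁]
          by_cases h : w = v
          · simp [h]
          · rw [if_neg h, List.mem_cons, hL.mem]; simp [Ne.symm h]
        · rw [hget]
          split
          · exact le_rfl
          · exact (hL.le v).trans (Nat.le_succ _)
      have h₂ : L.Ext L₁ := by
        refine ⟨fun v hv => ?_, fun v hv hv' => ?_, Nat.le_succ _⟩
        · rw [hget, if_neg (fun e : w = v => hv (e ▸ hw))]
        · rw [hget] at hv' ⊢
          split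
          · exact Nat.lt_succ_self _
          · rename_i h; rw [if_neg h] at hv'; exact absurd hv hv'
      obtain ⟨g1, g2, g3, g4⟩ := ih L₁ h₁
      have hval : (labelBag (w :: vs) L).val = (labelBag vs L₁).val := by simp [labelBag, hw, hL₁]
      rw [hval]
      refine ⟨g1, h₂.trans g2, fun v => ?_, ?_⟩
      · rw [g3, hget]
        by_cases h : w = v
        · simp [h]
        · rw [if_neg h, List.mem_cons]; simp [Ne.symm h]
      · simp only [labelBag, hw, if_true, bind_time, ret_time, ← hL₁, g4, List.length_cons]; ring
    · obtain ⟨g1, g2, g3, g4⟩ := ih L hL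
      have hval : (labelBag (w :: vs) L).val = (labelBag vs L).val := by simp [labelBag, hw]
      rw [hval]
      refine ⟨g1, g2, fun v => ?_, ?_⟩
      · rw [g3, List.mem_cons]
        by_cases h : v = w
        · simp [h, hw]
        · simp [h]
      · simp only [labelBag, hw, if_false, bind_time, ret_time, g4, List.length_cons]; ring

variable {K : ℕ}

theorem labelForest_spec (bags : Vector (List (Fin n)) m) (hK : ∀ i, (bags.get i).length ≤ K)
    (T : Forest (Fin m)) (L : Labelling n) (hL : L.OK) :
    (labelForest bags T L).val.OK ∧ L.Ext (labelForest bags T L).val ∧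
    (∀ v, (labelForest bags T L).val.lab.get v ≠ 0 ↔
      L.lab.get v ≠ 0 ∨ v ∈ verts (fun i => {v | v ∈ bags.get i}) T) ∧
    (labelForest bags T L).time ≤ (2 * K + 4) * T.nodes.length + 1 := by
  induction T generalizing L with
  | nil => exact ⟨hL, ⟨fun _ _ => rfl, fun _ h h' => absurd h h', le_rfl⟩, by simp [labelForest],
      by simp [labelForest]⟩
  | node i c s ihc ihs =>
    obtain ⟨a1, a2, a3, a4⟩ := labelBag_spec (bags.get i) L hL
    obtain ⟨b1, b2, b3, b4⟩ := ihc _ a1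
    obtain ⟨c1, c2, c3, c4⟩ := ihs _ b1
    refine ⟨c1, (a2.trans b2).trans c2, fun v => ?_, ?_⟩
    · simp only [labelForest, bind_val]
      rw [c3, b3, a3, verts_node]
      simp only [Set.mem_union, Set.mem_ofPred_eq]
      tauto
    · have := hK i
      simp only [labelForest, bind_time, Forest.nodes, List.length_cons, List.length_append]
      simp only [Nat.mul_add (2 * K + 4)]
      omega

/-- Labels are never changed and new ones exceed all old ones, so it suffices that a new vertex is
unlabelled on entry while `P` is labelled. Running intersection keeps this invariant. The claim is
about any later labelling `L'`, since the siblings are labelled after the children. -/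
theorem labelForest_labOK (bags : Vector (List (Fin n)) m) (T : Forest (Fin m)) (L : Labelling n)
    (hL : L.OK) (P : Set (Fin n)) (hT : RunInt (fun i => {v | v ∈ bags.get i}) T P)
    (hP : ∀ v ∈ P, L.lab.get v ≠ 0)
    (hP' : ∀ v ∈ verts (fun i => {v | v ∈ bags.get i}) T, L.lab.get v ≠ 0 → v ∈ P)
    (L' : Labelling n) (hL' : (labelForest bags T L).val.Ext L') :
    LabOK (fun i => {v | v ∈ bags.get i}) L'.lab.get T P := by
  -- Some bound on the bag sizes, needed only to quote `labelForest_spec`.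
  obtain ⟨K, hK⟩ : ∃ K, ∀ i, (bags.get i).length ≤ K :=
    ⟨_, fun i => Finset.le_sup (f := fun i => (bags.get i).length) (Finset.mem_univ i)⟩
  induction T generalizing L P L' with
  | nil => trivial
  | node i c s ihc ihs =>
    obtain ⟨a1, a2, a3, -⟩ := labelBag_spec (bags.get i) L hL
    obtain ⟨b1, b2, b3, -⟩ := labelForest_spec bags hK c _ a1
    obtain ⟨c1, c2, c3, -⟩ := labelForest_spec bags hK s _ b1
    obtain ⟨h1, h2, h3, h4⟩ := hT
    rw [verts_node] at hP'
    have hf : (labelForest bags c (labelBag (bags.get i) L).val).val.Ext L' := c2.trans hL'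
    have ha := a2.trans b2
    refine ⟨fun u hu v hv hvP => ?_, ihc _ a1 _ h3 (fun v hv => (a3 v).2 (Or.inr hv))
      (fun v hv hv' => ?_) L' hf, ihs _ b1 _ h4 (fun v hv => ?_) (fun v hv hv' => ?_) L' hL'⟩
    · have hv0 : L.lab.get v = 0 := by
        by_contra h
        exact hvP (hP' v (Or.inl hv) h)
      have hu0 := hP u hu
      have hv2 : (labelForest bags c (labelBag (bags.get i) L).val).val.lab.get v ≠ 0 := by
        rw [b3, a3]
        rcases hv with hv | hv
        · exact Or.inl (Or.inr hv)
        · exact Or.inr hv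
      rw [hf.eq v hv2, (ha.trans hf).eq u hu0]
      exact (hL.le u).trans_lt (ha.lt v hv0 hv2)
    · rcases (a3 v).1 hv' with h | h
      · exact h1 ⟨hv, hP' v (Or.inl (Or.inr hv)) h⟩
      · exact h
    · rw [b3, a3]; exact Or.inl (Or.inl (hP v hv))
    · rw [b3, a3] at hv'
      rcases hv' with (h | h) | h
      · exact hP' v (Or.inr hv) h
      · exact h2 ⟨Or.inl h, hv⟩
      · exact h2 ⟨Or.inr h, hv⟩

theorem Labelling.OK.injective {L : Labelling n} (hL : L.OK) (h : ∀ v, L.lab.get v ≠ 0) :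
    Function.Injective L.lab.get := by
  intro u v huv
  by_contra hne
  have h1 : L.order.Pairwise fun u v => L.lab.get u ≠ L.lab.get v := hL.sorted.imp fun h => h.ne'
  have : Std.Symm fun u v => L.lab.get u ≠ L.lab.get v := ⟨fun _ _ h => h.symm⟩
  exact h1.forall ((hL.mem u).2 (h u)) ((hL.mem v).2 (h v)) hne huv

theorem Labelling.OK.nodup {L : Labelling n} (hL : L.OK) : L.order.Nodup :=
  hL.sorted.imp fun h e => by subst e; exact lt_irrefl _ h

/-! ## Bucket sort -/

@[simp] theorem newArray_val {α : Type*} (n : ℕ) (a : α) :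
    (newArray n a).val = Vector.replicate n a := rfl

@[simp] theorem newArray_time {α : Type*} (n : ℕ) (a : α) : (newArray n a).time = n + 1 := rfl

theorem get_pushAt {α : Type*} (A : Vector (List α) n) (i j : Fin n) (x : α) :
    (pushAt A i x).val.get j = if i = j then x :: A.get j else A.get j := by
  simp only [pushAt, ret_val, get_set]
  split
  · subst_vars; rfl
  · rfl

@[simp] theorem pushAt_time {α : Type*} (A : Vector (List α) n) (i : Fin n) (x : α) :
    (pushAt A i x).time = 1 := rfl

/-- The number of entries in all cells. -/
def total {α : Type*} (A : Vector (List α) n) : ℕ := ∑ i, (A.get i).length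

theorem total_replicate {α : Type*} : total (Vector.replicate n ([] : List α)) = 0 := by
  simp [total]

theorem total_pushAt {α : Type*} (A : Vector (List α) n) (i : Fin n) (x : α) :
    total (pushAt A i x).val = total A + 1 := by
  have : ∀ j, ((pushAt A i x).val.get j).length = (A.get j).length + if i = j then 1 else 0 := by
    intro j; rw [get_pushAt]; split <;> simp
  simp [total, this, Finset.sum_add_distrib]

theorem sum_length_le_total {α : Type*} (A : Vector (List α) n) {js : List (Fin n)}
    (h : js.Nodup) : (js.map fun j => (A.get j).length).sum ≤ total A := by
  rw [← List.sum_toFinset _ h]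
  exact Finset.sum_le_sum_of_subset (Finset.subset_univ _)

theorem spread_spec {α : Type*} (x : α) (l : List (Fin n)) (hl : l.Nodup)
    (A : Vector (List α) n) :
    (∀ i, (spread x l A).val.get i = if i ∈ l then x :: A.get i else A.get i) ∧
    total (spread x l A).val = total A + l.length ∧ (spread x l A).time = 2 * l.length + 1 := by
  induction l generalizing A with
  | nil => simp [spread]
  | cons j l ih =>
    rw [List.nodup_cons] at hl
    obtain ⟨h1, h2, h3⟩ := ih hl.2 (pushAt A j x).val
    refine ⟨fun i => ?_, ?_, ?_⟩
    · simp only [spread, bind_val, h1, get_pushAt, List.mem_cons]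
      by_cases hi : i = j
      · subst hi; simp [hl.1]
      · simp [hi, Ne.symm hi]
    · simp only [spread, bind_val, h2, total_pushAt, List.length_cons]; ring
    · simp only [spread, bind_time, pushAt_time, h3, List.length_cons]; ring

/-- Pushing to the front reverses: each cell lists its members in the opposite order to `js`. -/
theorem transpose_spec (A : Vector (List (Fin n)) m) (hA : ∀ j, (A.get j).Nodup)
    (js : List (Fin m)) (S : Vector (List (Fin m)) n) :
    (∀ i, (transpose A js S).val.get i = (js.filter (i ∈ A.get ·)).reverse ++ S.get i) ∧
    total (transpose A js S).val = total S + (js.map fun j => (A.get j).length).sum ∧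
    (transpose A js S).time = 2 * (js.map fun j => (A.get j).length).sum + 2 * js.length + 1 := by
  induction js generalizing S with
  | nil => simp [transpose]
  | cons j js ih =>
    obtain ⟨g1, g2, g3⟩ := spread_spec j (A.get j) (hA j) S
    obtain ⟨h1, h2, h3⟩ := ih (spread j (A.get j) S).val
    refine ⟨fun i => ?_, ?_, ?_⟩
    · simp only [transpose, bind_val, h1, g1]
      by_cases hi : i ∈ A.get j <;> simp [hi]
    · simp only [transpose, bind_val, h2, g2, List.map_cons, List.sum_cons]; ring
    · simp only [transpose, bind_time, h3, g3, List.map_cons, List.sum_cons, List.length_cons]; ring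

/-- The first transposition lists the occurrences of each vertex, in an irrelevant order. The second
runs through the vertices by decreasing label, so every bag comes out increasing. -/
theorem sortBags_spec (bags : Vector (List (Fin n)) m) (hbags : ∀ i, (bags.get i).Nodup)
    (L : Labelling n) (hL : L.OK) (hall : ∀ v, L.lab.get v ≠ 0) :
    (∀ i, ((sortBags bags L.order).val.get i).Pairwise fun u v => L.lab.get u < L.lab.get v) ∧
    (∀ i v, v ∈ (sortBags bags L.order).val.get i ↔ v ∈ bags.get i) ∧
    (sortBags bags L.order).time ≤ 4 * total bags + 3 * m + 3 * n + 10 := by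
  obtain ⟨a1, a2, a3⟩ := transpose_spec bags hbags (List.finRange m) (Vector.replicate n [])
  set O := (transpose bags (List.finRange m) (Vector.replicate n [])).val with hO
  have hO' : ∀ v, O.get v = ((List.finRange m).filter (v ∈ bags.get ·)).reverse := fun v => by
    rw [a1, get_replicate, List.append_nil]
  have hOn : ∀ v, (O.get v).Nodup := fun v => by
    rw [hO', List.nodup_reverse]; exact (List.nodup_finRange m).filter _
  obtain ⟨b1, -, b3⟩ := transpose_spec O hOn L.order (Vector.replicate m [])
  have hval : (sortBags bags L.order).val = (transpose O L.order (Vector.replicate m [])).val := by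
    simp [sortBags, hO]
  have hS : ∀ i, (sortBags bags L.order).val.get i =
      (L.order.filter (i ∈ O.get ·)).reverse := fun i => by
    rw [hval, b1, get_replicate, List.append_nil]
  refine ⟨fun i => ?_, fun i v => ?_, ?_⟩
  · rw [hS, List.pairwise_reverse]
    exact hL.sorted.sublist List.filter_sublist
  · rw [hS, List.mem_reverse, List.mem_filter, hL.mem]
    simp [hall, hO']
  · have h1 := sum_length_le_total bags (List.nodup_finRange m)
    have h2 := sum_length_le_total O hL.nodup
    rw [total_replicate] at a2
    have h3 : L.order.length ≤ n := by simpa using hL.nodup.length_le_card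
    rw [List.length_finRange] at a3
    simp only [sortBags, bind_time, newArray_val, newArray_time, ← hO, a3, b3]
    omega

section
variable {F : Type*} [Field F]

theorem bucket_spec (es : List (Fin n × Fin n × F)) :
    (∀ j, (bucket es).val.get j = (es.filter (·.2.1 = j)).map fun e => (e.1, e.2.2)) ∧
    total (bucket es).val = es.length ∧ (bucket es).time = 2 * es.length + n + 1 := by
  induction es with
  | nil => simp [bucket, total_replicate]
  | cons e es ih =>
    obtain ⟨h1, h2, h3⟩ := ih
    refine ⟨fun j => ?_, ?_, ?_⟩
    · simp only [bucket, bind_val, get_pushAt, h1]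
      by_cases h : e.2.1 = j <;> simp [h]
    · simp only [bucket, bind_val, total_pushAt, h2, List.length_cons]
    · simp only [bucket, bind_time, pushAt_time, h3, List.length_cons]; ring

theorem spreadRow_spec (v : Fin n) (f : Fin n → F) (l : List (Fin n × F))
    (hl : (l.map Prod.fst).Nodup) (hf : ∀ p ∈ l, p.2 = f p.1) (A : Vector (List (Fin n × F)) n) :
    (∀ u, (spreadRow v l A).val.get u =
      if u ∈ l.map Prod.fst then (v, f u) :: A.get u else A.get u) ∧
    (spreadRow v l A).time = 2 * l.length + 1 := by
  induction l generalizing A with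
  | nil => simp [spreadRow]
  | cons e l ih =>
    simp only [List.forall_mem_cons] at hf
    rw [List.map_cons, List.nodup_cons] at hl
    obtain ⟨h1, h2⟩ := ih hl.2 hf.2 (pushAt A e.1 (v, e.2)).val
    refine ⟨fun u => ?_, ?_⟩
    · simp only [spreadRow, bind_val, h1, get_pushAt, List.map_cons, List.mem_cons]
      by_cases hu : u = e.1
      · subst hu; simp only [hl.1, if_false, true_or, if_true, hf.1]
      · simp only [if_neg (Ne.symm hu), hu, false_or]
    · simp only [spreadRow, bind_time, pushAt_time, h2, List.length_cons]; ring

variable [DecidableEq F]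

/-- Cell `v` of `A` holds column `v`; distributing the columns in a decreasing order builds the rows
in increasing order. -/
theorem transposeRows_spec (M : Matrix (Fin n) (Fin n) F) (A : Vector (List (Fin n × F)) n)
    (hA : ∀ v, (A.get v).Nodup) (hM : ∀ u v a, (u, a) ∈ A.get v ↔ a = M u v ∧ a ≠ 0)
    (vs : List (Fin n)) (S : Vector (List (Fin n × F)) n) :
    (∀ u, (transposeRows A vs S).val.get u =
      (((vs.filter (M u · ≠ 0)).map fun v => (v, M u v)).reverse ++ S.get u)) ∧
    (transposeRows A vs S).time =
      2 * (vs.map fun v => (A.get v).length).sum + 2 * vs.length + 1 := by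
  induction vs generalizing S with
  | nil => simp [transposeRows]
  | cons v vs ih =>
    have hfst : ∀ u, u ∈ (A.get v).map Prod.fst ↔ M u v ≠ 0 := fun u => by
      simp [hM]
    obtain ⟨g1, g2⟩ := spreadRow_spec v (M · v) (A.get v)
      ((hA v).map_on fun p hp q hq e => by
        obtain ⟨p1, p2⟩ := p
        obtain ⟨q1, q2⟩ := q
        simp only at e
        subst e
        rw [((hM _ _ _).1 hp).1, ((hM _ _ _).1 hq).1])
      (fun p hp => ((hM _ _ _).1 hp).1) S
    obtain ⟨h1, h2⟩ := ih (spreadRow v (A.get v) S).val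
    refine ⟨fun u => ?_, ?_⟩
    · simp only [transposeRows, bind_val, h1, g1, hfst]
      by_cases hu : M u v = 0 <;> simp [hu]
    · simp only [transposeRows, bind_time, h2, g2, List.map_cons, List.sum_cons,
        List.length_cons]; ring

theorem sortRows_spec (M : Matrix (Fin n) (Fin n) F) (es : List (Fin n × Fin n × F))
    (hes : es.Nodup) (hM : ∀ i j a, (i, j, a) ∈ es ↔ a = M i j ∧ a ≠ 0)
    (L : Labelling n) (hL : L.OK) (hall : ∀ v, L.lab.get v ≠ 0) :
    RowsOK L.lab M (sortRows es L.order).val ∧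
    (sortRows es L.order).time ≤ 4 * es.length + 4 * n + 10 := by
  obtain ⟨a1, a2, a3⟩ := bucket_spec es
  set A := (bucket es).val with hA
  obtain ⟨b1, b2⟩ := transposeRows_spec M A (fun v => by
      rw [a1]
      refine (hes.filter _).map_on fun p hp q hq e => ?_
      have hp := (List.mem_filter.1 hp).2
      have hq := (List.mem_filter.1 hq).2
      simp only [decide_eq_true_eq, Prod.mk.injEq] at hp hq e
      exact Prod.ext e.1 (Prod.ext (hp.trans hq.symm) e.2))
    (fun u v a => by
      rw [a1, ← hM]
      simp only [List.mem_map, List.mem_filter, decide_eq_true_eq, Prod.mk.injEq]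
      constructor
      · rintro ⟨⟨i, j, b⟩, ⟨h, rfl⟩, rfl, rfl⟩; exact h
      · intro h; exact ⟨_, ⟨h, rfl⟩, rfl, rfl⟩)
    L.order (Vector.replicate n [])
  have hval : (sortRows es L.order).val = (transposeRows A L.order (Vector.replicate n [])).val :=
    by simp [sortRows, hA]
  refine ⟨fun v => ⟨(L.order.filter (M v · ≠ 0)).reverse, ?_, ?_, fun u => ?_⟩, ?_⟩
  · rw [hval, b1, get_replicate, List.append_nil, List.map_reverse]
  · rw [List.pairwise_reverse]
    exact hL.sorted.sublist List.filter_sublist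
  · rw [List.mem_reverse, List.mem_filter, hL.mem]
    simp [hall]
  · have h2 := sum_length_le_total A hL.nodup
    have h3 : L.order.length ≤ n := by simpa using hL.nodup.length_le_card
    simp only [sortRows, bind_time, newArray_val, newArray_time, ← hA, a3, b2]
    omega

end
end

/-! ## Rooting the tree -/

section
variable {m : ℕ}

/-- Loops are excluded because both endpoints are pushed, and a loop would enter its cell twice. -/
theorem adjacency_spec (es : List (Fin m × Fin m)) (hes : (es.map fun e => s(e.1, e.2)).Nodup)
    (hne : ∀ e ∈ es, e.1 ≠ e.2) :
    (∀ x y, y ∈ (adjacency es).val.get x ↔ s(x, y) ∈ es.map fun e => s(e.1, e.2)) ∧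
    (∀ x, ((adjacency es).val.get x).Nodup) ∧ (adjacency es).time = 4 * es.length + m + 1 := by
  induction es with
  | nil => simp [adjacency]
  | cons e es ih =>
    rw [List.map_cons, List.nodup_cons] at hes
    rw [List.forall_mem_cons] at hne
    obtain ⟨h1, h2, h3⟩ := ih hes.2 hne.2
    have hval : ∀ x, (adjacency (e :: es)).val.get x =
        if e.2 = x then e.1 :: (adjacency es).val.get x
        else if e.1 = x then e.2 :: (adjacency es).val.get x else (adjacency es).val.get x := by
      intro x
      simp only [adjacency, bind_val, get_pushAt]
      by_cases h : e.2 = x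
      · rw [if_pos h, if_pos h, if_neg (fun h' => hne.1 (h'.trans h.symm))]
      · rw [if_neg h, if_neg h]
    refine ⟨fun x y => ?_, fun x => ?_, ?_⟩
    · rw [hval, List.map_cons, List.mem_cons, Sym2.eq_iff, ← h1]
      split_ifs with h h'
      · subst h
        have := hne.1
        grind
      · subst h'; grind
      · grind
    · rw [hval]
      split_ifs with h h'
      · subst h
        refine List.nodup_cons.2 ⟨fun h => hes.1 ?_, h2 _⟩
        rw [Sym2.eq_swap]
        exact (h1 _ _).1 h
      · subst h'
        exact List.nodup_cons.2 ⟨fun h => hes.1 ((h1 _ _).1 h), h2 _⟩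
      · exact h2 x
    · simp only [adjacency, bind_time, pushAt_time, h3, List.length_cons]
      ring

/-- The part of `grow` that handles a list of neighbours of `x`. -/
def growList (A : Vector (List (Fin m)) m) (d : ℕ) (p x : Fin m) (l : List (Fin m)) :
    Timed (Forest (Fin m)) :=
  l.foldr
    (fun y rest =>
      if y = p then rest >>- fun s => ret s
      else grow A d x y >>- fun c => rest >>- fun s => ret (Forest.node y c s))
    (ret Forest.nil)

theorem grow_succ (A : Vector (List (Fin m)) m) (d : ℕ) (p x : Fin m) :
    grow A (d + 1) p x = growList A d p x (A.get x) := rfl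

@[simp] theorem growList_nil (A : Vector (List (Fin m)) m) (d : ℕ) (p x : Fin m) :
    growList A d p x [] = ret Forest.nil := rfl

theorem growList_cons (A : Vector (List (Fin m)) m) (d : ℕ) (p x y : Fin m) (l : List (Fin m)) :
    growList A d p x (y :: l) = if y = p then growList A d p x l >>- fun s => ret s
      else grow A d x y >>- fun c => growList A d p x l >>- fun s => ret (Forest.node y c s) := rfl

theorem mem_growList_nodes (A : Vector (List (Fin m)) m) (d : ℕ) (p x z : Fin m)
    (l : List (Fin m)) : z ∈ (growList A d p x l).val.nodes ↔
      ∃ y ∈ l, y ≠ p ∧ (z = y ∨ z ∈ (grow A d x y).val.nodes) := by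
  induction l with
  | nil => simp [Forest.nodes]
  | cons y l ih =>
    rw [growList_cons]
    by_cases h : y = p
    · simp [h, ih]
    · simp [h, ih, Forest.nodes, or_assoc]

theorem grow_time (A : Vector (List (Fin m)) m) (hA : ∀ x, (A.get x).Nodup) (d : ℕ)
    (p x : Fin m) : (grow A d p x).time ≤ 6 * (grow A d p x).val.nodes.length + 3 := by
  induction d generalizing p x with
  | zero => simp [grow, Forest.nodes]
  | succ d ih =>
    -- A child costs 6 steps: 3 for the constant of its own call and 3 for sequencing. Skipping the
    -- parent costs 2, and happens at most once in a list without repetitions.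
    have key : ∀ l : List (Fin m), l.Nodup → (growList A d p x l).time ≤
        6 * (growList A d p x l).val.nodes.length + if p ∈ l then 3 else 1 := by
      intro l hl
      induction l with
      | nil => simp
      | cons y l ihl =>
        rw [List.nodup_cons] at hl
        have h1 := ihl hl.2
        rw [growList_cons]
        by_cases h : y = p
        · subst h
          rw [if_neg hl.1] at h1
          simp only [if_true, bind_time, ret_time, bind_val, ret_val, List.mem_cons, true_or]
          omega
        · have h2 := ih x y
          simp only [h, if_false, bind_time, ret_time, bind_val, ret_val, List.mem_cons,
            Forest.nodes, List.length_cons, List.length_append, Ne.symm h, false_or]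
          split_ifs at h1 ⊢ <;> omega
    have := key _ (hA x)
    rw [grow_succ]
    split_ifs at this <;> omega

end

/-! ### Branches of an acyclic graph -/

section
variable {V : Type*} {G : SimpleGraph V}

/-- The vertices that are reached from `x` by a path that does not return to `p`. -/
def branch (G : SimpleGraph V) (p x : V) : Set V :=
  {z | ∃ w : G.Walk x z, w.IsPath ∧ p ∉ w.support.tail}

/-- In `branch` the first vertex of the path is exempt, so that `p = x` is allowed at the root.
Along an edge the exemption makes no difference. -/
theorem mem_branch_of_adj {x y z : V} (h : G.Adj x y) :
    z ∈ branch G x y ↔ ∃ w : G.Walk y z, w.IsPath ∧ x ∉ w.support := by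
  refine exists_congr fun w => and_congr_right fun _ => not_congr ?_
  constructor
  · exact List.mem_of_mem_tail
  · intro hx
    rw [← w.cons_tail_support, List.mem_cons] at hx
    exact hx.resolve_left h.ne

theorem self_mem_branch {x y : V} (h : G.Adj x y) : y ∈ branch G x y :=
  (mem_branch_of_adj h).2 ⟨.nil, .nil, by simpa using h.ne⟩

theorem notMem_branch {x y : V} (h : G.Adj x y) : x ∉ branch G x y := by
  rw [mem_branch_of_adj h]
  rintro ⟨w, -, hx⟩
  exact hx w.end_mem_support

theorem exists_walk_of_induce {s : Set V} (hs : (G.induce s).Preconnected) {x y : V} (hx : x ∈ s)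
    (hy : y ∈ s) : ∃ w : G.Walk x y, ∀ i ∈ w.support, i ∈ s := by
  obtain ⟨q⟩ := hs ⟨x, hx⟩ ⟨y, hy⟩
  refine ⟨q.map (SimpleGraph.Embedding.induce s).toHom, fun i hi => ?_⟩
  obtain ⟨j, -, rfl⟩ := List.mem_map.1
    ((SimpleGraph.Walk.support_map (SimpleGraph.Embedding.induce s).toHom q) ▸ hi)
  exact j.2

variable (hG : G.IsAcyclic)
include hG

/-- Prefixing the two paths with their edges from `x` gives two paths from `x` to `z`. In an acyclic
graph they coincide, and so do their second vertices. -/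
theorem branch_unique {x y y' z : V} (h : G.Adj x y) (h' : G.Adj x y') (hz : z ∈ branch G x y)
    (hz' : z ∈ branch G x y') : y = y' := by
  obtain ⟨w, hw, hx⟩ := (mem_branch_of_adj h).1 hz
  obtain ⟨w', hw', hx'⟩ := (mem_branch_of_adj h').1 hz'
  have e := congrArg Subtype.val (Subsingleton.elim (h := hG.subsingleton_path x z)
    ⟨.cons h w, hw.cons hx⟩ ⟨.cons h' w', hw'.cons hx'⟩)
  simpa using congrArg SimpleGraph.Walk.snd e

/-- Otherwise `a` would belong to two branches at `x`: its own, and that of `y`. -/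
theorem eq_of_mem_support {x y z a : V} (h : G.Adj x y) (w : G.Walk y z) (hw : x ∉ w.support)
    (ha : G.Adj x a) (haw : a ∈ w.support) : a = y := by
  classical
  refine branch_unique hG ha h (self_mem_branch ha) ((mem_branch_of_adj h).2
    ⟨(w.takeUntil a haw).bypass, SimpleGraph.Walk.bypass_isPath _, fun hx => hw ?_⟩)
  exact w.support_takeUntil_subset_support haw (SimpleGraph.Walk.support_bypass_subset_support _ hx)

theorem branch_subset {p x y : V} (hp : p = x ∨ G.Adj x p) (h : G.Adj x y) (hy : y ≠ p) :
    branch G x y ⊆ branch G p x \ {x} := by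
  intro z hz
  refine ⟨?_, fun e => notMem_branch h (e ▸ hz)⟩
  obtain ⟨w, hw, hx⟩ := (mem_branch_of_adj h).1 hz
  refine ⟨.cons h w, hw.cons hx, ?_⟩
  rw [SimpleGraph.Walk.support_cons, List.tail_cons]
  rcases hp with rfl | hp
  · exact hx
  · exact fun hpw => hy (eq_of_mem_support hG h w hx hp hpw).symm

/-- The only path from `x` to `z` runs through `y`, and a connected set containing both ends
contains this path. -/
theorem branch_crossing {s : Set V} (hs : (G.induce s).Preconnected) {x y z : V} (h : G.Adj x y)
    (hz : z ∈ branch G x y) (hxs : x ∈ s) (hzs : z ∈ s) : y ∈ s := by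
  classical
  obtain ⟨w, hw, hx⟩ := (mem_branch_of_adj h).1 hz
  obtain ⟨q, hq⟩ := exists_walk_of_induce hs hxs hzs
  have e := congrArg Subtype.val (Subsingleton.elim (h := hG.subsingleton_path x z)
    ⟨.cons h w, hw.cons hx⟩ q.toPath)
  refine hq y (SimpleGraph.Walk.support_bypass_subset_support _ ?_)
  change (SimpleGraph.Walk.cons h w : G.Walk x z) = SimpleGraph.Walk.bypass _ at e
  rw [← e, SimpleGraph.Walk.support_cons]
  exact List.mem_cons_of_mem _ w.start_mem_support

/-- Going from `y` to `z`, inside `s` to `z'`, and back to `y'` would avoid `x` if `x` were not in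
`s`, and so bypass the separation of the two branches. -/
theorem branch_meeting {s : Set V} (hs : (G.induce s).Preconnected) {x y y' z z' : V}
    (h : G.Adj x y) (h' : G.Adj x y') (hy : y ≠ y') (hz : z ∈ branch G x y)
    (hz' : z' ∈ branch G x y') (hzs : z ∈ s) (hzs' : z' ∈ s) : x ∈ s := by
  obtain ⟨w, hw, hx⟩ := (mem_branch_of_adj h).1 hz
  obtain ⟨w', hw', hx'⟩ := (mem_branch_of_adj h').1 hz'
  obtain ⟨q, hq⟩ := exists_walk_of_induce hs hzs hzs'
  by_contra hxs
  refine hy (eq_of_mem_support hG h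
    ((w.append q).append w'.reverse) ?_ h'
    (SimpleGraph.Walk.end_mem_support _)).symm
  rw [SimpleGraph.Walk.mem_support_append_iff, SimpleGraph.Walk.mem_support_append_iff,
    SimpleGraph.Walk.support_reverse, List.mem_reverse]
  exact not_or.2 ⟨not_or.2 ⟨hx, fun hi => hxs (hq x hi)⟩, hx'⟩

end

/-! ### Depth-first search in a tree -/

section
variable {m : ℕ} {G : SimpleGraph (Fin m)} {A : Vector (List (Fin m)) m}
  (hA : ∀ x y, y ∈ A.get x ↔ G.Adj x y)
include hA

/-- The depth bound of the search is compared with the length of a path, which drops by one with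
each call. -/
theorem mem_grow_nodes (d : ℕ) {p x z : Fin m} (w : G.Walk x z) (hw : w.IsPath)
    (hp : p ∉ w.support.tail) (hd : w.length ≤ d) (hz : z ≠ x) :
    z ∈ (grow A d p x).val.nodes := by
  induction d generalizing p x with
  | zero =>
    cases w with
    | nil => exact absurd rfl hz
    | cons h w => simp at hd
  | succ d ih =>
    cases w with
    | nil => exact absurd rfl hz
    | @cons _ y _ h w =>
      rw [SimpleGraph.Walk.support_cons, List.tail_cons] at hp
      rw [SimpleGraph.Walk.cons_isPath_iff] at hw
      rw [SimpleGraph.Walk.length_cons] at hd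
      rw [grow_succ, mem_growList_nodes]
      refine ⟨y, (hA x y).2 h, fun e => hp (e ▸ w.start_mem_support), ?_⟩
      by_cases hzy : z = y
      · exact Or.inl hzy
      · exact Or.inr (ih w hw.1 (fun hx => hw.2 (List.mem_of_mem_tail hx)) (by omega) hzy)

variable (hG : G.IsAcyclic)
include hG

theorem grow_nodes_subset (d : ℕ) {p x : Fin m} (hp : p = x ∨ G.Adj x p) :
    ∀ z ∈ (grow A d p x).val.nodes, z ∈ branch G p x \ {x} := by
  induction d generalizing p x with
  | zero => simp [grow, Forest.nodes]
  | succ d ih =>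
    intro z hz
    rw [grow_succ, mem_growList_nodes] at hz
    obtain ⟨y, hy, hyp, hz⟩ := hz
    rw [hA] at hy
    refine branch_subset hG hp hy hyp ?_
    rcases hz with rfl | hz
    · exact self_mem_branch hy
    · exact (ih (Or.inr hy.symm) z hz).1

theorem grow_nodup (hA' : ∀ x, (A.get x).Nodup) (d : ℕ) {p x : Fin m}
    (hp : p = x ∨ G.Adj x p) : (grow A d p x).val.nodes.Nodup := by
  induction d generalizing p x with
  | zero => simp [grow, Forest.nodes]
  | succ d ih =>
    have key : ∀ l : List (Fin m), l.Nodup → (∀ y ∈ l, G.Adj x y) →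
        (growList A d p x l).val.nodes.Nodup := by
      intro l hl hx
      induction l with
      | nil => simp [Forest.nodes]
      | cons y l ihl =>
        rw [List.nodup_cons] at hl
        rw [List.forall_mem_cons] at hx
        rw [growList_cons]
        by_cases h : y = p
        · simpa [h] using ihl hl.2 hx.2
        · have hsub := grow_nodes_subset hA hG d (p := x) (x := y) (Or.inr hx.1.symm)
          have hl' : ∀ z ∈ (growList A d p x l).val.nodes, z ∉ branch G x y := by
            intro z hz hzy
            obtain ⟨y', hy', -, hz⟩ := (mem_growList_nodes A d p x z l).1 hz
            refine hl.1 ?_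
            rw [branch_unique hG hx.1 (hx.2 y' hy') hzy ?_]
            · exact hy'
            · rcases hz with rfl | hz
              · exact self_mem_branch (hx.2 _ hy')
              · exact (grow_nodes_subset hA hG d (Or.inr (hx.2 y' hy').symm) z hz).1
          simp only [h, if_false, bind_val, ret_val, Forest.nodes, List.nodup_cons, List.mem_append,
            List.nodup_append', not_or]
          refine ⟨⟨fun hy => (hsub y hy).2 rfl, fun hy => hl' y hy (self_mem_branch hx.1)⟩,
            ih (Or.inr hx.1.symm), ihl hl.2 hx.2, fun z hz hz' => hl' z hz' (hsub z hz).1⟩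
    rw [grow_succ]
    exact key _ (hA' x) fun y => (hA x y).1

/-- The two intersection conditions at a node are `branch_crossing` for the edge to a child and
`branch_meeting` for two different children, applied to the connected set of the nodes containing a
given vertex. -/
theorem grow_runInt {V : Type*} (hA' : ∀ x, (A.get x).Nodup) (bag : Fin m → Set V)
    (hbag : ∀ v, (G.induce {i | v ∈ bag i}).Preconnected) (d : ℕ) {p x : Fin m}
    (hp : p = x ∨ G.Adj x p) : RunInt bag (grow A d p x).val (bag x) := by
  induction d generalizing p x with
  | zero => trivial
  | succ d ih =>
    have key : ∀ l : List (Fin m), l.Nodup → (∀ y ∈ l, G.Adj x y) →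
        RunInt bag (growList A d p x l).val (bag x) := by
      intro l hl hx
      induction l with
      | nil => trivial
      | cons y l ihl =>
        rw [List.nodup_cons] at hl
        rw [List.forall_mem_cons] at hx
        rw [growList_cons]
        by_cases h : y = p
        · simpa [h] using ihl hl.2 hx.2
        · have hsub := grow_nodes_subset hA hG d (p := x) (x := y) (Or.inr hx.1.symm)
          simp only [h, if_false, bind_val, ret_val]
          refine ⟨?_, ?_, ih (Or.inr hx.1.symm), ihl hl.2 hx.2⟩
          · rintro v ⟨⟨i, hi, hvi⟩, hvx⟩
            exact branch_crossing hG (hbag v) hx.1 (hsub i hi).1 hvx hvi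
          · rintro v ⟨hv, i', hi', hvi'⟩
            obtain ⟨i, hi, hvi⟩ : ∃ i ∈ branch G x y, v ∈ bag i := by
              rcases hv with hv | ⟨i, hi, hvi⟩
              · exact ⟨y, self_mem_branch hx.1, hv⟩
              · exact ⟨i, (hsub i hi).1, hvi⟩
            obtain ⟨y', hy', -, hz⟩ := (mem_growList_nodes A d p x i' l).1 hi'
            refine branch_meeting hG (hbag v) hx.1 (hx.2 y' hy') (fun e => hl.1 (e ▸ hy')) hi ?_
              hvi hvi'
            rcases hz with rfl | hz
            · exact self_mem_branch (hx.2 _ hy')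
            · exact (grow_nodes_subset hA hG d (Or.inr (hx.2 y' hy').symm) _ hz).1
    rw [grow_succ]
    exact key _ (hA' x) fun y => (hA x y).1

end

/-- Depth `m` suffices, since a path visits no node twice. The search enters the root from itself;
as there are no loops, no neighbour is skipped there. -/
theorem rootTree_spec {m : ℕ} {V : Type*} (G : SimpleGraph (Fin m)) (hG : G.IsTree)
    (edges : List (Fin m × Fin m)) (hes : (edges.map fun e => s(e.1, e.2)).Nodup)
    (hmem : ∀ i j, s(i, j) ∈ edges.map (fun e => s(e.1, e.2)) ↔ G.Adj i j)
    (bag : Fin m → Set V) (hbag : ∀ v, (G.induce {i | v ∈ bag i}).Preconnected) :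
    RunInt bag (rootTree edges).val ∅ ∧ (∀ i, i ∈ (rootTree edges).val.nodes) ∧
    (rootTree edges).val.nodes.length ≤ m ∧ (rootTree edges).time ≤ 20 * m ∧ 1 ≤ m := by
  classical
  have hm : 0 < m := by
    obtain ⟨i⟩ := hG.connected.nonempty
    exact i.pos
  obtain ⟨a1, a2, a3⟩ := adjacency_spec edges hes fun e he =>
    ((hmem e.1 e.2).1 (List.mem_map.2 ⟨e, he, rfl⟩)).ne
  set A := (adjacency edges).val with hAdef
  have hA : ∀ x y, y ∈ A.get x ↔ G.Adj x y := fun x y => (a1 x y).trans (hmem x y)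
  set r : Fin m := ⟨0, hm⟩ with hr
  have hval : (rootTree edges).val = .node r (grow A m r r).val .nil := by
    simp [rootTree, hm, hAdef, hr]
  have htime : (rootTree edges).time = (adjacency edges).time + (grow A m r r).time + 3 := by
    simp only [rootTree, hm, dif_pos, bind_time, ret_time, ← hAdef, ← hr]
    ring
  have hnodup := grow_nodup hA hG.isAcyclic a2 m (p := r) (x := r) (Or.inl rfl)
  have hsub := grow_nodes_subset hA hG.isAcyclic m (p := r) (x := r) (Or.inl rfl)
  have hlen : (rootTree edges).val.nodes.length ≤ m := by
    have : (rootTree edges).val.nodes.Nodup := by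
      rw [hval]
      simp only [Forest.nodes, List.append_nil, List.nodup_cons]
      exact ⟨fun h => (hsub r h).2 rfl, hnodup⟩
    simpa using this.length_le_card
  refine ⟨?_, fun i => ?_, hlen, ?_, hm⟩
  · rw [hval]
    exact ⟨by simp, by simp, grow_runInt hA hG.isAcyclic a2 bag hbag m (Or.inl rfl), trivial⟩
  · rw [hval]
    simp only [Forest.nodes, List.append_nil, List.mem_cons]
    by_cases hi : i = r
    · exact Or.inl hi
    · obtain ⟨w⟩ := hG.connected.preconnected r i
      refine Or.inr (mem_grow_nodes hA m w.bypass w.bypass_isPath ?_ ?_ hi)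
      · have := w.bypass_isPath.support_nodup
        rw [← SimpleGraph.Walk.cons_tail_support, List.nodup_cons] at this
        exact this.1
      · simpa using w.bypass_isPath.length_lt.le
  · have h1 := grow_time A a2 m r r
    -- A tree on `m` nodes has `m - 1` edges, each listed once; so the adjacency lists are paid by
    -- the nodes.
    have h2 : edges.length + 1 ≤ m := by
      have h3 := hG.card_edgeFinset
      rw [Fintype.card_fin] at h3
      have h4 : (edges.map fun e => s(e.1, e.2)).toFinset ⊆ G.edgeFinset := by
        intro e he
        rw [List.mem_toFinset] at he
        induction e with
        | _ i j => exact SimpleGraph.mem_edgeFinset.2 ((hmem i j).1 he)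
      have h5 := Finset.card_le_card h4
      rw [List.toFinset_card_of_nodup hes, List.length_map] at h5
      omega
    rw [hval] at hlen
    simp only [Forest.nodes, List.append_nil, List.length_cons] at hlen
    rw [htime, a3]
    omega


/-! ## From forms to matrices -/

section
open Matrix
variable {n : ℕ} {F : Type*} [Field F]

/-- Polarization: unit vectors give the diagonal entries, and sums of two of them give twice the
others. -/
theorem eq_of_quadratic_eq (h2 : (2 : F) ≠ 0) {A B : Matrix (Fin n) (Fin n) F} (hA : A.IsSymm)
    (hB : B.IsSymm) (h : ∀ x, x ⬝ᵥ A *ᵥ x = x ⬝ᵥ B *ᵥ x) : A = B := by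
  have hd : ∀ i, A i i = B i i := fun i => by simpa using h (Pi.single i 1)
  ext i j
  have hij := h (Pi.single i 1 + Pi.single j 1)
  simp only [mulVec_add, dotProduct_add, add_dotProduct, mulVec_single_one, single_one_dotProduct,
    col_apply, hd, hA.apply i j, hB.apply i j] at hij
  refine mul_left_cancel₀ h2 ?_
  linear_combination hij

/-- The matrix `P` is the transpose of that of the substitution, so it inherits determinant 1. -/
theorem exists_congruence (h2 : (2 : F) ≠ 0) {M : Matrix (Fin n) (Fin n) F} (hM : M.IsSymm)
    {W : List (Fin n)} {d : Fin n → F}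
    (h : Cg W (fun x => x ⬝ᵥ M *ᵥ x) (fun x => ∑ v, d v * x v ^ 2)) :
    ∃ P : Matrix (Fin n) (Fin n) F, P.det = 1 ∧ diagonal d = P * M * Pᵀ := by
  obtain ⟨L, hL, -, hq⟩ := h
  refine ⟨(LinearMap.toMatrix' L)ᵀ, by rw [det_transpose, LinearMap.det_toMatrix', hL], ?_⟩
  refine eq_of_quadratic_eq h2 (isSymm_diagonal d) ?_ fun x => ?_
  · rw [IsSymm, transpose_mul, transpose_mul, transpose_transpose, hM.eq, Matrix.mul_assoc]
  · rw [transpose_transpose, ← mulVec_mulVec, ← mulVec_mulVec, dotProduct_mulVec x _ᵀ,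
      vecMul_transpose, LinearMap.toMatrix'_mulVec]
    refine Eq.trans ?_ (hq x)
    rw [dotProduct]
    exact Finset.sum_congr rfl fun v _ => by rw [mulVec_diagonal]; ring

/-- The terms for `(v, u)` and `(u, v)` agree by symmetry; both are booked at the vertex of larger
label, whence the factor 2 in `vertexForm`. -/
theorem sum_vertexForm {M : Matrix (Fin n) (Fin n) F} (hM : M.IsSymm) {lab : Vector ℕ n}
    (hlab : Function.Injective lab.get) (x : Fin n → F) :
    ∑ v, vertexForm M lab v x = x ⬝ᵥ M *ᵥ x := by
  have hswap : ∑ v, ∑ u with lab.get v < lab.get u, x v * (M v u * x u) =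
      ∑ v, ∑ u with lab.get u < lab.get v, x v * (M v u * x u) := by
    simp only [Finset.sum_filter]
    rw [Finset.sum_comm]
    refine Finset.sum_congr rfl fun v _ => Finset.sum_congr rfl fun u _ => ?_
    rw [hM.apply v u]
    split_ifs <;> ring
  have hsplit : ∀ v, x v * (M *ᵥ x) v = ∑ u with lab.get u < lab.get v, x v * (M v u * x u) +
      ∑ u with lab.get v < lab.get u, x v * (M v u * x u) + x v * (M v v * x v) := by
    intro v
    rw [mulVec, dotProduct, Finset.mul_sum, Finset.sum_filter, Finset.sum_filter,
      ← Finset.sum_add_distrib, ← Finset.sum_add_sum_compl {v}, Finset.sum_singleton,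
      ← Finset.sum_add_sum_compl {v} fun u => ite _ _ _ + ite _ _ _, Finset.sum_singleton]
    simp only [lt_self_iff_false, if_false, add_zero, zero_add]
    rw [add_comm]
    congr 1
    refine Finset.sum_congr rfl fun u hu => ?_
    have huv : lab.get u ≠ lab.get v := fun e => by simp [hlab e] at hu
    rcases huv.lt_or_gt with h | h
    · rw [if_pos h, if_neg h.not_gt, add_zero]
    · rw [if_pos h, if_neg h.not_gt, zero_add]
  rw [dotProduct, Finset.sum_congr rfl fun v _ => hsplit v]
  simp only [Finset.sum_add_distrib, hswap, vertexForm]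
  rw [← two_mul, Finset.mul_sum, ← Finset.sum_add_distrib]
  refine Finset.sum_congr rfl fun v _ => ?_
  rw [← Finset.mul_sum]
  ring

theorem exists_eq_map_of_nodup {D : List (Fin n × F)} (h : (D.map Prod.fst).Nodup) :
    ∃ d : Fin n → F, D = (D.map Prod.fst).map fun v => (v, d v) := by
  induction D with
  | nil => exact ⟨0, rfl⟩
  | cons p D ih =>
    rw [List.map_cons, List.nodup_cons] at h
    obtain ⟨d, hd⟩ := ih h.2
    refine ⟨Function.update d p.1 p.2, ?_⟩
    rw [List.map_cons, List.map_cons, Function.update_self]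
    congr 1
    conv_lhs => rw [hd]
    refine List.map_congr_left fun v hv => ?_
    rw [Function.update_of_ne fun e : v = p.1 => h.1 (e ▸ hv)]

theorem diagForm_of_perm {D : List (Fin n × F)} {d : Fin n → F}
    (h : D.Perm ((List.finRange n).map fun v => (v, d v))) (x : Fin n → F) :
    diagForm D x = ∑ v, d v * x v ^ 2 := by
  rw [diagForm, (h.map _).sum_eq, List.map_map, Fin.sum_univ_def]
  rfl

/-- Charge every nonzero entry to its index of larger label. A vertex has at most `K - 1` smaller
neighbours and one diagonal entry, and symmetry doubles the count. -/
theorem entries_length_le {M : Matrix (Fin n) (Fin n) F} (hM : M.IsSymm)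
    {es : List (Fin n × Fin n × F)} (hes : es.Nodup)
    (hmem : ∀ i j a, (i, j, a) ∈ es ↔ a = M i j ∧ a ≠ 0) {lab : Vector ℕ n}
    (hlab : Function.Injective lab.get) {K : ℕ} (hK : ∀ v, ∃ B : List (Fin n), B.length + 1 ≤ K ∧
      ∀ u, M v u ≠ 0 → lab.get u < lab.get v → u ∈ B) : es.length ≤ 2 * K * n := by
  classical
  have hcard : ∀ v, (Finset.univ.filter fun u => M v u ≠ 0 ∧ lab.get u ≤ lab.get v).card ≤ K := by
    intro v
    obtain ⟨B, hB, hB'⟩ := hK v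
    refine le_trans (Finset.card_le_card (t := (v :: B).toFinset) fun u hu => ?_)
      ((List.toFinset_card_le _).trans (by simpa using hB))
    obtain ⟨-, h1, h2⟩ := Finset.mem_filter.1 hu
    rw [List.mem_toFinset, List.mem_cons]
    rcases h2.eq_or_lt with h | h
    · exact Or.inl (hlab h)
    · exact Or.inr (hB' u h1 h)
  have h1 : es.length ≤ ∑ v : Fin n, ∑ u : Fin n, if M v u ≠ 0 then 1 else 0 := by
    rw [← Finset.sum_product', ← Finset.card_filter, ← List.toFinset_card_of_nodup hes]
    refine Finset.card_le_card_of_injOn (fun e => (e.1, e.2.1)) (fun e he => ?_)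
      fun e he e' he' hee => ?_
    · obtain ⟨h, h'⟩ := (hmem _ _ _).1 (List.mem_toFinset.1 he)
      simpa [← h] using h'
    · have h := ((hmem _ _ _).1 (List.mem_toFinset.1 he)).1
      have h' := ((hmem _ _ _).1 (List.mem_toFinset.1 he')).1
      obtain ⟨hee1, hee2⟩ := Prod.mk.inj hee
      exact Prod.ext hee1 (Prod.ext hee2 (by rw [h, h', hee1, hee2]))
  have h2 : ∀ v u : Fin n, (if M v u ≠ 0 then 1 else 0) ≤
      (if M v u ≠ 0 ∧ lab.get u ≤ lab.get v then 1 else 0) +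
      if M u v ≠ 0 ∧ lab.get v ≤ lab.get u then 1 else 0 := by
    intro v u
    rw [hM.apply v u]
    rcases le_total (lab.get u) (lab.get v) with h | h <;> by_cases h' : M v u = 0 <;> simp [h, h']
  calc es.length ≤ _ := h1
    _ ≤ _ := Finset.sum_le_sum fun v _ => Finset.sum_le_sum fun u _ => h2 v u
    _ = ∑ v : Fin n, ∑ u : Fin n, (if M v u ≠ 0 ∧ lab.get u ≤ lab.get v then 1 else 0) +
        ∑ v : Fin n, ∑ u : Fin n, (if M v u ≠ 0 ∧ lab.get u ≤ lab.get v then 1 else 0) := by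
      simp only [Finset.sum_add_distrib]
      congr 1
      exact Finset.sum_comm
    _ ≤ ∑ v : Fin n, K + ∑ v : Fin n, K := by
      refine Nat.add_le_add ?_ ?_ <;>
      exact Finset.sum_le_sum fun v _ => by rw [← Finset.card_filter]; exact hcard v
    _ = 2 * K * n := by simp; ring

end

/-! ## The algorithm -/

section
variable {n m : ℕ} {F : Type*} [Field F] [DecidableEq F]

/-- An empty bag leaves no columns, so the box has neither rows nor a form, and every vertex has
reached the output. -/
theorem process_root (h2 : (2 : F) ≠ 0) {M : Matrix (Fin n) (Fin n) F} (hM : M.IsSymm)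
    {lab : Vector ℕ n} (hlab : Function.Injective lab.get) {rows : Vector (List (Fin n × F)) n}
    (hrows : RowsOK lab M rows) {K : ℕ} {t : NiceTree (Fin n)} {W : List (Fin n)}
    (ht : NiceOK lab (fun v u => M v u ≠ 0) K t [] W) (hW : W.Perm (List.finRange n)) :
    ∃ d : Fin n → F,
      (process lab rows t []).val.2.Perm ((List.finRange n).map fun v => (v, d v)) ∧
      ∃ P : Matrix (Fin n) (Fin n) F, P.det = 1 ∧ Matrix.diagonal d = P * M * P.transpose := by
  obtain ⟨D, h1, h3, h4, h5⟩ := process_spec h2 hlab hrows ht []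
  rw [List.append_nil] at h1
  have hech : (process lab rows t []).val.1.ech = [] :=
    List.eq_nil_of_length_eq_zero (by simpa using h3.ech_len)
  rw [hech, rowLabels_nil, List.nil_append] at h4
  obtain ⟨d, hd⟩ := exists_eq_map_of_nodup
    (((h4.trans hW).nodup_iff).2 (List.nodup_finRange n))
  have hD : D.Perm ((List.finRange n).map fun v => (v, d v)) := by
    rw [hd]; exact (h4.trans hW).map _
  refine ⟨d, h1 ▸ hD, exists_congruence (W := W) h2 hM ?_⟩
  refine (h5.congr_left fun x => ?_).congr_right fun x => ?_
  · rw [← sum_vertexForm hM hlab, (hW.map _).sum_eq, Fin.sum_univ_def]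
  · rw [boxForm, h3.cols, ← diagForm_of_perm hD]
    simp

theorem TreeDecomposition.card_bag_le {V : Type*} {G : SimpleGraph V}
    (T : TreeDecomposition G m) (i : Fin m) : (T.bag i).card ≤ T.width + 1 := by
  have := Finset.le_sup (f := fun i => (T.bag i).card) (Finset.mem_univ i)
  rw [TreeDecomposition.width]
  omega

/-- The surplus `4 * n + 4` in the time bound is reserved for evaluating the output: each readout
takes `2 * n + 1` steps and one for sequencing. -/
theorem congruentDiagonal_spec (h2 : (2 : F) ≠ 0) {M : Matrix (Fin n) (Fin n) F} (hM : M.IsSymm)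
    (T : TreeDecomposition (underlyingGraph M) m) (I : Input F n m) (hI : I.Encodes M T) :
    (congruentDiagonal I).time + 4 * n + 4 ≤ 5000 * bound T.width m n ∧
    ∃ d : Fin n → F, (congruentDiagonal I).val.Perm ((List.finRange n).map fun v => (v, d v)) ∧
      ∃ P : Matrix (Fin n) (Fin n) F, P.det = 1 ∧ Matrix.diagonal d = P * M * P.transpose := by
  set bag : Fin m → Set (Fin n) := fun i => {v | v ∈ T.bag i} with hbag
  obtain ⟨r1, r2, r3, r4, hm⟩ :=
    rootTree_spec T.tree T.isTree I.edges hI.edges_nodup hI.mem_edges bag T.connected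
  set R := (rootTree I.edges).val with hR
  have hbags : (fun i => {v | v ∈ I.bags.get i}) = bag :=
    funext fun i => Set.ext fun v => hI.mem_bags i v
  -- `K` bounds the bag sizes and costs at most a factor 2 against the width read as at least 1.
  -- Fixing `K = 1` for `n = 0` keeps a constant number of nice nodes from costing `K ^ 2` when the
  -- term in `n` vanishes.
  obtain ⟨K, hK1, hK, hK2, hK3⟩ : ∃ K, 1 ≤ K ∧ (∀ i, (T.bag i).card ≤ K) ∧
      K ≤ 2 * max T.width 1 ∧ (n = 0 → K = 1) := by
    refine ⟨if n = 0 then 1 else T.width + 1, by split <;> omega, fun i => ?_, ?_,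
      fun h => if_pos h⟩
    · split
      · rename_i h
        exact (Finset.card_le_univ _).trans (by simp [h])
      · exact T.card_bag_le i
    · have := le_max_left T.width 1
      have := le_max_right T.width 1
      split <;> omega
  have hlen : ∀ i, (I.bags.get i).length = (T.bag i).card := fun i => by
    rw [← List.toFinset_card_of_nodup (hI.bags_nodup i)]
    congr 1
    ext v
    simp [hI.mem_bags]
  have hverts : ∀ v, v ∈ verts bag R := fun v => by
    obtain ⟨i, hi⟩ := T.cover v
    exact ⟨i, r2 i, hi⟩
  set L₀ : Labelling n := ⟨Vector.replicate n 0, [], 0⟩ with hL₀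
  have hz : ∀ v, L₀.lab.get v = 0 := fun v => get_replicate v 0
  have hL₀' : L₀.OK := ⟨List.Pairwise.nil, fun v => by simp [hL₀], fun v => (hz v).le⟩
  obtain ⟨l1, l2, l3, l4⟩ := labelForest_spec I.bags (fun i => (hlen i).trans_le (hK i)) R L₀ hL₀'
  have l5 := labelForest_labOK I.bags R L₀ hL₀' ∅ (hbags ▸ r1) (by simp)
    (fun v _ hv => absurd (hz v) hv) _ ⟨fun _ _ => rfl, fun _ h h' => absurd h h', le_rfl⟩
  set L := (labelForest I.bags R L₀).val with hL
  have hall : ∀ v, L.lab.get v ≠ 0 := fun v => (l3 v).2 (Or.inr (hbags ▸ hverts v))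
  have hlab := l1.injective hall
  obtain ⟨s1, s2, s3⟩ := sortBags_spec I.bags hI.bags_nodup L l1 hall
  obtain ⟨q1, q2⟩ := sortRows_spec M I.entries hI.entries_nodup hI.mem_entries L l1 hall
  set bags := (sortBags I.bags L.order).val with hbags'
  set rows := (sortRows I.entries L.order).val with hrows
  have hbags₂ : (fun i => {v | v ∈ bags.get i}) = bag :=
    funext fun i => Set.ext fun v => (s2 i v).trans (hI.mem_bags i v)
  have hdec : DecompOK bag L.lab.get (fun v u => M v u ≠ 0) R ∅ := by
    refine ⟨r1, hbags ▸ l5, fun v _ _ u hvu => ?_⟩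
    by_cases huv : v = u
    · subst huv
      obtain ⟨i, hi⟩ := T.cover v
      exact ⟨i, r2 i, hi, hi⟩
    · obtain ⟨i, hi⟩ := T.edge v u ((SimpleGraph.fromRel_adj _ _ _).2 ⟨huv, Or.inl hvu⟩)
      exact ⟨i, r2 i, hi⟩
  have hlen₂ : ∀ i, (bags.get i).length ≤ K := fun i => by
    rw [← List.toFinset_card_of_nodup (nodup_of_sorted (s1 i))]
    refine le_trans (Finset.card_le_card fun v hv => ?_) (hK i)
    rwa [List.mem_toFinset, s2, hI.mem_bags] at hv
  obtain ⟨W, t1, t2, t3, t4⟩ := niceTree_spec hlab hK1 bags s1 hlen₂ R (hbags₂ ▸ hdec)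
  have hW : W.Perm (List.finRange n) :=
    (List.perm_ext_iff_of_nodup t1.nodup (List.nodup_finRange n)).2 fun v => by
      simp only [List.mem_finRange, iff_true]
      exact (t2 v).2 (hbags₂ ▸ hverts v)
  have hWn : W.length = n := by simpa using hW.length_eq
  have hval : (congruentDiagonal I).val =
      (process L.lab rows (niceTree bags R).val []).val.2 := rfl
  refine ⟨?_, hval ▸ process_root h2 hM hlab q1 t1 hW⟩
  have htime : (congruentDiagonal I).time = (rootTree I.edges).time + (labelForest I.bags R L₀).time
      + (sortBags I.bags L.order).time + (sortRows I.entries L.order).time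
      + (niceTree bags R).time + (process L.lab rows (niceTree bags R).val []).time + n + 9 := by
    simp only [congruentDiagonal, bind_time, ret_time, newArray_time, newArray_val, ← hR, ← hL₀,
      ← hL, ← hbags', ← hrows]
    ring
  have p1 := process_time h2 hlab q1 hK1 t1 []
  have p2 : I.entries.length ≤ 2 * K * n :=
    entries_length_le hM hI.entries_nodup hI.mem_entries hlab fun v =>
      t1.exists_bag v ((t2 v).2 (hbags₂ ▸ hverts v))
  have p3 : total I.bags ≤ m * K := by
    refine (Finset.sum_le_card_nsmul _ _ K fun i _ => (hlen i).trans_le (hK i)).trans ?_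
    simp
  -- The nice tree has at most `4 * n + 1` nodes. For `n > 0` the extra node is absorbed into `5 *
  -- n`; for `n = 0` it is paid by `m ≥ 1`.
  have p4 : 200 * (K * K) * (niceTree bags R).val.size ≤ 1000 * (K * K * n) + 200 * m := by
    rw [hWn] at t3
    refine (Nat.mul_le_mul_left _ t3).trans ?_
    rcases Nat.eq_zero_or_pos n with h | h
    · rw [hK3 h, h]; omega
    · have : K * K ≤ K * K * n := Nat.le_mul_of_pos_right _ h
      nlinarith
  have p5 : (2 * K + 4) * R.nodes.length ≤ (2 * K + 4) * m := Nat.mul_le_mul_left _ r3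
  have p6 : 50 * K * R.nodes.length ≤ 50 * K * m := Nat.mul_le_mul_left _ r3
  set k := max T.width 1 with hk
  have hk1 : 1 ≤ k := le_max_right _ _
  have p7 : K * m ≤ 2 * (k * m) := (Nat.mul_le_mul_right m hK2).trans_eq (by ring)
  have p8 : m ≤ k * m := Nat.le_mul_of_pos_left m hk1
  have p9 : K * K * n ≤ 4 * (k ^ 2 * n) :=
    (Nat.mul_le_mul_right n (Nat.mul_le_mul hK2 hK2)).trans_eq (by ring)
  have p10 : n ≤ k ^ 2 * n := Nat.le_mul_of_pos_left n (by positivity)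
  have p11 : K * n ≤ K * K * n := Nat.mul_le_mul_right n (Nat.le_mul_self K)
  rw [bound, ← hk, htime]
  ring_nf at *
  omega

end

/-! ## Determinant, rank and inertia -/

section
variable {V F : Type*} [Field F]

theorem prodDiag_spec (D : List (V × F)) :
    (prodDiag D).val = (D.map Prod.snd).prod ∧ (prodDiag D).time = 2 * D.length + 1 := by
  induction D with
  | nil => simp [prodDiag]
  | cons p D ih =>
    refine ⟨by simp [prodDiag, ih.1], ?_⟩
    simp only [prodDiag, bind_time, ret_time, ih.2, List.length_cons]
    ring

theorem countDiag_spec [DecidableEq F] (D : List (V × F)) :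
    (countDiag D).val = (D.map Prod.snd).countP (· ≠ 0) ∧
    (countDiag D).time = 2 * D.length + 1 := by
  induction D with
  | nil => simp [countDiag]
  | cons p D ih =>
    refine ⟨?_, ?_⟩
    · simp only [countDiag, bind_val, ret_val, ih.1, List.map_cons, List.countP_cons]
      by_cases h : p.2 = 0 <;> simp [h]
    · simp only [countDiag, bind_time, ret_time, ih.2, List.length_cons]
      ring

theorem signDiag_spec [LinearOrder F] (D : List (V × F)) :
    (signDiag D).val = ((D.map Prod.snd).countP (0 < ·), (D.map Prod.snd).countP (· < 0),
      (D.map Prod.snd).countP (· = 0)) ∧ (signDiag D).time = 2 * D.length + 1 := by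
  induction D with
  | nil => simp [signDiag]
  | cons p D ih =>
    refine ⟨?_, ?_⟩
    · simp only [signDiag, bind_val, ret_val, ih.1, List.map_cons, List.countP_cons]
      rcases lt_trichotomy p.2 0 with h | h | h
      · simp [h, h.not_gt, h.ne]
      · simp [h]
      · simp [h, h.not_gt, h.ne']
    · simp only [signDiag, bind_time, ret_time, ih.2, List.length_cons]
      ring

end

theorem countP_map_finRange {n : ℕ} {α : Type*} (d : Fin n → α) (p : α → Prop) [DecidablePred p] :
    ((List.finRange n).map d).countP (p ·) = (Finset.univ.filter fun v => p (d v)).card := by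
  rw [List.countP_map, List.countP_eq_length_filter, Finset.card_def, Finset.filter_val,
    Fin.univ_def]
  rfl

/-! ### Sylvester's law of inertia -/

section
open Matrix QuadraticMap
variable {n : ℕ}

/-- The equivalence is the substitution `x ↦ Qᵀ x`, invertible because `Q` is. -/
theorem equivalent_weightedSumSquares {d e : Fin n → ℝ} {Q : Matrix (Fin n) (Fin n) ℝ}
    (hQ : IsUnit Q.det) (h : diagonal d = Q * diagonal e * Qᵀ) :
    Equivalent (weightedSumSquares ℝ d) (weightedSumSquares ℝ e) := by
  have hw : ∀ (w x : Fin n → ℝ), weightedSumSquares ℝ w x = x ⬝ᵥ diagonal w *ᵥ x := by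
    intro w x
    rw [weightedSumSquares_apply, dotProduct]
    exact Finset.sum_congr rfl fun v _ => by rw [mulVec_diagonal, smul_eq_mul]; ring
  refine ⟨⟨Matrix.toLinearEquiv' Qᵀ ((Matrix.isUnit_iff_isUnit_det _).2
    (by rwa [det_transpose])).invertible, fun x => ?_⟩⟩
  rw [hw, hw, h, ← mulVec_mulVec, ← mulVec_mulVec, dotProduct_mulVec x Q, ← mulVec_transpose]
  rfl

/-- Sylvester's law of inertia for a matrix that is congruent to a diagonal matrix. -/
theorem inertia_eq_of_congruent {M P : Matrix (Fin n) (Fin n) ℝ} (hM : M.IsSymm)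
    (hP : IsUnit P.det) {d : Fin n → ℝ} (h : diagonal d = P * M * Pᵀ) :
    inertia M = ((Finset.univ.filter fun v => 0 < d v).card,
      (Finset.univ.filter fun v => d v < 0).card, (Finset.univ.filter fun v => d v = 0).card) := by
  have hH : M.IsHermitian := by rw [IsHermitian, conjTranspose_eq_transpose_of_trivial, hM.eq]
  set e := hH.eigenvalues with he
  set U : Matrix (Fin n) (Fin n) ℝ := (hH.eigenvectorUnitary).1 with hU
  -- The spectral theorem makes `M` congruent to the diagonal matrix of its eigenvalues, so the
  -- weights `d` and `e` describe equivalent forms.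
  have hspec : M = U * diagonal e * Uᵀ := by
    conv_lhs => rw [hH.spectral_theorem, Unitary.conjStarAlgAut_apply]
    rw [star_eq_conjTranspose, conjTranspose_eq_transpose_of_trivial]
    rfl
  have hUdet : IsUnit U.det := by
    rw [← Matrix.isUnit_iff_isUnit_det]
    exact (Unitary.toUnits hH.eigenvectorUnitary).isUnit
  have hequiv : Equivalent (weightedSumSquares ℝ d) (weightedSumSquares ℝ e) := by
    refine equivalent_weightedSumSquares (Q := P * U) (by rw [det_mul]; exact hP.mul hUdet) ?_
    rw [h, transpose_mul]
    conv_lhs => rw [hspec]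
    simp only [Matrix.mul_assoc]
  have hroots : M.charpoly.roots = Finset.univ.val.map e := hH.roots_charpoly_eq_eigenvalues
  have hcount : ∀ (p : ℝ → Prop) [DecidablePred p],
      M.charpoly.roots.countP p = (Finset.univ.filter fun v => p (e v)).card := by
    intro p _
    rw [hroots, Multiset.countP_map, Finset.card_def, Finset.filter_val]
  have hncard : ∀ (p : Fin n → Prop) [DecidablePred p],
      {v | p v}.ncard = (Finset.univ.filter p).card := by
    intro p _
    rw [← Set.ncard_coe_finset]
    simp
  have hpos : (Finset.univ.filter fun v => 0 < e v).card =
      (Finset.univ.filter fun v => 0 < d v).card := by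
    rw [← hncard, ← hncard, ← QuadraticForm.sigPos_weightedSumSquares,
      ← QuadraticForm.sigPos_weightedSumSquares, hequiv.sigPos_eq]
  have hneg : (Finset.univ.filter fun v => e v < 0).card =
      (Finset.univ.filter fun v => d v < 0).card := by
    rw [← hncard, ← hncard, ← QuadraticForm.sigNeg_weightedSumSquares,
      ← QuadraticForm.sigNeg_weightedSumSquares, hequiv.sigNeg_eq]
  -- The three counts add up to `n`, so agreement of the positive and negative counts forces that of
  -- the zeros.
  have hsum : ∀ w : Fin n → ℝ, (Finset.univ.filter fun v => 0 < w v).card +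
      (Finset.univ.filter fun v => w v < 0).card +
      (Finset.univ.filter fun v => w v = 0).card = n := by
    intro w
    simp only [Finset.card_filter, ← Finset.sum_add_distrib]
    rw [Finset.sum_congr rfl (g := fun _ => 1)]
    · simp
    · intro v _
      rcases lt_trichotomy (w v) 0 with h | h | h
      · simp [h, h.not_gt, h.ne]
      · simp [h]
      · simp [h, h.not_gt, h.ne']
  have h1 := hsum d
  have h2 := hsum e
  have hzero : M.charpoly.roots.count 0 = (Finset.univ.filter fun v => e v = 0).card := by
    rw [Multiset.count, hcount]
    simp only [eq_comm]
  rw [inertia, hcount, hcount, hzero, hpos, hneg]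
  congr 2
  omega

end

theorem congruentDiagonal_det_rank {F : Type*} [Field F] [DecidableEq F] (h2 : (2 : F) ≠ 0)
    {n m : ℕ} {M : Matrix (Fin n) (Fin n) F} (hM : M.IsSymm)
    (T : TreeDecomposition (underlyingGraph M) m) (I : Input F n m) (hI : I.Encodes M T) :
    ((congruentDiagonal I).time ≤ 5000 * bound T.width m n ∧
      ∃ d : Fin n → F,
        (congruentDiagonal I).val.Perm ((List.finRange n).map fun v => (v, d v)) ∧
        ∃ P : Matrix (Fin n) (Fin n) F,
          IsUnit P.det ∧ Matrix.diagonal d = P * M * P.transpose) ∧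
    ((detAlg I).time ≤ 5000 * bound T.width m n ∧ (detAlg I).val = M.det) ∧
    ((rankAlg I).time ≤ 5000 * bound T.width m n ∧ (rankAlg I).val = M.rank) := by
  obtain ⟨ht, d, hd, P, hP, hPM⟩ := congruentDiagonal_spec h2 hM T I hI
  have hu : IsUnit P.det := by rw [hP]; exact isUnit_one
  have hlen : (congruentDiagonal I).val.length = n := by simpa using hd.length_eq
  have hsnd : ((congruentDiagonal I).val.map Prod.snd).Perm ((List.finRange n).map d) := by
    simpa [Function.comp_def] using hd.map Prod.snd
  refine ⟨⟨by omega, d, hd, P, hu, hPM⟩, ⟨?_, ?_⟩, ?_, ?_⟩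
  · simp only [detAlg, bind_time, (prodDiag_spec _).2, hlen]
    omega
  · simp only [detAlg, bind_val, (prodDiag_spec _).1]
    rw [hsnd.prod_eq, ← Fin.prod_univ_def, ← Matrix.det_diagonal, hPM, Matrix.det_mul,
      Matrix.det_mul, Matrix.det_transpose, hP, one_mul, mul_one]
  · simp only [rankAlg, bind_time, (countDiag_spec _).2, hlen]
    omega
  · simp only [rankAlg, bind_val, (countDiag_spec _).1]
    rw [hsnd.countP_eq, countP_map_finRange, ← Fintype.card_subtype, ← Matrix.rank_diagonal, hPM,
      Matrix.rank_mul_eq_left_of_isUnit_det _ _ (by rwa [Matrix.det_transpose]),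
      Matrix.rank_mul_eq_right_of_isUnit_det _ _ hu]

/-- Here signs are only counted, so the order need not be compatible with the field operations.
Order enters seriously only over the reals. -/
theorem inertiaAlg_sign_count {F : Type*} [Field F] [LinearOrder F] (h2 : (2 : F) ≠ 0)
    {n m : ℕ} {M : Matrix (Fin n) (Fin n) F} (hM : M.IsSymm)
    (T : TreeDecomposition (underlyingGraph M) m) (I : Input F n m) (hI : I.Encodes M T) :
    (inertiaAlg I).time ≤ 5000 * bound T.width m n ∧
    ∃ (d : Fin n → F) (P : Matrix (Fin n) (Fin n) F), P.det = 1 ∧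
      Matrix.diagonal d = P * M * P.transpose ∧
      (inertiaAlg I).val = ((Finset.univ.filter fun v => 0 < d v).card,
        (Finset.univ.filter fun v => d v < 0).card,
        (Finset.univ.filter fun v => d v = 0).card) := by
  obtain ⟨ht, d, hd, P, hP, hPM⟩ := congruentDiagonal_spec h2 hM T I hI
  have hlen : (congruentDiagonal I).val.length = n := by simpa using hd.length_eq
  have hsnd : ((congruentDiagonal I).val.map Prod.snd).Perm ((List.finRange n).map d) := by
    simpa [Function.comp_def] using hd.map Prod.snd
  refine ⟨?_, d, P, hP, hPM, ?_⟩
  · simp only [inertiaAlg, bind_time, (signDiag_spec _).2, hlen]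
    omega
  · simp only [inertiaAlg, bind_val, (signDiag_spec _).1]
    rw [hsnd.countP_eq, hsnd.countP_eq, hsnd.countP_eq, countP_map_finRange,
      countP_map_finRange, countP_map_finRange]

theorem inertiaAlg_spec {K : Subfield ℝ} {n m : ℕ} {M : Matrix (Fin n) (Fin n) K} (hM : M.IsSymm)
    (T : TreeDecomposition (underlyingGraph M) m) (I : Input K n m) (hI : I.Encodes M T) :
    (inertiaAlg I).time ≤ 5000 * bound T.width m n ∧
    (inertiaAlg I).val = inertia (M.map K.subtype) := by
  obtain ⟨ht, d, P, hP, hPM, hval⟩ := inertiaAlg_sign_count two_ne_zero hM T I hI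
  -- The congruence is carried to the reals, where eigenvalues and Sylvester's law are available;
  -- the inclusion of the subfield preserves signs.
  have hreal : Matrix.diagonal (fun v => (d v : ℝ)) =
      P.map K.subtype * M.map K.subtype * (P.map K.subtype).transpose := by
    rw [← Matrix.transpose_map, ← Matrix.map_mul, ← Matrix.map_mul, ← hPM,
      Matrix.diagonal_map (map_zero _)]
    rfl
  have hdet : IsUnit (P.map K.subtype).det := by
    have := RingHom.map_det K.subtype P
    rw [hP, map_one] at this
    exact this ▸ isUnit_one
  refine ⟨ht, ?_⟩
  rw [hval, inertia_eq_of_congruent (hM.map _) hdet hreal]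
  simp only [← Subtype.coe_lt_coe, ← Subtype.coe_inj, ZeroMemClass.coe_zero]

end CongDiag

theorem theorem1 : ∃ C : ℕ,
    (∀ (F : Type*) [Field F] [DecidableEq F], (2 : F) ≠ 0 →
      ∀ (n m : ℕ) (M : Matrix (Fin n) (Fin n) F), M.IsSymm →
      ∀ (T : CongDiag.TreeDecomposition (CongDiag.underlyingGraph M) m) (I : CongDiag.Input F n m),
        I.Encodes M T →
        ((CongDiag.congruentDiagonal I).time ≤ C * CongDiag.bound T.width m n ∧
          ∃ d : Fin n → F,
            (CongDiag.congruentDiagonal I).val.Perm ((List.finRange n).map fun v => (v, d v)) ∧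
            ∃ P : Matrix (Fin n) (Fin n) F,
              IsUnit P.det ∧ Matrix.diagonal d = P * M * P.transpose) ∧
        ((CongDiag.detAlg I).time ≤ C * CongDiag.bound T.width m n ∧
          (CongDiag.detAlg I).val = M.det) ∧
        ((CongDiag.rankAlg I).time ≤ C * CongDiag.bound T.width m n ∧
          (CongDiag.rankAlg I).val = M.rank)) ∧
    (∀ (K : Subfield ℝ) (n m : ℕ) (M : Matrix (Fin n) (Fin n) K), M.IsSymm →
      ∀ (T : CongDiag.TreeDecomposition (CongDiag.underlyingGraph M) m) (I : CongDiag.Input K n m),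
        I.Encodes M T →
        (CongDiag.inertiaAlg I).time ≤ C * CongDiag.bound T.width m n ∧
        (CongDiag.inertiaAlg I).val = CongDiag.inertia (M.map K.subtype)) := by
  exact ⟨5000, fun F _ _ h2 n m M hM T I hI => CongDiag.congruentDiagonal_det_rank h2 hM T I hI,
    fun K n m M hM T I hI => CongDiag.inertiaAlg_spec hM T I hI⟩
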